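/- **Setting.** Let $P>0$, $\sigma_1,\sigma_2>0$, $|r|\le 1$, $\tilde\sigma\ge 0$ and $\tilde P>\tilde\sigma^2$, and put $$\Sigma=\begin{pmatrix}\sigma_1^2& r\sigma_1\sigma_2\\ r\sigma_1\sigma_2&\sigma_2^2\end{pmatrix},\qquad P_{eq}=P\Bigl(1-\frac{\tilde\sigma^2}{\tilde P}\Bigr),\qquad \Sigma_{eq}=\Sigma+\tilde\sigma^2\frac{P}{\tilde P}\begin{pmatrix}1&1\\1&1\end{pmatrix}.$$ *Setup 1 (AWGN broadcast channel with AWGN multiple-access feedback).* In round $t$ Terminal A sends $X_t$, terminal $B_i$ ($i=1,2$) receives $Y_{i,t}=X_t+Z_{i,t}$, the terminals $B_i$ send $\tilde X_{i,t}$, and A receives $\tilde Y_t=\tilde X_{1,t}+\tilde X_{2,t}+\tilde Z_t$. The pairs $(Z_{1,t},Z_{2,t})$ are i.i.d. $\mathcal N(0,\Sigma)$, the $\tilde Z_t$ are i.i.d. $\mathcal N(0,\tilde\sigma^2)$, and the two noise processes are independent. The messages $W_1,W_2$ are independent and uniform on finite sets of sizes $M_1,M_2$. A scheme of length $N$ consists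 of measurable functions $X_t=\varphi_t(W_1,W_2,\tilde Y^{t-1})$ and $\tilde X_{i,t}=\tilde\varphi_{i,t}(Y_i^t)$, which may also depend on common randomness; it has to satisfy $\sum_{t\le N}\mathbb E X_t^2\le NP$ and $\sum_{t\le N}\mathbb E\tilde X_{i,t}^2\le N\tilde P$. Its rates are $\log_2 M_i/N$, and its error probability is the probability that at least one $B_i$ errs in decoding $W_i$ (from $Y_i^N$ and the common randomness) under the optimal decision rule. A pair $(R_1,R_2)$ with $R_i\ge 0$ is achievable over Setup 1 if for every $\varepsilon>0$ and all sufficiently large $N$ there is a scheme of length $N$ with rates at least $R_i-\varepsilon$ and error probability at most $\varepsilon$. *Setup 2* is the broadcast channel with noise covariance $\Sigma_{eq}$, power $P_{eq}$, and noiseless feedback: $X_n$ may depend on $W_1,W_2,Y_1^{n-1},Y_2^{n-1}$ (and common randomness). A *linear feedback code (LFC)* has $X_n=\Theta_n-F_{1,n}-F_{2,n}$, where $\Theta_n$ is a function of the messages (and of a common random seed $U\sim\mathcal N(0,1)$) and $F_{i,n}$ is a fixed linear combination of $Y_{i,1},\dots,Y_{i,n-1}$. Let $\bar\Theta_n$ denote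 the value of $X_n$ when all the noises are $0$. *The Ozarow–Leung (OL) scheme* for power $p$ and noise covariance $S$, with parameters $g\ge 0$ and $\kappa_1,\kappa_2\in\mathbb R$. The message $W_i$ (with $M_i\ge 2$ values) is mapped to a point $\theta_i$ of a zero-mean, unit-variance set of $M_i$ equidistant points. Then $X_1=\sqrt p\,\theta_1$, $X_2=\sqrt p\,\theta_2$, and the estimates after step $2$ are $\hat\theta_1=Y_{1,1}/\sqrt p+\kappa_1U$ and $\hat\theta_2=Y_{2,2}/\sqrt p+\kappa_2U$. With $\epsilon_i=\hat\theta_i-\theta_i$ the current errors (as functions of the noises and $U$, with $U$ random), $\alpha_i$ their variances and $\rho$ their correlation coefficient for noise covariance $S$, each later transmission is $$X_n=\sqrt{\frac{p}{1+g^2+2g|\rho|}}\left(\frac{\epsilon_1}{\sqrt{\alpha_1}}+g\,\mathrm{sgn}(\rho)\frac{\epsilon_2}{\sqrt{\alpha_2}}\right),\qquad \mathrm{sgn}(0)=1,$$ and receiver $i$ subtracts from $\hat\theta_i$ the linear minimum mean square error estimate of $\epsilon_i$ given $Y_{i,n}$. After the last step it decides for the point nearest to $\hat\theta_i$. The parameters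 $\kappa_i$ set the initial correlation of the errors; $\kappa_1=\kappa_2=0$ means no seed. This scheme is an LFC. For fixed $(g,\kappa)$, let $\mathcal R_{OL}(g,\kappa)$ be the set of pairs $(R_1,R_2)$ with $R_i\ge0$ such that for every $\varepsilon>0$ and all sufficiently large $N$ there are $M_1,M_2\ge2$ for which the OL scheme of length $N$ for $(P_{eq},\Sigma_{eq})$, used over Setup 2, has rates $\log_2M_i/N\ge R_i-\varepsilon$, total power at most $NP_{eq}$ and error probability at most $\varepsilon$. The OL rate region for Setup 2 is the closure of $\bigcup_{g\ge0,\kappa}\mathcal R_{OL}(g,\kappa)$. *Modulo-lattice version of an LFC* with $N_C$ steps, for a full-rank lattice $\Lambda\subset\mathbb R^{d}$, $d\ge1$, with nearest-neighbor modulo operation $[\cdot]_\Lambda$ (ties broken measurably and $\Lambda$-periodically) and scaling $\gamma>0$. It runs $2d$ instances of the LFC with separate messages and seeds, indexed by position $\ell\in\{1,\dots,d\}$ and parity $\pi\in\{0,1\}$. Time is cut into blocks of length $d$, numbered from $0$. The vector of the $n$-th transmissions ($n=1,\dots,N_C$) of the $d$ instances of parity $\pi$ is sent by A in block $2(n-1)+\pi$.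 Bold letters denote vectors over these $d$ instances. For $n\ge2$, in block $2(n-1)+\pi-1$ the terminals send $\tilde{\mathbf X}_i=[\gamma\mathbf F_{i,n}+\mathbf V_{i,n}]_\Lambda$, with dithers $\mathbf V_{i,n}$ (common randomness, independent for different $i,n,\pi$) uniform on the Voronoi cell of $\Lambda$. From the received vector $\tilde{\mathbf Y}$, A forms $\mathbf K_n=[\gamma\mathbf\Theta_n-(\tilde{\mathbf Y}-\mathbf V_{1,n}-\mathbf V_{2,n})-\gamma\bar{\mathbf\Theta}_n]_\Lambda$ and sends $\gamma^{-1}\mathbf K_n+\bar{\mathbf\Theta}_n$; for $n=1$ it sends $\mathbf\Theta_1$. Otherwise $0$ is sent; the length is any $N\ge 2N_Cd$. **Statement.** 1. For all $g\ge0$, $\kappa\in\mathbb R^2$, all lengths and all $M_1,M_2\ge2$, the OL scheme for $(P_{eq},\Sigma_{eq})$ has constant transmission power over Setup 2: $\mathbb E X_n^2=P_{eq}$ for every $n$. 2. For all $g\ge0$, $\kappa\in\mathbb R^2$, every pair in $\mathcal R_{OL}(g,\kappa)$ is achieved over Setup 1 by modulo-lattice OL schemes with the same $g,\kappa$: for every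 $\varepsilon>0$ and all sufficiently large $N$ there are $P'\in(P_{eq}-\varepsilon,P_{eq}]$, $P'>0$, integers $N_C$, $d$, $M_1,M_2\ge 2$, and a lattice $\Lambda\subset\mathbb R^d$ of second moment per dimension $\tilde P$, such that the modulo-lattice version, of length $N$ and with $\gamma=\sqrt{\tilde P/P}$, of the $N_C$-step OL scheme for $(P',\Sigma_{eq})$ satisfies the power constraints $P$ and $\tilde P$ of Setup 1 and has rates at least $R_i-\varepsilon$ and error probability at most $\varepsilon$. 3. Consequently the OL rate region for Setup 2 is contained in the set of rate pairs achievable over Setup 1. -/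

import Mathlib

open MeasureTheory ProbabilityTheory Filter Topology
open scoped ENNReal NNReal

noncomputable section

/-! ### Averages over the messages -/

/-- The average of `f` over independent, uniformly distributed messages `(w 0, w 1)`. -/
def msgAvg {Msg : Fin 2 → Type} [∀ i, Fintype (Msg i)] (f : (∀ i, Msg i) → ℝ≥0∞) : ℝ≥0∞ :=
  (∑ w, f w) / (Fintype.card (∀ i, Msg i) : ℝ≥0∞)

/-! ### The AWGN broadcast channel -/

/-- The covariance matrix of the noise pair of the broadcast channel. -/
def bcCov (σ₁ σ₂ r : ℝ) : Matrix (Fin 2) (Fin 2) ℝ :=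
  !![σ₁ ^ 2, r * σ₁ * σ₂; r * σ₁ * σ₂, σ₂ ^ 2]

/-- The law of the noise of `N` uses of the broadcast channel: independent over time, each noise
pair is centered Gaussian with covariance matrix `S`. -/
def bcNoise (N : ℕ) (S : Matrix (Fin 2) (Fin 2) ℝ) :
    Measure (Fin N → EuclideanSpace ℝ (Fin 2)) :=
  Measure.pi fun _ => multivariateGaussian 0 S

/-! ### Setup 1: AWGN broadcast channel with AWGN multiple-access feedback -/

/-- The law of all the noise of `N` rounds: the broadcast noise, and independently of it the i.i.d.
noise of the feedback channel, with variance `vt`. -/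
def macNoise (N : ℕ) (S : Matrix (Fin 2) (Fin 2) ℝ) (vt : ℝ) :
    Measure ((Fin N → EuclideanSpace ℝ (Fin 2)) × (Fin N → ℝ)) :=
  (bcNoise N S).prod (Measure.pi fun _ => gaussianReal 0 vt.toNNReal)

/-- An interactive scheme with `N` rounds, message sets `Msg 0`, `Msg 1` and common randomness with
values in `Q`. In round `t`, Terminal A sends a function of the messages, the common randomness and
the feedback outputs of the rounds before `t`; the receiving terminal `i` feeds back a function of
the common randomness and its own channel outputs of the rounds up to `t`. -/
structure MacScheme (N : ℕ) (Msg : Fin 2 → Type) (Q : Type) where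
  enc : (t : Fin N) → (∀ i, Msg i) → Q → (Set.Iio t → ℝ) → ℝ
  fb : Fin 2 → (t : Fin N) → Q → (Set.Iic t → ℝ) → ℝ

namespace MacScheme

variable {N : ℕ} {Msg : Fin 2 → Type} {Q : Type}

/-- The output of the feedback channel in round `t`, for given messages `w`, common randomness `q`,
broadcast noise `z` and feedback noise `zt`. -/
def macOutput (C : MacScheme N Msg Q) (w : ∀ i, Msg i) (q : Q)
    (z : Fin N → EuclideanSpace ℝ (Fin 2)) (zt : Fin N → ℝ) (t : Fin N) : ℝ :=
  ∑ i, C.fb i t q (fun s : Set.Iic t =>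
    C.enc s.1 w q (fun k : Set.Iio s.1 => macOutput C w q z zt k.1) + z s.1 i) + zt t
termination_by t.val
decreasing_by
  have h1 : (k.1 : Fin N) < s.1 := k.2
  have h2 : (s.1 : Fin N) ≤ t := s.2
  exact lt_of_lt_of_le h1 h2

/-- The input of the broadcast channel in round `t`. -/
def input (C : MacScheme N Msg Q) (w : ∀ i, Msg i) (q : Q)
    (z : Fin N → EuclideanSpace ℝ (Fin 2)) (zt : Fin N → ℝ) (t : Fin N) : ℝ :=
  C.enc t w q (fun k => C.macOutput w q z zt k.1)

/-- The output of the broadcast channel at the receiving terminal `i` in round `t`. -/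
def bcOutput (C : MacScheme N Msg Q) (w : ∀ i, Msg i) (q : Q)
    (z : Fin N → EuclideanSpace ℝ (Fin 2)) (zt : Fin N → ℝ) (i : Fin 2) (t : Fin N) : ℝ :=
  C.input w q z zt t + z t i

/-- The input of the feedback channel from the receiving terminal `i` in round `t`. -/
def fbInput (C : MacScheme N Msg Q) (w : ∀ i, Msg i) (q : Q)
    (z : Fin N → EuclideanSpace ℝ (Fin 2)) (zt : Fin N → ℝ) (i : Fin 2) (t : Fin N) : ℝ :=
  C.fb i t q (fun s => C.bcOutput w q z zt i s.1)

theorem macOutput_eq (C : MacScheme N Msg Q) (w : ∀ i, Msg i) (q : Q)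
    (z : Fin N → EuclideanSpace ℝ (Fin 2)) (zt : Fin N → ℝ) (t : Fin N) :
    C.macOutput w q z zt t =
      C.fbInput w q z zt 0 t + C.fbInput w q z zt 1 t + zt t := by
  rw [macOutput, Fin.sum_univ_two]
  rfl

variable [MeasurableSpace Q]

/-- All functions of the scheme are measurable. -/
def IsMeasurable (C : MacScheme N Msg Q) : Prop :=
  (∀ t w, Measurable fun x : Q × (Set.Iio t → ℝ) => C.enc t w x.1 x.2) ∧
  (∀ i t, Measurable fun x : Q × (Set.Iic t → ℝ) => C.fb i t x.1 x.2)

variable [∀ i, Fintype (Msg i)]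

/-- The probability, over uniform messages, common randomness with law `ν` and noise, that at least
one of the terminals errs when terminal `i` uses the decision rule `d i`. -/
def errorProbWith (C : MacScheme N Msg Q) (ν : Measure Q) (S : Matrix (Fin 2) (Fin 2) ℝ) (vt : ℝ)
    (d : ∀ i, Q → (Fin N → ℝ) → Msg i) : ℝ≥0∞ :=
  msgAvg fun w => (ν.prod (macNoise N S vt))
    {x | ∃ i, d i x.1 (C.bcOutput w x.1 x.2.1 x.2.2 i) ≠ w i}

/-- The error probability under the optimal decision rule. -/
def errorProb (C : MacScheme N Msg Q) (ν : Measure Q) (S : Matrix (Fin 2) (Fin 2) ℝ) (vt : ℝ) :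
    ℝ≥0∞ :=
  ⨅ (d : ∀ i, Q → (Fin N → ℝ) → Msg i)
    (_ : ∀ i v, MeasurableSet {x : Q × (Fin N → ℝ) | d i x.1 x.2 = v}), C.errorProbWith ν S vt d

/-- The scheme obeys the power constraints `P` of Terminal A and `Pt` of both other terminals, has
rates at least `R i - ε` and error probability at most `ε`. -/
def Achieves (C : MacScheme N Msg Q) (ν : Measure Q) (P : ℝ) (S : Matrix (Fin 2) (Fin 2) ℝ)
    (Pt vt : ℝ) (R : Fin 2 → ℝ) (ε : ℝ) : Prop :=
  (∀ i, Nonempty (Msg i)) ∧ IsProbabilityMeasure ν ∧ C.IsMeasurable ∧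
  (∑ t, msgAvg fun w => ∫⁻ x, ENNReal.ofReal (C.input w x.1 x.2.1 x.2.2 t ^ 2)
    ∂(ν.prod (macNoise N S vt))) ≤ ENNReal.ofReal (N * P) ∧
  (∀ i, (∑ t, msgAvg fun w => ∫⁻ x, ENNReal.ofReal (C.fbInput w x.1 x.2.1 x.2.2 i t ^ 2)
    ∂(ν.prod (macNoise N S vt))) ≤ ENNReal.ofReal (N * Pt)) ∧
  (∀ i, R i - ε ≤ Real.logb 2 (Fintype.card (Msg i)) / N) ∧
  C.errorProb ν S vt ≤ ENNReal.ofReal ε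

end MacScheme

/-- The rate pairs achievable over Setup 1 with feedforward power `P`, feedforward noise covariance
`S`, feedback power `Pt` and feedback noise variance `vt`: arbitrarily small loss of rate and
arbitrarily small error probability for all large block lengths. -/
def setup1Region (P : ℝ) (S : Matrix (Fin 2) (Fin 2) ℝ) (Pt vt : ℝ) : Set (Fin 2 → ℝ) :=
  {R | (∀ i, 0 ≤ R i) ∧ ∀ ε > 0, ∀ᶠ N : ℕ in atTop,
    ∃ (Msg : Fin 2 → Type) (_ : ∀ i, Fintype (Msg i)) (Q : Type) (_ : MeasurableSpace Q)
      (ν : Measure Q) (C : MacScheme N Msg Q), C.Achieves ν P S Pt vt R ε}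

/-! ### Linear feedback coding -/

/-- A linear feedback code (LFC) with `N` steps and message sets `Fin (m 0)`, `Fin (m 1)`: the
codebook elements, functions of the messages and of a real random seed known to all terminals, and
the coefficients of the feedback elements; `coeff i n k` is used for `k < n` only. -/
structure LFC (N : ℕ) (m : Fin 2 → ℕ) where
  codebook : Fin N → (∀ i, Fin (m i)) → ℝ → ℝ
  coeff : Fin 2 → Fin N → Fin N → ℝ

namespace LFC

variable {N : ℕ} {m : Fin 2 → ℕ}

/-- The feedback element of terminal `i` for step `n`, a linear combination of the outputs `y` of
the steps before `n`. -/
def feedback (L : LFC N m) (i : Fin 2) (n : Fin N) (y : {k : Fin N // k < n} → ℝ) : ℝ :=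
  ∑ k, L.coeff i n k.1 * y k

/-- The transmission of step `n` with noiseless feedback: codebook element minus both feedback
elements, where the output of terminal `i` in step `k` is the input plus the noise `z k i`. -/
def input (L : LFC N m) (w : ∀ i, Fin (m i)) (u : ℝ) (z : Fin N → EuclideanSpace ℝ (Fin 2))
    (n : Fin N) : ℝ :=
  L.codebook n w u - ∑ i, L.feedback i n fun k => input L w u z k.1 + z k.1 i
termination_by n.val
decreasing_by exact k.2

/-- The output of terminal `i` with noiseless feedback. -/
def output (L : LFC N m) (w : ∀ i, Fin (m i)) (u : ℝ) (z : Fin N → EuclideanSpace ℝ (Fin 2))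
    (i : Fin 2) (n : Fin N) : ℝ :=
  L.input w u z n + z n i

/-- The codebook elements of the equivalent formulation in which the feedback elements are linear
combinations of the noises instead of the outputs. The input being affine in the noise, they are
the inputs that result when all noises vanish. -/
def codebookBar (L : LFC N m) (n : Fin N) (w : ∀ i, Fin (m i)) (u : ℝ) : ℝ :=
  L.input w u 0 n

/-- The transmission power in step `n` over the broadcast channel with noiseless feedback and noise
covariance `S`, with a standard Gaussian seed. -/
def power (L : LFC N m) (S : Matrix (Fin 2) (Fin 2) ℝ) (n : Fin N) : ℝ≥0∞ :=
  msgAvg (Msg := fun i => Fin (m i)) fun w =>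
    ∫⁻ x, ENNReal.ofReal (L.input w x.1 x.2 n ^ 2) ∂((gaussianReal 0 1).prod (bcNoise N S))

end LFC

/-! ### The Ozarow–Leung scheme -/

namespace OzarowLeung

/-- Amplitude modulation: `m` equidistant points, symmetric about zero, with mean square one
(for `2 ≤ m`). -/
def pam (m : ℕ) (j : Fin m) : ℝ :=
  (2 * (j : ℝ) - ((m : ℝ) - 1)) * √(3 / ((m : ℝ) ^ 2 - 1))

/-- The variances `var i` of the estimation errors of the two receivers and the correlation
coefficient `corr` of the two errors. -/
structure State where
  var : Fin 2 → ℝ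
  corr : ℝ

def sgn (ρ : ℝ) : ℝ := if 0 ≤ ρ then 1 else -1

/-- The amplitudes of the two normalized errors in the transmitted signal
`Ψ (ε₁ / √α₁ + g sgn(ρ) ε₂ / √α₂)`, of power `P`. -/
def amp (P g ρ : ℝ) : Fin 2 → ℝ :=
  ![√(P / (1 + g ^ 2 + 2 * g * |ρ|)), √(P / (1 + g ^ 2 + 2 * g * |ρ|)) * (g * sgn ρ)]

/-- The correlation of the transmitted signal with the two normalized errors. -/
def cross (P g ρ : ℝ) : Fin 2 → ℝ :=
  ![amp P g ρ 0 + amp P g ρ 1 * ρ, amp P g ρ 0 * ρ + amp P g ρ 1]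

/-- The state after the first two transmissions. The error of receiver `i` is then its noise scaled
by `1 / √P`, plus `κ i` times the standard Gaussian seed. -/
def initState (P : ℝ) (S : Matrix (Fin 2) (Fin 2) ℝ) (κ : Fin 2 → ℝ) : State where
  var i := S i i / P + κ i ^ 2
  corr := κ 0 * κ 1 / √((S 0 0 / P + κ 0 ^ 2) * (S 1 1 / P + κ 1 ^ 2))

/-- The state after one more transmission, when each receiver `i` subtracts from its estimate the
linear minimum mean square error estimate of its error given its current output, whose variance is
`P + S i i`. -/
def step (P : ℝ) (S : Matrix (Fin 2) (Fin 2) ℝ) (g : ℝ) (s : State) : State where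
  var i := s.var i * (1 - cross P g s.corr i ^ 2 / (P + S i i))
  corr :=
    (s.corr - cross P g s.corr 0 * cross P g s.corr 1 *
        (1 / (P + S 0 0) + 1 / (P + S 1 1) - (P + S 0 1) / ((P + S 0 0) * (P + S 1 1)))) /
      √((1 - cross P g s.corr 0 ^ 2 / (P + S 0 0)) * (1 - cross P g s.corr 1 ^ 2 / (P + S 1 1)))

/-- The state after `2 + k` transmissions. -/
def state (P : ℝ) (S : Matrix (Fin 2) (Fin 2) ℝ) (g : ℝ) (κ : Fin 2 → ℝ) : ℕ → State
  | 0 => initState P S κ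
  | k + 1 => step P S g (state P S g κ k)

/-- The weight of the output of step `n` in the estimate of receiver `i`. The steps `0` and `1`
serve to send the message points of receiver `0` and receiver `1`. -/
def gain (P : ℝ) (S : Matrix (Fin 2) (Fin 2) ℝ) (g : ℝ) (κ : Fin 2 → ℝ) (i : Fin 2) (n : ℕ) : ℝ :=
  if n < 2 then (if n = i.val then 1 / √P else 0)
  else
    let s := state P S g κ (n - 2);
    -(√(s.var i) * cross P g s.corr i / (P + S i i))

/-- The coefficient of the (not normalized) error of receiver `i` in the transmission of
step `n ≥ 2`. -/
def errCoeff (P : ℝ) (S : Matrix (Fin 2) (Fin 2) ℝ) (g : ℝ) (κ : Fin 2 → ℝ) (i : Fin 2) (n : ℕ) :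
    ℝ :=
  let s := state P S g κ (n - 2);
  amp P g s.corr i / √(s.var i)

/-- The Ozarow–Leung scheme, as an LFC, for power `P` and noise covariance `S`, with parameters `g`
and `κ`. In the steps `n ≥ 2` it sends `∑ i, errCoeff i n * (estimate i - message point i)`, where
the estimate of receiver `i` is `κ i * u + ∑ k < n, gain i k * (output of receiver i in step k)`. -/
def scheme (P : ℝ) (S : Matrix (Fin 2) (Fin 2) ℝ) (g : ℝ) (κ : Fin 2 → ℝ) (N : ℕ)
    (m : Fin 2 → ℕ) : LFC N m where
  codebook n w u :=
    if n.val = 0 then √P * pam (m 0) (w 0)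
    else if n.val = 1 then √P * pam (m 1) (w 1)
    else ∑ i, errCoeff P S g κ i n.val * (κ i * u - pam (m i) (w i))
  coeff i n k := if n.val < 2 then 0 else -(errCoeff P S g κ i n.val * gain P S g κ i k.val)

/-- The final estimate of the message point of receiver `i`. -/
def estimate (P : ℝ) (S : Matrix (Fin 2) (Fin 2) ℝ) (g : ℝ) (κ : Fin 2 → ℝ) {N : ℕ} (u : ℝ)
    (i : Fin 2) (y : Fin N → ℝ) : ℝ :=
  κ i * u + ∑ k : Fin N, gain P S g κ i k.val * y k

/-- The error probability of the Ozarow–Leung scheme over the broadcast channel with noiseless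
feedback: receiver `i` decides for the message point nearest to its final estimate (a tie counts as
an error). -/
def errorProb (P : ℝ) (S : Matrix (Fin 2) (Fin 2) ℝ) (g : ℝ) (κ : Fin 2 → ℝ) (N : ℕ)
    (m : Fin 2 → ℕ) : ℝ≥0∞ :=
  msgAvg (Msg := fun i => Fin (m i)) fun w => ((gaussianReal 0 1).prod (bcNoise N S))
    {x | ¬ ∀ i, ∀ v : Fin (m i), v ≠ w i →
      |estimate P S g κ x.1 i ((scheme P S g κ N m).output w x.1 x.2 i) - pam (m i) (w i)| <
        |estimate P S g κ x.1 i ((scheme P S g κ N m).output w x.1 x.2 i) - pam (m i) v|}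

/-- The rate pairs that the Ozarow–Leung scheme with parameters `g` and `κ` achieves over the
broadcast channel with noiseless feedback, power constraint `P` and noise covariance `S`. -/
def region (P : ℝ) (S : Matrix (Fin 2) (Fin 2) ℝ) (g : ℝ) (κ : Fin 2 → ℝ) : Set (Fin 2 → ℝ) :=
  {R | (∀ i, 0 ≤ R i) ∧ ∀ ε > 0, ∀ᶠ N : ℕ in atTop,
    ∃ m : Fin 2 → ℕ, (∀ i, 2 ≤ m i) ∧ (∀ i, R i - ε ≤ Real.logb 2 (m i) / N) ∧
      (∑ n, (scheme P S g κ N m).power S n) ≤ ENNReal.ofReal (N * P) ∧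
      errorProb P S g κ N m ≤ ENNReal.ofReal ε}

/-- The rate region of the Ozarow–Leung scheme over the broadcast channel with noiseless feedback:
closure of the union over all parameters. -/
def fullRegion (P : ℝ) (S : Matrix (Fin 2) (Fin 2) ℝ) : Set (Fin 2 → ℝ) :=
  closure (⋃ (g : ℝ) (_ : 0 ≤ g) (κ : Fin 2 → ℝ), region P S g κ)

end OzarowLeung

/-! ### Lattices -/

/-- The point of the lattice `G ℤ^d` with coordinate vector `k`. -/
def latticePoint {d : ℕ} (G : Matrix (Fin d) (Fin d) ℝ) (k : Fin d → ℤ) :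
    EuclideanSpace ℝ (Fin d) :=
  WithLp.toLp 2 (G.mulVec fun i => (k i : ℝ))

/-- A full-rank lattice in `ℝ^d` with a nearest neighbor quantizer; the ties are broken in a
measurable way that is invariant under translation by lattice points. -/
structure LatticeQuantizer (d : ℕ) where
  gen : Matrix (Fin d) (Fin d) ℝ
  det_gen : gen.det ≠ 0
  quant : EuclideanSpace ℝ (Fin d) → EuclideanSpace ℝ (Fin d)
  measurable_quant : Measurable quant
  quant_mem : ∀ x, ∃ k, quant x = latticePoint gen k
  quant_nearest : ∀ x k, ‖x - quant x‖ ≤ ‖x - latticePoint gen k‖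
  quant_add : ∀ x k, quant (x + latticePoint gen k) = quant x + latticePoint gen k

namespace LatticeQuantizer

variable {d : ℕ} (Λ : LatticeQuantizer d)

/-- The modulo-lattice operation. -/
def mod (x : EuclideanSpace ℝ (Fin d)) : EuclideanSpace ℝ (Fin d) := x - Λ.quant x

/-- The fundamental Voronoi cell. -/
def cell : Set (EuclideanSpace ℝ (Fin d)) := {x | Λ.quant x = 0}

/-- The uniform distribution on the fundamental Voronoi cell. -/
def dither : Measure (EuclideanSpace ℝ (Fin d)) := ProbabilityTheory.cond volume Λ.cell

/-- The second moment per dimension. -/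
def secondMoment : ℝ := (1 / (d : ℝ)) * ∫ x, ‖x‖ ^ 2 ∂Λ.dither

theorem mod_mod_add (x y : EuclideanSpace ℝ (Fin d)) : Λ.mod (Λ.mod x + y) = Λ.mod (x + y) := by
  obtain ⟨k, hk⟩ := Λ.quant_mem x
  have h := Λ.quant_add (x - Λ.quant x + y) k
  have e : x - Λ.quant x + y + latticePoint Λ.gen k = x + y := by rw [hk]; abel
  rw [e] at h
  simp only [mod]
  rw [h, ← hk]
  abel

end LatticeQuantizer

/-! ### Modulo-lattice linear feedback coding -/

/-- A partial record `y`, extended by zero. -/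
def extendZero {N : ℕ} {s : Set (Fin N)} (y : s → ℝ) (k : ℕ) : ℝ :=
  open Classical in
  if h : ∃ hk : k < N, (⟨k, hk⟩ : Fin N) ∈ s then y ⟨⟨k, h.1⟩, h.2⟩ else 0

/-- The common randomness of a modulo-lattice scheme: the dither vectors, indexed by the receiving
terminal, the LFC step and the parity, and the seeds of the interleaved LFC instances, indexed by
the position in the lattice block and the parity. -/
abbrev MLRandomness (NC d : ℕ) : Type :=
  (Fin 2 × Fin NC × Fin 2 → EuclideanSpace ℝ (Fin d)) × (Fin d × Fin 2 → ℝ)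

/-- The dithers are i.i.d. uniform on the Voronoi cell, the seeds i.i.d. standard Gaussian. -/
def mlRandomnessLaw (NC : ℕ) {d : ℕ} (Λ : LatticeQuantizer d) : Measure (MLRandomness NC d) :=
  (Measure.pi fun _ => Λ.dither).prod (Measure.pi fun _ => gaussianReal 0 1)

/-- The modulo-lattice LFC (MLLFC) scheme of an LFC `L` with `NC` steps, with lattice `Λ` of
dimension `d` and scaling `γ`. It runs `2 d` instances of `L`, with separate messages, indexed by
position `ℓ` and parity `p`. Block `b` consists of the rounds `b d, …, b d + d - 1`. Step `n` of
the instances of parity `p` is sent in block `2 n + p`; the feedback for step `n ≥ 1` is sent in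
block `2 n + p - 1`. All terminals send `0` in the rounds without an assignment, in particular
after the `2 NC` blocks. -/
def mlScheme {NC : ℕ} {m : Fin 2 → ℕ} (L : LFC NC m) {d : ℕ} (hd : 0 < d)
    (Λ : LatticeQuantizer d) (γ : Fin NC → ℝ) (N : ℕ) :
    MacScheme N (fun i => Fin d × Fin 2 → Fin (m i)) (MLRandomness NC d) where
  enc t w q y :=
    let n : ℕ := t.val / (2 * d)
    let p : Fin 2 := ⟨(t.val / d) % 2, Nat.mod_lt _ two_pos⟩
    let ℓ : Fin d := ⟨t.val % d, Nat.mod_lt _ hd⟩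
    if hn : n < NC then
      let θ : EuclideanSpace ℝ (Fin d) :=
        WithLp.toLp 2 fun j => L.codebook ⟨n, hn⟩ (fun i => w i (j, p)) (q.2 (j, p))
      let θbar : EuclideanSpace ℝ (Fin d) :=
        WithLp.toLp 2 fun j => L.codebookBar ⟨n, hn⟩ (fun i => w i (j, p)) (q.2 (j, p))
      let ytil : EuclideanSpace ℝ (Fin d) :=
        WithLp.toLp 2 fun j => extendZero y ((2 * n + p.val - 1) * d + j.val)
      let K := Λ.mod (γ ⟨n, hn⟩ • θ - (ytil - ∑ i, q.1 (i, ⟨n, hn⟩, p)) - γ ⟨n, hn⟩ • θbar)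
      if n = 0 then θ ℓ else (γ ⟨n, hn⟩)⁻¹ * K ℓ + θbar ℓ
    else 0
  fb i t q y :=
    let b : ℕ := t.val / d
    let n : ℕ := (b + 1) / 2
    let p : Fin 2 := ⟨(b + 1) % 2, Nat.mod_lt _ two_pos⟩
    let ℓ : Fin d := ⟨t.val % d, Nat.mod_lt _ hd⟩
    if hn : n < NC then
      let F : EuclideanSpace ℝ (Fin d) := WithLp.toLp 2 fun j =>
        L.feedback i ⟨n, hn⟩ fun k => extendZero y ((2 * k.1.val + p.val) * d + j.val)
      if n = 0 then 0 else Λ.mod (γ ⟨n, hn⟩ • F + q.1 (i, ⟨n, hn⟩, p)) ℓ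
    else 0

/-- The feedforward power of the equivalent noiseless-feedback setup. -/
def eqPower (P Pt vt : ℝ) : ℝ := P * (1 - vt / Pt)

/-- The noise covariance of the equivalent noiseless-feedback setup. -/
def eqCov (P : ℝ) (S : Matrix (Fin 2) (Fin 2) ℝ) (Pt vt : ℝ) : Matrix (Fin 2) (Fin 2) ℝ :=
  S + (vt * P / Pt) • !![1, 1; 1, 1]

/-- The rate pairs achieved over Setup 1 by the modulo-lattice version of the Ozarow–Leung scheme
with parameters `g` and `κ`. The underlying Ozarow–Leung scheme is designed for the equivalent
noise covariance and for a power `P'` at most, but arbitrarily close to, the equivalent power; the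
scaling is `√(Pt / P)` and the lattice has second moment `Pt`. -/
def moduloLatticeOLRegion (P : ℝ) (S : Matrix (Fin 2) (Fin 2) ℝ) (Pt vt : ℝ) (g : ℝ)
    (κ : Fin 2 → ℝ) : Set (Fin 2 → ℝ) :=
  {R | (∀ i, 0 ≤ R i) ∧ ∀ ε > 0, ∀ᶠ N : ℕ in atTop,
    ∃ (P' : ℝ) (NC d : ℕ) (hd : 0 < d) (Λ : LatticeQuantizer d) (m : Fin 2 → ℕ),
      0 < P' ∧ eqPower P Pt vt - ε < P' ∧ P' ≤ eqPower P Pt vt ∧ 2 * NC * d ≤ N ∧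
      Λ.secondMoment = Pt ∧ (∀ i, 2 ≤ m i) ∧
      (mlScheme (OzarowLeung.scheme P' (eqCov P S Pt vt) g κ NC m) hd Λ
        (fun _ => √(Pt / P)) N).Achieves (mlRandomnessLaw NC Λ) P S Pt vt R ε}

end

open scoped Pointwise

noncomputable section

/-! Reduction modulo a lattice makes noisy multiple-access feedback look noiseless. The residues
sent by the two terminals add up modulo the lattice, and the dithers cancel. So Terminal A sends the
zero-noise input of the code plus `γ⁻¹` times the residue of an argument, which is `γ` times a
linear form in the noises minus the feedback noise (`LFC.input_slot`). While these arguments stay in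
the Voronoi cell, the code runs with noiseless feedback over a channel with noise `z - γ⁻¹ zt`
(`LFC.codebookBar_add_latticeInput`); for `γ² = Pt / P` its covariance is `eqCov`. The dithers make
the feedback uniform on the cell, of power `Pt`. Terminal A spends the power of the code plus `γ⁻²
vt`, which is `P` when the code has power `eqPower`.

Lattices. Needed are lattices of second moment `Pt` whose cell contains, with high probability, a
Gaussian vector of variance almost `Pt` (`LatticeQuantizer.eventually_exists_good`). They come from
the lattices of all `(e u, y + u t)` with integer `u`, `y` and `t` uniform on the torus. Each
nonzero multiple of `t` is uniform, so a union bound controls overloads. The points `x - u t` with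
`x` and `t` uniform are pairwise independent, so Chebyshev's inequality shows that most points are
close to the lattice, which bounds the second moment.

Trade-off. In dimension `d` the lattice costs a fraction of about `d ^ (-1/4)` of the power, so the
code is designed for a power slightly below `eqPower`, while the hypothesis concerns `eqPower`
itself. The state recursion is Lipschitz in the power, hence the error variances after `k` steps
change at most by a factor whose logarithm is exponential in `k` times the power loss
(`OzarowLeung.exists_abs_log_var_sub_le`). Moreover all `2 d` instances must succeed together. A
pair in the region forces the variances to vanish relative to the squared point distance
(`OzarowLeung.le_errorProb`), and they vanish geometrically if at all
(`OzarowLeung.exists_geometric`). At slightly smaller rates they are therefore exponentially small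
compared to the squared distance (`OzarowLeung.exists_message_sizes`), and one instance fails with
doubly exponentially small probability. With about `√(log N)` steps, exponentials in the number of
steps are subpolynomial in `d`, and the doubly exponential beats `d` (`eventually_steps`).
`OzarowLeung.region_subset_moduloLatticeOLRegion` combines this.

Constant power holds because the errors are linear forms in seed and noise whose covariances follow
the state recursion (`OzarowLeung.state_valid`). The last claim follows since the Setup 1 region is
closed. -/

/-! ### Centered Gaussian linear forms -/

/-- The random variable `X` is centered Gaussian with variance `v`. -/
structure CenteredGaussian {Ω : Type*} [MeasurableSpace Ω] (X : Ω → ℝ) (v : ℝ) (μ : Measure Ω) :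
    Prop where
  measurable : Measurable X
  nonneg : 0 ≤ v
  charFun : ∀ s : ℝ, ∫ ω, Complex.exp (s * X ω * Complex.I) ∂μ = Complex.exp (-(v * s ^ 2 / 2))

namespace CenteredGaussian

variable {Ω Ω' : Type*} [MeasurableSpace Ω] [MeasurableSpace Ω'] {μ : Measure Ω} {μ' : Measure Ω'}
  {X : Ω → ℝ} {v : ℝ}

theorem map_eq [IsProbabilityMeasure μ] (h : CenteredGaussian X v μ) :
    μ.map X = gaussianReal 0 v.toNNReal := by
  have : IsProbabilityMeasure (μ.map X) := Measure.isProbabilityMeasure_map h.measurable.aemeasurable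
  apply Measure.ext_of_charFun
  ext s
  rw [charFun_apply_real, integral_map h.measurable.aemeasurable (by fun_prop), h.charFun,
    charFun_gaussianReal]
  congr 1
  simp [h.nonneg]

theorem comp (h : CenteredGaussian X v μ) {f : Ω' → Ω} (hf : MeasurePreserving f μ' μ) :
    CenteredGaussian (fun ω => X (f ω)) v μ' where
  measurable := h.measurable.comp hf.measurable
  nonneg := h.nonneg
  charFun s := by
    rw [← h.charFun s, ← hf.map_eq, integral_map hf.measurable.aemeasurable]
    have := h.measurable
    exact Measurable.aestronglyMeasurable (by fun_prop)

theorem const_mul (h : CenteredGaussian X v μ) (c : ℝ) :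
    CenteredGaussian (fun ω => c * X ω) (c ^ 2 * v) μ where
  measurable := h.measurable.const_mul c
  nonneg := mul_nonneg (sq_nonneg c) h.nonneg
  charFun s := by
    have := h.charFun (s * c)
    push_cast at this ⊢
    simp only [← mul_assoc]
    rw [this]
    congr 1
    ring

theorem prod_add [SFinite μ] [SFinite μ'] {Y : Ω' → ℝ} {v' : ℝ} (h : CenteredGaussian X v μ)
    (h' : CenteredGaussian Y v' μ') :
    CenteredGaussian (fun ω : Ω × Ω' => X ω.1 + Y ω.2) (v + v') (μ.prod μ') where
  measurable := (h.measurable.comp measurable_fst).add (h'.measurable.comp measurable_snd)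
  nonneg := add_nonneg h.nonneg h'.nonneg
  charFun s := by
    have := integral_prod_mul (μ := μ) (ν := μ') (fun ω => Complex.exp (s * X ω * Complex.I))
      (fun ω => Complex.exp (s * Y ω * Complex.I))
    rw [h.charFun, h'.charFun, ← Complex.exp_add] at this
    refine Eq.trans (integral_congr_ae (ae_of_all _ fun ω => ?_)) (this.trans ?_)
    · simp only [← Complex.exp_add]; push_cast; ring_nf
    · congr 1; push_cast; ring

theorem pi_sum {ι : Type*} [Fintype ι] {E : ι → Type*} [∀ i, MeasurableSpace (E i)]
    {m : ∀ i, Measure (E i)} [∀ i, SigmaFinite (m i)] {Y : ∀ i, E i → ℝ} {w : ι → ℝ}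
    (h : ∀ i, CenteredGaussian (Y i) (w i) (m i)) :
    CenteredGaussian (fun ω : ∀ i, E i => ∑ i, Y i (ω i)) (∑ i, w i) (Measure.pi m) where
  measurable := Finset.measurable_sum _ fun i _ => (h i).measurable.comp (measurable_pi_apply i)
  nonneg := Finset.sum_nonneg fun i _ => (h i).nonneg
  charFun s := by
    have := integral_fintype_prod_eq_prod (μ := m) (𝕜 := ℂ)
      (fun i (x : E i) => Complex.exp (s * Y i x * Complex.I))
    simp only [(h _).charFun, ← Complex.exp_sum] at this
    refine Eq.trans (integral_congr_ae (ae_of_all _ fun ω => ?_)) (this.trans ?_)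
    · simp only [Complex.ofReal_sum, Finset.mul_sum, Finset.sum_mul]
    · congr 1
      simp only [Complex.ofReal_sum, Finset.sum_mul, Finset.sum_div, Finset.sum_neg_distrib]

theorem id_gaussianReal {v : ℝ} (hv : 0 ≤ v) :
    CenteredGaussian (fun x : ℝ => x) v (gaussianReal 0 v.toNNReal) where
  measurable := measurable_id
  nonneg := hv
  charFun s := by
    have := charFun_gaussianReal (μ := 0) (v := v.toNNReal) s
    rw [charFun_apply_real] at this
    rw [this]
    simp [hv]

theorem id_gaussianReal_one : CenteredGaussian (fun x : ℝ => x) 1 (gaussianReal 0 1) := by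
  simpa using id_gaussianReal zero_le_one

/-- The quadratic form of the noise covariance matrix. -/
theorem sum_mul_multivariateGaussian {S : Matrix (Fin 2) (Fin 2) ℝ} (hS : S.PosSemidef)
    (a : Fin 2 → ℝ) :
    CenteredGaussian (fun z : EuclideanSpace ℝ (Fin 2) => ∑ i, a i * z i)
      (∑ i, ∑ j, a i * S i j * a j) (multivariateGaussian 0 S) where
  measurable := by fun_prop
  nonneg := by
    have := hS.dotProduct_mulVec_nonneg a
    simp [dotProduct, Matrix.mulVec, Fin.sum_univ_two] at this ⊢
    linarith
  charFun s := by
    have := charFun_multivariateGaussian (μ := 0) hS (WithLp.toLp 2 (s • a))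
    rw [charFun_apply] at this
    convert this using 3 with z
    · simp [PiLp.inner_apply, Fin.sum_univ_two]; ring_nf
    · simp [Matrix.mulVec, dotProduct, Fin.sum_univ_two]; ring

/-- A random vector all of whose projections are Gaussian with variance proportional to the squared
norm is a scaled standard Gaussian vector. -/
theorem map_vector_eq [IsProbabilityMeasure μ] {d : ℕ} {V : Ω → EuclideanSpace ℝ (Fin d)}
    (hV : Measurable V) (hv : 0 ≤ v)
    (h : ∀ a : Fin d → ℝ, CenteredGaussian (fun ω => ∑ j, a j * V ω j) (v * ∑ j, a j ^ 2) μ) :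
    μ.map V = (stdGaussian (EuclideanSpace ℝ (Fin d))).map fun x => √v • x := by
  have : IsProbabilityMeasure (μ.map V) := Measure.isProbabilityMeasure_map hV.aemeasurable
  have : IsProbabilityMeasure ((stdGaussian (EuclideanSpace ℝ (Fin d))).map fun x => √v • x) :=
    Measure.isProbabilityMeasure_map (by fun_prop)
  apply Measure.ext_of_charFun
  ext a
  rw [charFun_map_smul, charFun_stdGaussian, charFun_apply,
    integral_map hV.aemeasurable (by fun_prop)]
  have := (h a).charFun 1
  convert this using 3 with ω
  · simp [PiLp.inner_apply]
  · rw [norm_smul, ← Complex.ofReal_pow, mul_pow, EuclideanSpace.real_norm_sq_eq,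
      Real.norm_eq_abs, sq_abs, Real.sq_sqrt hv]
    push_cast; ring

theorem lintegral_sq [IsProbabilityMeasure μ] (h : CenteredGaussian X v μ) :
    ∫⁻ ω, ENNReal.ofReal (X ω ^ 2) ∂μ = ENNReal.ofReal v := by
  rw [← lintegral_map (f := fun x : ℝ => ENNReal.ofReal (x ^ 2)) (by fun_prop) h.measurable,
    h.map_eq]
  have h2 : MemLp id 2 (gaussianReal 0 v.toNNReal) := memLp_id_gaussianReal' 2 (by simp)
  have h3 := ofReal_integral_eq_lintegral_ofReal h2.integrable_sq (ae_of_all _ fun x => sq_nonneg _)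
  simp only [id] at h3
  rw [← h3]
  have := variance_eq_integral (μ := gaussianReal 0 v.toNNReal) (X := id) (by fun_prop)
  simp [variance_id_gaussianReal, integral_id_gaussianReal, h.nonneg] at this
  simp [← this]

/-- Only a bound `α` on the variance enters, because the variances in the lattice scheme are merely
bounded by those of the equivalent channel. -/
theorem hasSubgaussianMGF [IsProbabilityMeasure μ] (h : CenteredGaussian X v μ) {α : ℝ≥0}
    (hα : v ≤ α) : HasSubgaussianMGF X α μ where
  integrable_exp_mul t := by
    have := integrable_exp_mul_gaussianReal (μ := 0) (v := v.toNNReal) t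
    rw [← h.map_eq] at this
    exact (integrable_map_measure (by fun_prop) h.measurable.aemeasurable).mp this
  mgf_le t := by
    rw [mgf_gaussianReal h.map_eq]
    simp only [zero_mul, zero_add, Real.coe_toNNReal _ h.nonneg, Real.exp_le_exp]
    nlinarith [sq_nonneg t]

theorem measure_abs_ge_le [IsProbabilityMeasure μ] (h : CenteredGaussian X v μ) {α a : ℝ}
    (hα : v ≤ α) (ha : 0 ≤ a) :
    μ {ω | a ≤ |X ω|} ≤ ENNReal.ofReal (2 * Real.exp (-a ^ 2 / (2 * α))) := by
  have hs := h.hasSubgaussianMGF (α := α.toNNReal) (hα.trans (Real.le_coe_toNNReal α))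
  have h1 := hs.measure_ge_le ha
  have h2 := hs.neg.measure_ge_le ha
  have hα0 : 0 ≤ α := h.nonneg.trans hα
  rw [Real.coe_toNNReal _ hα0] at h1 h2
  have hsub : {ω | a ≤ |X ω|} ⊆ {ω | a ≤ X ω} ∪ {ω | a ≤ (-X) ω} := by
    intro ω hω
    rcases le_abs.mp (show a ≤ |X ω| from hω) with h | h
    · exact Or.inl h
    · exact Or.inr h
  rw [two_mul, ENNReal.ofReal_add (Real.exp_nonneg _) (Real.exp_nonneg _)]
  refine (measure_mono hsub).trans ((measure_union_le _ _).trans (add_le_add ?_ ?_))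
  · rw [← ENNReal.ofReal_toReal (measure_ne_top μ {ω | a ≤ X ω})]
    exact ENNReal.ofReal_le_ofReal h1
  · rw [← ENNReal.ofReal_toReal (measure_ne_top μ {ω | a ≤ (-X) ω})]
    exact ENNReal.ofReal_le_ofReal h2

end CenteredGaussian

/-- Selecting distinct members of an i.i.d. family gives an i.i.d. family. -/
theorem measurePreserving_comp_injective {ι κ E : Type*} [Fintype ι] [Fintype κ]
    [MeasurableSpace E] (m : Measure E) [IsProbabilityMeasure m] {σ : ι → κ}
    (hσ : Function.Injective σ) :
    MeasurePreserving (fun (ω : κ → E) i => ω (σ i)) (Measure.pi fun _ => m)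
      (Measure.pi fun _ => m) where
  measurable := by fun_prop
  map_eq := by
    have h : iIndepFun (fun k (ω : κ → E) => ω k) (Measure.pi fun _ : κ => m) :=
      iIndepFun_pi (X := fun _ x => x) (fun _ => aemeasurable_id)
    have h2 := h.precomp hσ
    rw [iIndepFun_iff_map_fun_eq_pi_map
      (fun i => (measurable_pi_apply (σ i)).aemeasurable)] at h2
    refine h2.trans ?_
    congr 1
    ext1 i
    exact (measurePreserving_eval (fun _ : κ => m) (σ i)).map_eq

namespace OzarowLeung

/-! ### The evolution of the error state -/

theorem sgn_mul_self (ρ : ℝ) : sgn ρ * sgn ρ = 1 := by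
  unfold sgn; split_ifs <;> norm_num

theorem sgn_mul_eq_abs (ρ : ℝ) : sgn ρ * ρ = |ρ| := by
  unfold sgn
  split_ifs with h
  · rw [abs_of_nonneg h, one_mul]
  · rw [abs_of_neg (not_le.mp h)]; ring

theorem abs_sgn (ρ : ℝ) : |sgn ρ| = 1 := by
  unfold sgn; split_ifs <;> simp

/-- The squared amplitude `Ψ²`. -/
def ampSq (P g a : ℝ) : ℝ := P / (1 + g ^ 2 + 2 * g * a)

section amp

variable {P g ρ : ℝ}

theorem ampDen_pos (hg : 0 ≤ g) {a : ℝ} (ha : 0 ≤ a) : 0 < 1 + g ^ 2 + 2 * g * a := by positivity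

theorem ampSq_pos (hP : 0 < P) (hg : 0 ≤ g) {a : ℝ} (ha : 0 ≤ a) : 0 < ampSq P g a :=
  div_pos hP (ampDen_pos hg ha)

theorem sqrt_ampSq_mul_self (hP : 0 < P) (hg : 0 ≤ g) (ρ : ℝ) :
    √(ampSq P g |ρ|) * √(ampSq P g |ρ|) = ampSq P g |ρ| :=
  Real.mul_self_sqrt (ampSq_pos hP hg (abs_nonneg ρ)).le

theorem cross_zero : cross P g ρ 0 = √(ampSq P g |ρ|) * (1 + g * |ρ|) := by
  simp only [cross, amp, ampSq, Matrix.cons_val_zero, Matrix.cons_val_one]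
  rw [← sgn_mul_eq_abs]
  ring

theorem cross_one : cross P g ρ 1 = √(ampSq P g |ρ|) * (sgn ρ * (g + |ρ|)) := by
  simp only [cross, amp, ampSq, Matrix.cons_val_zero, Matrix.cons_val_one]
  rw [mul_add (sgn ρ), ← sgn_mul_eq_abs ρ, ← mul_assoc (sgn ρ) (sgn ρ), sgn_mul_self]
  ring

theorem cross_zero_sq (hP : 0 < P) (hg : 0 ≤ g) :
    cross P g ρ 0 ^ 2 = ampSq P g |ρ| * (1 + g * |ρ|) ^ 2 := by
  rw [cross_zero, mul_pow, sq (√_), sqrt_ampSq_mul_self hP hg]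

theorem cross_one_sq (hP : 0 < P) (hg : 0 ≤ g) :
    cross P g ρ 1 ^ 2 = ampSq P g |ρ| * (g + |ρ|) ^ 2 := by
  rw [cross_one, mul_pow, sq (√_), sqrt_ampSq_mul_self hP hg, mul_pow, sq (sgn ρ), sgn_mul_self,
    one_mul]

theorem cross_zero_mul_one (hP : 0 < P) (hg : 0 ≤ g) :
    cross P g ρ 0 * cross P g ρ 1 = sgn ρ * (ampSq P g |ρ| * (1 + g * |ρ|) * (g + |ρ|)) := by
  rw [cross_zero, cross_one]
  linear_combination sgn ρ * (1 + g * |ρ|) * (g + |ρ|) * sqrt_ampSq_mul_self hP hg ρ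

/-- An instance of Cauchy–Schwarz for the signal, of variance `P`, and a normalized error. With
positive noise variance it keeps the factor `1 - cross ^ 2 / (P + S i i)` positive. -/
theorem cross_sq_le (hP : 0 < P) (hg : 0 ≤ g) (hρ : |ρ| ≤ 1) (i : Fin 2) :
    cross P g ρ i ^ 2 ≤ P := by
  have h0 := abs_nonneg ρ
  have hd := ampDen_pos hg h0
  have h1 : |ρ| ^ 2 ≤ 1 := by nlinarith
  fin_cases i
  · simp only [Fin.zero_eta, cross_zero_sq hP hg, ampSq, div_mul_eq_mul_div, div_le_iff₀ hd]
    refine mul_le_mul_of_nonneg_left ?_ hP.le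
    nlinarith [sq_nonneg g]
  · simp only [Fin.mk_one, cross_one_sq hP hg, ampSq, div_mul_eq_mul_div, div_le_iff₀ hd]
    refine mul_le_mul_of_nonneg_left ?_ hP.le
    nlinarith [sq_nonneg g]

/-- The power of the transmitted signal. -/
theorem amp_power (hP : 0 < P) (hg : 0 ≤ g) :
    amp P g ρ 0 ^ 2 + amp P g ρ 1 ^ 2 + 2 * amp P g ρ 0 * amp P g ρ 1 * ρ = P := by
  have hd := ampDen_pos hg (abs_nonneg ρ)
  have h := sqrt_ampSq_mul_self hP hg ρ
  have e : amp P g ρ 0 ^ 2 + amp P g ρ 1 ^ 2 + 2 * amp P g ρ 0 * amp P g ρ 1 * ρ =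
      (√(ampSq P g |ρ|) * √(ampSq P g |ρ|)) *
        (1 + g ^ 2 * (sgn ρ * sgn ρ) + 2 * g * (sgn ρ * ρ)) := by
    simp only [amp, ampSq, Matrix.cons_val_zero, Matrix.cons_val_one]
    ring
  rw [e, h, sgn_mul_self, sgn_mul_eq_abs, ampSq, mul_one]
  exact div_mul_cancel₀ _ hd.ne'

end amp

/-! ### Linear forms in the seed and the noise -/

/-- The coefficients of a linear form in the seed and the noises. -/
abbrev Weight : Type := ℝ × (ℕ → Fin 2 → ℝ)

/-- The linear form with given coefficients. -/
def evalWeight {N : ℕ} (x : Weight) (u : ℝ) (z : Fin N → EuclideanSpace ℝ (Fin 2)) : ℝ :=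
  x.1 * u + ∑ k : Fin N, ∑ i, x.2 k i * z k i

theorem evalWeight_add {N : ℕ} (x y : Weight) (u : ℝ) (z : Fin N → EuclideanSpace ℝ (Fin 2)) :
    evalWeight (x + y) u z = evalWeight x u z + evalWeight y u z := by
  simp only [evalWeight, Prod.fst_add, Prod.snd_add, Pi.add_apply, add_mul, Finset.sum_add_distrib]
  ring

theorem evalWeight_smul {N : ℕ} (c : ℝ) (x : Weight) (u : ℝ)
    (z : Fin N → EuclideanSpace ℝ (Fin 2)) :
    evalWeight (c • x) u z = c * evalWeight x u z := by
  simp only [evalWeight, Prod.smul_fst, Prod.smul_snd, Pi.smul_apply, smul_eq_mul, mul_add,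
    Finset.mul_sum, mul_assoc]

/-- The covariance of two linear forms, with `M` noise pairs of covariance `S`. -/
def covForm (M : ℕ) (S : Matrix (Fin 2) (Fin 2) ℝ) : LinearMap.BilinForm ℝ Weight :=
  LinearMap.mk₂ ℝ
    (fun x y => x.1 * y.1 + ∑ k ∈ Finset.range M, ∑ i, ∑ j, x.2 k i * S i j * y.2 k j)
    (by intros; simp only [Prod.fst_add, Prod.snd_add, Pi.add_apply, add_mul,
          Finset.sum_add_distrib]; ring)
    (by intros; simp only [Prod.smul_fst, Prod.smul_snd, Pi.smul_apply, smul_eq_mul, mul_add,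
          Finset.mul_sum, mul_assoc])
    (by intros; simp only [Prod.fst_add, Prod.snd_add, Pi.add_apply, mul_add,
          Finset.sum_add_distrib]; ring)
    (by
      intros
      simp only [Prod.smul_fst, Prod.smul_snd, Pi.smul_apply, smul_eq_mul, mul_add, Finset.mul_sum]
      congr 1
      · ring
      · refine Finset.sum_congr rfl fun _ _ => Finset.sum_congr rfl fun _ _ =>
          Finset.sum_congr rfl fun _ _ => ?_
        ring)

theorem covForm_apply (M : ℕ) (S : Matrix (Fin 2) (Fin 2) ℝ) (x y : Weight) :
    covForm M S x y =
      x.1 * y.1 + ∑ k ∈ Finset.range M, ∑ i, ∑ j, x.2 k i * S i j * y.2 k j := rfl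

section covForm

variable {M : ℕ} {S : Matrix (Fin 2) (Fin 2) ℝ}

theorem symm_of_posSemidef (hS : S.PosSemidef) (i j : Fin 2) : S i j = S j i := by
  simpa using hS.isHermitian.apply j i

theorem quadForm_nonneg (hS : S.PosSemidef) (a : Fin 2 → ℝ) : 0 ≤ ∑ i, ∑ j, a i * S i j * a j := by
  have := hS.dotProduct_mulVec_nonneg a
  simp only [dotProduct, Matrix.mulVec, Fin.sum_univ_two, star_trivial, Pi.star_apply] at this ⊢
  linarith

theorem covForm_comm (hS : S.PosSemidef) (x y : Weight) : covForm M S x y = covForm M S y x := by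
  rw [covForm_apply, covForm_apply, mul_comm x.1]
  congr 1
  refine Finset.sum_congr rfl fun k _ => ?_
  rw [Finset.sum_comm]
  refine Finset.sum_congr rfl fun i _ => Finset.sum_congr rfl fun j _ => ?_
  rw [symm_of_posSemidef hS]; ring

theorem covForm_self_nonneg (hS : S.PosSemidef) (x : Weight) : 0 ≤ covForm M S x x := by
  rw [covForm_apply]
  exact add_nonneg (mul_self_nonneg _) (Finset.sum_nonneg fun k _ => quadForm_nonneg hS _)

/-- Cauchy–Schwarz, from the discriminant of the nonnegative quadratic polynomial `t ↦ covForm (x +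
t y) (x + t y)`. -/
theorem covForm_sq_le (hS : S.PosSemidef) (x y : Weight) :
    covForm M S x y ^ 2 ≤ covForm M S x x * covForm M S y y := by
  have h (t : ℝ) : 0 ≤ covForm M S y y * (t * t) + 2 * covForm M S x y * t + covForm M S x x := by
    have := covForm_self_nonneg (M := M) hS (x + t • y)
    simp only [map_add, map_smul, LinearMap.add_apply, LinearMap.smul_apply, smul_eq_mul,
      covForm_comm hS y x] at this
    linarith
  have := discrim_le_zero h
  rw [discrim] at this
  linarith

/-- The noise of receiver `i` in step `n`. -/
def noiseWeight (n : ℕ) (i : Fin 2) : Weight := (0, Pi.single n (Pi.single i 1))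

theorem evalWeight_noiseWeight {N : ℕ} (n : Fin N) (i : Fin 2) (u : ℝ)
    (z : Fin N → EuclideanSpace ℝ (Fin 2)) : evalWeight (noiseWeight n i) u z = z n i := by
  simp only [evalWeight, noiseWeight, zero_mul, zero_add]
  rw [Finset.sum_eq_single n, Finset.sum_eq_single i]
  · simp
  · intro j _ hj; simp [hj]
  · simp
  · intro k _ hk
    have : (k : ℕ) ≠ n := fun h => hk (Fin.ext h)
    simp [this]
  · simp

theorem covForm_noiseWeight_left {n : ℕ} (hn : n < M) (i : Fin 2) (x : Weight) :
    covForm M S (noiseWeight n i) x = ∑ j, S i j * x.2 n j := by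
  rw [covForm_apply, Finset.sum_eq_single n, Finset.sum_eq_single i]
  · simp [noiseWeight]
  · intro j _ hj; simp [noiseWeight, hj]
  · simp
  · intro k _ hk
    simp [noiseWeight, hk]
  · simp [hn]

theorem covForm_noiseWeight_noiseWeight {n : ℕ} (hn : n < M) (i j : Fin 2) :
    covForm M S (noiseWeight n i) (noiseWeight n j) = S i j := by
  rw [covForm_noiseWeight_left hn, Finset.sum_eq_single j]
  · simp [noiseWeight]
  · intro l _ hl; simp [noiseWeight, hl]
  · simp

end covForm

section errWeight

variable (P : ℝ) (S : Matrix (Fin 2) (Fin 2) ℝ) (g : ℝ) (κ : Fin 2 → ℝ)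

/-- The error of receiver `i` after `2 + k` transmissions, as a linear form. -/
def errWeight : ℕ → Fin 2 → Weight
  -- Receiver `i` gets its message point in step `i`, so this is the only noise in its first
  -- estimate.
  | 0, i => (κ i, 0) + (1 / √P) • noiseWeight i i
  | k + 1, i => errWeight k i + gain P S g κ i (k + 2) •
      (noiseWeight (k + 2) i + ∑ l, errCoeff P S g κ l (k + 2) • errWeight k l)

/-- The transmission of step `k + 2`, as a linear form. -/
def inputWeight (k : ℕ) : Weight := ∑ l, errCoeff P S g κ l (k + 2) • errWeight P S g κ k l

theorem errWeight_succ (k : ℕ) (i : Fin 2) :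
    errWeight P S g κ (k + 1) i = errWeight P S g κ k i + gain P S g κ i (k + 2) •
      (noiseWeight (k + 2) i + inputWeight P S g κ k) := rfl

/-- Causality. It makes the noise of step `k + 2` uncorrelated with the current errors and with the
signal built from them. -/
theorem errWeight_snd_eq_zero (k : ℕ) (i : Fin 2) {n : ℕ} (hn : k + 2 ≤ n) :
    (errWeight P S g κ k i).2 n = 0 := by
  induction k generalizing i n with
  | zero =>
    have : n ≠ (i : ℕ) := by omega
    simp [errWeight, noiseWeight, this]
  | succ k ih =>
    have h1 : n ≠ k + 2 := by omega
    simp [errWeight, noiseWeight, h1, ih _ (show k + 2 ≤ n by omega)]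

theorem inputWeight_snd_eq_zero (k : ℕ) {n : ℕ} (hn : k + 2 ≤ n) :
    (inputWeight P S g κ k).2 n = 0 := by
  simp [inputWeight, errWeight_snd_eq_zero P S g κ k _ hn]

end errWeight

/-- The state consists of the variances and the correlation coefficient of the errors. -/
structure State.Valid (s : State) (S : Matrix (Fin 2) (Fin 2) ℝ) (M : ℕ) (x : Fin 2 → Weight) :
    Prop where
  var_pos : ∀ i, 0 < s.var i
  abs_corr_le : |s.corr| ≤ 1
  var_eq : ∀ i, covForm M S (x i) (x i) = s.var i
  corr_eq : covForm M S (x 0) (x 1) = s.corr * (√(s.var 0) * √(s.var 1))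

section valid

variable {P : ℝ} {S : Matrix (Fin 2) (Fin 2) ℝ} {g : ℝ} {κ : Fin 2 → ℝ}

/-- The bound on the correlation coefficient comes for free from Cauchy–Schwarz. -/
theorem State.valid_of_eq (hS : S.PosSemidef) {s : State} {M : ℕ} {x : Fin 2 → Weight}
    (hpos : ∀ i, 0 < s.var i) (hvar : ∀ i, covForm M S (x i) (x i) = s.var i)
    (hcorr : covForm M S (x 0) (x 1) = s.corr * (√(s.var 0) * √(s.var 1))) : s.Valid S M x where
  var_pos := hpos
  var_eq := hvar
  corr_eq := hcorr
  abs_corr_le := by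
    have h := covForm_sq_le (M := M) hS (x 0) (x 1)
    rw [hvar, hvar, hcorr, mul_pow, mul_pow, Real.sq_sqrt (hpos 0).le, Real.sq_sqrt (hpos 1).le]
      at h
    have h01 := mul_pos (hpos 0) (hpos 1)
    rw [← sq_le_one_iff_abs_le_one]
    exact le_of_mul_le_mul_right (by linarith) h01

/-- The two initial noises belong to different steps, so the correlation of the errors is due to the
common seed alone. -/
theorem initState_valid (hP : 0 < P) (hS : S.PosSemidef) (hd : ∀ i, 0 < S i i) {M : ℕ}
    (hM : 2 ≤ M) : (initState P S κ).Valid S M (errWeight P S g κ 0) := by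
  have hpos (i : Fin 2) : 0 < S i i / P + κ i ^ 2 :=
    add_pos_of_pos_of_nonneg (div_pos (hd i) hP) (sq_nonneg _)
  have hi (i : Fin 2) : (i : ℕ) < M := by omega
  have hz (i j : Fin 2) (h : i ≠ j) : covForm M S (noiseWeight i i) (noiseWeight j j) = 0 := by
    have : (i : ℕ) ≠ j := fun e => h (Fin.ext e)
    rw [covForm_noiseWeight_left (hi i)]
    simp [noiseWeight, this]
  have hc (c : ℝ) (n : ℕ) (i : Fin 2) (hn : n < M) :
      covForm M S (noiseWeight n i) (c, 0) = 0 := by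
    rw [covForm_noiseWeight_left hn]; simp
  have hc' (c : ℝ) (n : ℕ) (i : Fin 2) : covForm M S (c, 0) (noiseWeight n i) = 0 := by
    simp [covForm_apply, noiseWeight]
  have hcc (c c' : ℝ) : covForm M S (c, 0) (c', 0) = c * c' := by
    simp [covForm_apply]
  refine State.valid_of_eq hS hpos (fun i => ?_) ?_
  · simp only [errWeight, map_add, map_smul, LinearMap.add_apply, LinearMap.smul_apply,
      smul_eq_mul, hcc, hc', hc _ _ _ (hi i), covForm_noiseWeight_noiseWeight (hi i), initState]
    have : 1 / √P * (1 / √P) = 1 / P := by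
      rw [div_mul_div_comm, Real.mul_self_sqrt hP.le, one_mul]
    linear_combination S i i * this
  · simp only [errWeight, map_add, map_smul, LinearMap.add_apply, LinearMap.smul_apply,
      smul_eq_mul, hcc, hc', hc _ _ _ (hi 0), hz 0 1 (by decide), initState]
    rw [← Real.sqrt_mul (hpos 0).le, div_mul_cancel₀]
    · ring
    · exact (Real.sqrt_pos.mpr (mul_pos (hpos 0) (hpos 1))).ne'

section step

theorem covForm_noiseWeight_errWeight {k M : ℕ} (hM : k + 3 ≤ M) (i j : Fin 2) :
    covForm M S (noiseWeight (k + 2) i) (errWeight P S g κ k j) = 0 := by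
  rw [covForm_noiseWeight_left (by omega)]
  simp [errWeight_snd_eq_zero]

theorem covForm_noiseWeight_inputWeight {k M : ℕ} (hM : k + 3 ≤ M) (i : Fin 2) :
    covForm M S (noiseWeight (k + 2) i) (inputWeight P S g κ k) = 0 := by
  simp [inputWeight, covForm_noiseWeight_errWeight hM]

variable {k M : ℕ} (h : (state P S g κ k).Valid S M (errWeight P S g κ k))
include h

theorem errCoeff_mul_sqrt (i : Fin 2) :
    errCoeff P S g κ i (k + 2) * √((state P S g κ k).var i) = amp P g (state P S g κ k).corr i := by
  simp only [errCoeff, Nat.add_sub_cancel]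
  exact div_mul_cancel₀ _ (Real.sqrt_pos.mpr (h.var_pos i)).ne'

theorem covForm_inputWeight_errWeight (hS : S.PosSemidef) (i : Fin 2) :
    covForm M S (inputWeight P S g κ k) (errWeight P S g κ k i) =
      √((state P S g κ k).var i) * cross P g (state P S g κ k).corr i := by
  have h0 := errCoeff_mul_sqrt h 0
  have h1 := errCoeff_mul_sqrt h 1
  have s0 := Real.mul_self_sqrt (h.var_pos 0).le
  have s1 := Real.mul_self_sqrt (h.var_pos 1).le
  have hc := h.corr_eq
  simp only [inputWeight, Fin.sum_univ_two, map_add, map_smul, LinearMap.add_apply,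
    LinearMap.smul_apply, smul_eq_mul]
  fin_cases i
  · simp only [Fin.zero_eta, h.var_eq, covForm_comm hS (errWeight P S g κ k 1), hc, cross,
      Matrix.cons_val_zero, ← h0, ← h1]
    linear_combination (-errCoeff P S g κ 0 (k + 2)) * s0
  · simp only [Fin.mk_one, h.var_eq, hc, cross,
      Matrix.cons_val_one, Matrix.cons_val_fin_one, ← h0, ← h1]
    linear_combination (-errCoeff P S g κ 1 (k + 2)) * s1

/-- The amplitudes are normalized for the correlation coefficient stored in the state; the power is
exactly `P` because validity makes it the true one. -/
theorem covForm_inputWeight (hP : 0 < P) (hg : 0 ≤ g) (hS : S.PosSemidef) :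
    covForm M S (inputWeight P S g κ k) (inputWeight P S g κ k) = P := by
  have e : covForm M S (inputWeight P S g κ k) (inputWeight P S g κ k) =
      ∑ l, errCoeff P S g κ l (k + 2) *
        covForm M S (inputWeight P S g κ k) (errWeight P S g κ k l) := by
    change covForm M S (inputWeight P S g κ k) (∑ l, errCoeff P S g κ l (k + 2) •
      errWeight P S g κ k l) = _
    simp only [map_sum, map_smul, smul_eq_mul]
  rw [e]
  simp only [covForm_inputWeight_errWeight h hS, Fin.sum_univ_two, ← mul_assoc,
    errCoeff_mul_sqrt h]
  have := amp_power (ρ := (state P S g κ k).corr) hP hg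
  simp only [cross, Matrix.cons_val_zero, Matrix.cons_val_one]
  linear_combination this

/-- Bilinear expansion. The output is signal plus fresh noise, of variance `P + S i i`, and `gain`
is minus the covariance of error and output divided by this variance. -/
theorem step_valid (hP : 0 < P) (hg : 0 ≤ g) (hS : S.PosSemidef) (hd : ∀ i, 0 < S i i)
    (hM : k + 3 ≤ M) : (state P S g κ (k + 1)).Valid S M (errWeight P S g κ (k + 1)) := by
  set s := state P S g κ k with hs
  have hq (i : Fin 2) : 0 < P + S i i := add_pos hP (hd i)
  have hφ (i : Fin 2) : 0 < 1 - cross P g s.corr i ^ 2 / (P + S i i) := by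
    have := cross_sq_le hP hg h.abs_corr_le i
    rw [sub_pos, div_lt_one (hq i)]
    linarith [hd i]
  have hpos (i : Fin 2) : 0 < (step P S g s).var i := mul_pos (h.var_pos i) (hφ i)
  have hXe (i : Fin 2) := covForm_inputWeight_errWeight h hS i
  have hX := covForm_inputWeight h hP hg hS
  have hne := covForm_noiseWeight_errWeight (P := P) (S := S) (g := g) (κ := κ) hM
  have hnX := covForm_noiseWeight_inputWeight (P := P) (S := S) (g := g) (κ := κ) hM
  have hgain (i : Fin 2) : gain P S g κ i (k + 2) =
      -(√(s.var i) * cross P g s.corr i / (P + S i i)) := by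
    simp [gain, hs]
  have ss (i : Fin 2) := Real.mul_self_sqrt (h.var_pos i).le
  refine State.valid_of_eq hS hpos (fun i => ?_) ?_
  · simp only [errWeight_succ, map_add, map_smul, LinearMap.add_apply, LinearMap.smul_apply,
      smul_eq_mul, h.var_eq, hXe, hX, hne, hnX, covForm_comm hS (errWeight P S g κ k _),
      covForm_comm hS (inputWeight P S g κ k) (noiseWeight _ _),
      covForm_noiseWeight_noiseWeight (show k + 2 < M by omega), hgain]
    change _ = s.var i * (1 - cross P g s.corr i ^ 2 / (P + S i i))
    have hqi := (hq i).ne'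
    have hr := ss i
    simp only [← hs]
    -- With `r * r` in place of the variance, the identity is one of rational functions.
    generalize √(s.var i) = r at hr ⊢
    rw [← hr]
    field_simp
    ring
  · have hprod : √((state P S g κ (k + 1)).var 0) * √((state P S g κ (k + 1)).var 1) =
        √(s.var 0) * √(s.var 1) * √((1 - cross P g s.corr 0 ^ 2 / (P + S 0 0)) *
          (1 - cross P g s.corr 1 ^ 2 / (P + S 1 1))) := by
      change √(s.var 0 * _) * √(s.var 1 * _) = _
      rw [Real.sqrt_mul (h.var_pos 0).le, Real.sqrt_mul (h.var_pos 1).le,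
        Real.sqrt_mul (hφ 0).le]
      ring
    have hden := (Real.sqrt_pos.mpr (mul_pos (hφ 0) (hφ 1))).ne'
    have hcorr : (state P S g κ (k + 1)).corr = (s.corr - cross P g s.corr 0 * cross P g s.corr 1 *
        (1 / (P + S 0 0) + 1 / (P + S 1 1) - (P + S 0 1) / ((P + S 0 0) * (P + S 1 1)))) /
      √((1 - cross P g s.corr 0 ^ 2 / (P + S 0 0)) *
        (1 - cross P g s.corr 1 ^ 2 / (P + S 1 1))) := rfl
    rw [hprod, hcorr, mul_comm (√(s.var 0) * _), ← mul_assoc, div_mul_cancel₀ _ hden]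
    simp only [errWeight_succ, map_add, map_smul, LinearMap.add_apply, LinearMap.smul_apply,
      smul_eq_mul, h.corr_eq, hXe, hX, hne, hnX, covForm_comm hS (errWeight P S g κ k _),
      covForm_comm hS (inputWeight P S g κ k) (noiseWeight _ _),
      covForm_noiseWeight_noiseWeight (show k + 2 < M by omega), hgain]
    simp only [← hs]
    have h0 := (hq 0).ne'
    have h1 := (hq 1).ne'
    field_simp
    ring

end step

theorem state_valid (hP : 0 < P) (hg : 0 ≤ g) (hS : S.PosSemidef) (hd : ∀ i, 0 < S i i) {M : ℕ}
    (k : ℕ) (hM : k + 2 ≤ M) : (state P S g κ k).Valid S M (errWeight P S g κ k) := by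
  induction k with
  | zero => exact initState_valid hP hS hd hM
  | succ k ih => exact step_valid (ih (by omega)) hP hg hS hd (by omega)

theorem state_var_pos (hP : 0 < P) (hg : 0 ≤ g) (hS : S.PosSemidef) (hd : ∀ i, 0 < S i i)
    (k : ℕ) (i : Fin 2) : 0 < (state P S g κ k).var i :=
  (state_valid hP hg hS hd k le_rfl).var_pos i

theorem abs_state_corr_le (hP : 0 < P) (hg : 0 ≤ g) (hS : S.PosSemidef) (hd : ∀ i, 0 < S i i)
    (k : ℕ) : |(state P S g κ k).corr| ≤ 1 :=
  (state_valid hP hg hS hd k le_rfl).abs_corr_le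

end valid

end OzarowLeung

/-! ### Averages over the messages -/

section msgAvg

variable {Msg : Fin 2 → Type} [∀ i, Fintype (Msg i)]

theorem card_msg_ne_zero [∀ i, Nonempty (Msg i)] :
    (Fintype.card (∀ i, Msg i) : ℝ≥0∞) ≠ 0 := by
  exact_mod_cast Fintype.card_ne_zero

theorem msgAvg_mono {f g : (∀ i, Msg i) → ℝ≥0∞} (h : ∀ w, f w ≤ g w) : msgAvg f ≤ msgAvg g :=
  ENNReal.div_le_div_right (Finset.sum_le_sum fun w _ => h w) _

theorem msgAvg_const [∀ i, Nonempty (Msg i)] (c : ℝ≥0∞) :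
    msgAvg (fun _ : ∀ i, Msg i => c) = c := by
  rw [msgAvg, Finset.sum_const, nsmul_eq_mul, Finset.card_univ, mul_comm,
    ENNReal.mul_div_cancel_right card_msg_ne_zero (ENNReal.natCast_ne_top _)]

theorem msgAvg_le_of_le [∀ i, Nonempty (Msg i)] {f : (∀ i, Msg i) → ℝ≥0∞} {c : ℝ≥0∞}
    (h : ∀ w, f w ≤ c) : msgAvg f ≤ c :=
  (msgAvg_mono h).trans_eq (msgAvg_const c)

theorem le_msgAvg_of_le [∀ i, Nonempty (Msg i)] {f : (∀ i, Msg i) → ℝ≥0∞} {c : ℝ≥0∞}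
    (h : ∀ w, c ≤ f w) : c ≤ msgAvg f :=
  (msgAvg_const (Msg := Msg) c).symm.trans_le (msgAvg_mono h)

theorem msgAvg_coord [∀ i, Nonempty (Msg i)] (i : Fin 2) (f : Msg i → ℝ≥0∞) :
    msgAvg (fun w : ∀ i, Msg i => f (w i)) = (∑ j, f j) / Fintype.card (Msg i) := by
  have hc : (Fintype.card (∀ i, Msg i) : ℝ≥0∞) =
      Fintype.card (Msg 0) * Fintype.card (Msg 1) := by
    rw [Fintype.card_pi, Fin.prod_univ_two, Nat.cast_mul]
  have hne (i : Fin 2) : (Fintype.card (Msg i) : ℝ≥0∞) ≠ 0 := by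
    exact_mod_cast Fintype.card_ne_zero
  have hs : ∑ w : ∀ i, Msg i, f (w i) =
      ∑ p : Msg 0 × Msg 1, f ((piFinTwoEquiv Msg).symm p i) :=
    Fintype.sum_equiv (piFinTwoEquiv Msg) _ _ fun w => by rw [Equiv.symm_apply_apply]
  rw [msgAvg, hc, hs, Fintype.sum_prod_type]
  fin_cases i
  · simp only [Fin.zero_eta, piFinTwoEquiv_symm_apply, Fin.cons_zero, Finset.sum_const,
      nsmul_eq_mul, Finset.card_univ, ← Finset.mul_sum]
    rw [mul_comm, ENNReal.mul_div_mul_right _ _ (hne 1) (ENNReal.natCast_ne_top _)]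
  · change (∑ _x : Msg 0, ∑ y : Msg 1, f y) / _ = _
    simp only [Finset.sum_const, nsmul_eq_mul, Finset.card_univ]
    exact ENNReal.mul_div_mul_left _ _ (hne 0) (ENNReal.natCast_ne_top _)

end msgAvg

namespace OzarowLeung

/-! ### Amplitude modulation -/

theorem sum_pam (m : ℕ) : ∑ j, pam m j = 0 := by
  simp only [pam, ← Finset.sum_mul]
  rw [Fin.sum_univ_eq_sum_range (fun j => 2 * (j : ℝ) - ((m : ℝ) - 1))]
  -- The upper limit is detached from `m`, which also occurs in the summand, so that induction
  -- applies.
  have (n : ℕ) : ∑ j ∈ Finset.range n, (2 * (j : ℝ) - ((m : ℝ) - 1)) = n * (n - m) := by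
    induction n with
    | zero => simp
    | succ n ih => rw [Finset.sum_range_succ, ih]; push_cast; ring
  rw [this]; ring

theorem three_div_pos {m : ℕ} (hm : 2 ≤ m) : 0 < 3 / ((m : ℝ) ^ 2 - 1) := by
  have : (2 : ℝ) ≤ m := by exact_mod_cast hm
  exact div_pos (by norm_num) (by nlinarith)

theorem sum_pam_sq {m : ℕ} (hm : 2 ≤ m) : ∑ j, pam m j ^ 2 = m := by
  have h3 := three_div_pos hm
  have hm' : (2 : ℝ) ≤ m := by exact_mod_cast hm
  simp only [pam, mul_pow, Real.sq_sqrt h3.le, ← Finset.sum_mul]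
  rw [Fin.sum_univ_eq_sum_range (fun j => (2 * (j : ℝ) - ((m : ℝ) - 1)) ^ 2)]
  have (n : ℕ) : ∑ j ∈ Finset.range n, (2 * (j : ℝ) - ((m : ℝ) - 1)) ^ 2 =
      (n : ℝ) * ((m : ℝ) - 1) ^ 2 - 2 * ((m : ℝ) - 1) * ((n : ℝ) * ((n : ℝ) - 1)) +
        2 * (n : ℝ) * ((n : ℝ) - 1) * (2 * (n : ℝ) - 1) / 3 := by
    induction n with
    | zero => simp
    | succ n ih => rw [Finset.sum_range_succ, ih]; push_cast; ring
  rw [this]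
  have : (m : ℝ) ^ 2 - 1 ≠ 0 := by nlinarith
  field_simp
  ring

/-- The constellation has mean zero and mean square one, so the cross term drops out. The offset `c`
plays the role of the noise. -/
theorem msgAvg_pam {m : Fin 2 → ℕ} (hm : ∀ i, 2 ≤ m i) (i : Fin 2) (a c : ℝ) :
    msgAvg (Msg := fun i => Fin (m i)) (fun w => ENNReal.ofReal ((a * pam (m i) (w i) + c) ^ 2)) =
      ENNReal.ofReal (a ^ 2 + c ^ 2) := by
  have : ∀ i, NeZero (m i) := fun i => ⟨by have := hm i; omega⟩
  have hm0 : (0 : ℝ) < m i := by exact_mod_cast (Nat.zero_lt_two.trans_le (hm i))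
  rw [msgAvg_coord (Msg := fun i => Fin (m i)) i
    (fun j => ENNReal.ofReal ((a * pam (m i) j + c) ^ 2)),
    ← ENNReal.ofReal_sum_of_nonneg (fun _ _ => sq_nonneg _)]
  have : ∑ j, (a * pam (m i) j + c) ^ 2 = m i * (a ^ 2 + c ^ 2) := by
    have e (j : Fin (m i)) : (a * pam (m i) j + c) ^ 2 =
      a ^ 2 * pam (m i) j ^ 2 + 2 * a * c * pam (m i) j + c ^ 2 := by ring
    simp only [e, Finset.sum_add_distrib, ← Finset.mul_sum, sum_pam, sum_pam_sq (hm i),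
      Finset.sum_const, Finset.card_univ, Fintype.card_fin, nsmul_eq_mul]
    ring
  rw [this, Fintype.card_fin, ENNReal.ofReal_mul hm0.le, ENNReal.ofReal_natCast, mul_comm,
    ENNReal.mul_div_cancel_right (by exact_mod_cast hm0.ne') (ENNReal.natCast_ne_top _)]

end OzarowLeung

/-! ### Linear feedback codes -/

namespace LFC

variable {N : ℕ} {m : Fin 2 → ℕ} (L : LFC N m)

theorem feedback_eq (i : Fin 2) (n : Fin N) (y : Fin N → ℝ) :
    L.feedback i n (fun k => y k.1) = ∑ k, if k < n then L.coeff i n k * y k else 0 := by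
  rw [feedback, ← Finset.sum_filter]
  exact (Finset.sum_subtype (Finset.univ.filter (· < n)) (by simp)
    (fun k => L.coeff i n k * y k)).symm

theorem input_eq (w : ∀ i, Fin (m i)) (u : ℝ) (z : Fin N → EuclideanSpace ℝ (Fin 2)) (n : Fin N) :
    L.input w u z n = L.codebook n w u -
      ∑ i, ∑ k, if k < n then L.coeff i n k * L.output w u z i k else 0 := by
  rw [input]
  simp only [← feedback_eq]
  rfl

end LFC

namespace OzarowLeung

/-! ### Inputs and errors of the scheme are linear forms -/

section scheme

variable {P : ℝ} {S : Matrix (Fin 2) (Fin 2) ℝ} {g : ℝ} {κ : Fin 2 → ℝ} {N : ℕ} {m : Fin 2 → ℕ}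
  (w : ∀ i, Fin (m i)) (u : ℝ) (z : Fin N → EuclideanSpace ℝ (Fin 2))

theorem input_scheme_of_lt_two (n : Fin N) (i : Fin 2) (hn : n.val = i.val) :
    (scheme P S g κ N m).input w u z n = √P * pam (m i) (w i) := by
  have h2 : n.val < 2 := hn ▸ i.isLt
  rw [LFC.input_eq]
  simp only [scheme, h2, if_true, zero_mul, ite_self, Finset.sum_const_zero, sub_zero]
  fin_cases i
  · simp [hn]
  · simp [hn]

variable (P S g κ) in
/-- The error of the estimate of receiver `i` based on the first `n` outputs. -/
def partialErr (i : Fin 2) (n : ℕ) : ℝ :=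
  κ i * u + (∑ k : Fin N, if k.val < n then
    gain P S g κ i k * (scheme P S g κ N m).output w u z i k else 0) - pam (m i) (w i)

theorem input_scheme_eq_sum (n : Fin N) (hn : 2 ≤ n.val) :
    (scheme P S g κ N m).input w u z n =
      ∑ i, errCoeff P S g κ i n * partialErr P S g κ w u z i n := by
  rw [LFC.input_eq]
  have h0 : n.val ≠ 0 := by omega
  have h1 : n.val ≠ 1 := by omega
  have h2 : ¬ n.val < 2 := by omega
  have hc : (scheme P S g κ N m).codebook n w u =
      ∑ i, errCoeff P S g κ i n.val * (κ i * u - pam (m i) (w i)) := by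
    simp only [scheme, h0, h1, if_false]
  have hco (i : Fin 2) (k : Fin N) : (scheme P S g κ N m).coeff i n k =
      -(errCoeff P S g κ i n.val * gain P S g κ i k.val) := by
    simp only [scheme, h2, if_false]
  simp only [hc, hco, partialErr]
  rw [← Finset.sum_sub_distrib]
  refine Finset.sum_congr rfl fun i _ => ?_
  have : ∀ k : Fin N, -(if k < n then -(errCoeff P S g κ i n * gain P S g κ i k) *
      (scheme P S g κ N m).output w u z i k else 0) = errCoeff P S g κ i n *
      (if k.val < n.val then gain P S g κ i k * (scheme P S g κ N m).output w u z i k else 0) := by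
    intro k
    simp only [Fin.lt_def]
    split_ifs <;> ring
  rw [mul_sub (errCoeff P S g κ i n) (_ + _), mul_add, Finset.mul_sum,
    ← Finset.sum_congr rfl fun k _ => this k, Finset.sum_neg_distrib]
  ring

theorem partialErr_succ (i : Fin 2) (n : Fin N) :
    partialErr P S g κ w u z i (n + 1) = partialErr P S g κ w u z i n +
      gain P S g κ i n * (scheme P S g κ N m).output w u z i n := by
  have : ∀ k : Fin N, (if k.val < n.val + 1 then
      gain P S g κ i k * (scheme P S g κ N m).output w u z i k else 0) =
      (if k.val < n.val then gain P S g κ i k * (scheme P S g κ N m).output w u z i k else 0) +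
      (if k = n then gain P S g κ i n * (scheme P S g κ N m).output w u z i n else 0) := by
    intro k
    rcases lt_trichotomy k n with h | h | h
    · have h' : k.val < n.val := h
      simp [h', h.ne, Nat.lt_succ_of_lt h']
    · subst h; simp
    · have h' : ¬ k.val < n.val + 1 := by have : n.val < k.val := h; omega
      have h'' : ¬ k.val < n.val := by omega
      simp [h', h'', h.ne']
  simp only [partialErr, this, Finset.sum_add_distrib, Finset.sum_ite_eq', Finset.mem_univ,
    if_true]
  ring

/-- The message points cancel: step `i` delivers the point of receiver `i` with factor `√P`, which
the gain `1 / √P` undoes, and all later outputs are forms in the errors and the noise. -/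
theorem partialErr_eq (hP : 0 < P) (k : ℕ) (hk : k + 2 ≤ N) (i : Fin 2) :
    partialErr P S g κ w u z i (k + 2) = evalWeight (errWeight P S g κ k i) u z := by
  induction k generalizing i with
  | zero =>
    have hP' : √P ≠ 0 := (Real.sqrt_pos.mpr hP).ne'
    have h0 : partialErr P S g κ w u z i 0 = κ i * u - pam (m i) (w i) := by simp [partialErr]
    have h1 := partialErr_succ (P := P) (S := S) (g := g) (κ := κ) w u z i ⟨0, by omega⟩
    have h2 := partialErr_succ (P := P) (S := S) (g := g) (κ := κ) w u z i ⟨1, by omega⟩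
    simp only [zero_add, Nat.reduceAdd] at h1 h2
    have hev : evalWeight ((κ i, 0) : Weight) u z = κ i * u := by simp [evalWeight]
    have hn := evalWeight_noiseWeight (⟨i.val, by omega⟩ : Fin N) i u z
    simp only at hn
    rw [zero_add, h2, h1, h0, errWeight, evalWeight_add, evalWeight_smul, hev, hn]
    have i0 := input_scheme_of_lt_two (P := P) (S := S) (g := g) (κ := κ) w u z ⟨0, by omega⟩ 0 rfl
    have i1 := input_scheme_of_lt_two (P := P) (S := S) (g := g) (κ := κ) w u z ⟨1, by omega⟩ 1 rfl
    fin_cases i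
    · simp [gain, LFC.output, i0]
      field_simp
      ring
    · simp [gain, LFC.output, i1]
      field_simp
      ring
  | succ k ih =>
    have h1 := partialErr_succ (P := P) (S := S) (g := g) (κ := κ) w u z i ⟨k + 2, by omega⟩
    have h2 := input_scheme_eq_sum (P := P) (S := S) (g := g) (κ := κ) w u z ⟨k + 2, by omega⟩
      (by simp)
    have hn := evalWeight_noiseWeight (⟨k + 2, by omega⟩ : Fin N) i u z
    simp only [ih (by omega)] at h1 h2 hn
    rw [show k + 1 + 2 = k + 2 + 1 by ring, h1, errWeight, evalWeight_add, evalWeight_smul,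
      evalWeight_add, hn, LFC.output, h2]
    simp only [Fin.sum_univ_two, evalWeight_add, evalWeight_smul]
    ring

theorem input_scheme (hP : 0 < P) (k : ℕ) (hk : k + 2 < N) :
    (scheme P S g κ N m).input w u z ⟨k + 2, hk⟩ = evalWeight (inputWeight P S g κ k) u z := by
  rw [input_scheme_eq_sum _ _ _ _ (by simp)]
  simp only [partialErr_eq w u z hP k hk.le, inputWeight, Fin.sum_univ_two, evalWeight_add,
    evalWeight_smul]

theorem estimate_scheme (hP : 0 < P) (k : ℕ) (hk : k + 2 = N) (i : Fin 2) :
    estimate P S g κ u i ((scheme P S g κ N m).output w u z i) - pam (m i) (w i) =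
      evalWeight (errWeight P S g κ k i) u z := by
  rw [← partialErr_eq w u z hP k hk.le]
  simp [partialErr, estimate, hk]

end scheme

theorem centeredGaussian_evalWeight {S : Matrix (Fin 2) (Fin 2) ℝ} (hS : S.PosSemidef) (N : ℕ)
    (x : Weight) : CenteredGaussian
      (fun ω : ℝ × (Fin N → EuclideanSpace ℝ (Fin 2)) => evalWeight x ω.1 ω.2) (covForm N S x x)
      ((gaussianReal 0 1).prod (bcNoise N S)) := by
  have h1 := CenteredGaussian.id_gaussianReal_one.const_mul x.1
  have h2 := CenteredGaussian.pi_sum (ι := Fin N) (m := fun _ => multivariateGaussian 0 S)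
    fun k => CenteredGaussian.sum_mul_multivariateGaussian hS (x.2 k)
  have h := h1.prod_add h2
  have e : covForm N S x x = x.1 ^ 2 * 1 + ∑ k : Fin N, ∑ i, ∑ j, x.2 k i * S i j * x.2 k j := by
    rw [covForm_apply, Finset.sum_range]
    ring
  rw [e]
  exact h

instance isProbabilityMeasure_bcNoise (N : ℕ) (S : Matrix (Fin 2) (Fin 2) ℝ) :
    IsProbabilityMeasure (bcNoise N S) := by
  unfold bcNoise; infer_instance

/-- The transmission power is constant. -/
theorem power_scheme {P : ℝ} {S : Matrix (Fin 2) (Fin 2) ℝ} {g : ℝ} (hP : 0 < P) (hg : 0 ≤ g)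
    (hS : S.PosSemidef) (hd : ∀ i, 0 < S i i) (κ : Fin 2 → ℝ) (N : ℕ) {m : Fin 2 → ℕ}
    (hm : ∀ i, 2 ≤ m i) (n : Fin N) : (scheme P S g κ N m).power S n = ENNReal.ofReal P := by
  have : ∀ i, NeZero (m i) := fun i => ⟨by have := hm i; omega⟩
  rw [LFC.power]
  -- The first two steps send a message point, with power from the unit variance of the
  -- constellation; the later ones send a Gaussian form.
  rcases lt_or_ge n.val 2 with h2 | h2
  · have hi := input_scheme_of_lt_two (P := P) (S := S) (g := g) (κ := κ) (m := m) (n := n)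
      (i := ⟨n, h2⟩) (hn := rfl)
    simp only [hi, lintegral_const, measure_univ, mul_one]
    have := msgAvg_pam hm ⟨n, h2⟩ (√P) 0
    simp only [add_zero] at this
    rw [this, Real.sq_sqrt hP.le]
    simp
  · obtain ⟨k, hk⟩ := Nat.exists_eq_add_of_le' h2
    obtain ⟨n, hn⟩ := n
    simp only at hk
    subst hk
    simp only [input_scheme (hP := hP)]
    rw [msgAvg_const (Msg := fun i => Fin (m i)),
      (centeredGaussian_evalWeight hS N (inputWeight P S g κ k)).lintegral_sq,
      covForm_inputWeight (state_valid hP hg hS hd k hn.le) hP hg hS]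

end OzarowLeung

namespace OzarowLeung

/-! ### Dynamics of the state -/

/-- The squared amplitude of the part of the signal that is aligned with the error of receiver `i`,
as a function of the modulus `a` of the correlation coefficient. -/
def crossSq (P g a : ℝ) (i : Fin 2) : ℝ :=
  ampSq P g a * (if i = 0 then 1 + g * a else g + a) ^ 2

/-- The factor by which the error variance of receiver `i` is reduced in one step. -/
def reduction (P : ℝ) (S : Matrix (Fin 2) (Fin 2) ℝ) (g a : ℝ) (i : Fin 2) : ℝ :=
  1 - crossSq P g a i / (P + S i i)

/-- The map that governs the modulus of the correlation coefficient, up to sign. -/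
def corrMap (P : ℝ) (S : Matrix (Fin 2) (Fin 2) ℝ) (g a : ℝ) : ℝ :=
  (a - ampSq P g a * (1 + g * a) * (g + a) *
    (1 / (P + S 0 0) + 1 / (P + S 1 1) - (P + S 0 1) / ((P + S 0 0) * (P + S 1 1)))) /
    √(reduction P S g a 0 * reduction P S g a 1)

section dynamics

variable {P : ℝ} {S : Matrix (Fin 2) (Fin 2) ℝ} {g : ℝ} {κ : Fin 2 → ℝ}

theorem cross_sq (hP : 0 < P) (hg : 0 ≤ g) (ρ : ℝ) (i : Fin 2) :
    cross P g ρ i ^ 2 = crossSq P g |ρ| i := by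
  fin_cases i
  · simp [cross_zero_sq hP hg, crossSq]
  · simp [cross_one_sq hP hg, crossSq]

theorem crossSq_le (hP : 0 < P) (hg : 0 ≤ g) {a : ℝ} (ha : 0 ≤ a) (ha1 : a ≤ 1) (i : Fin 2) :
    crossSq P g a i ≤ P := by
  have := cross_sq_le (ρ := a) hP hg (by rwa [abs_of_nonneg ha]) i
  rwa [cross_sq hP hg, abs_of_nonneg ha] at this

theorem reduction_pos (hP : 0 < P) (hg : 0 ≤ g) (hd : ∀ i, 0 < S i i) {a : ℝ} (ha : 0 ≤ a)
    (ha1 : a ≤ 1) (i : Fin 2) : 0 < reduction P S g a i := by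
  rw [reduction, sub_pos, div_lt_one (add_pos hP (hd i))]
  linarith [crossSq_le hP hg ha ha1 i, hd i]

theorem state_succ_var (hP : 0 < P) (hg : 0 ≤ g) (k : ℕ) (i : Fin 2) :
    (state P S g κ (k + 1)).var i =
      (state P S g κ k).var i * reduction P S g |(state P S g κ k).corr| i := by
  rw [reduction, ← cross_sq hP hg]; rfl

/-- The sign of `ρ` factors out of the recursion. So the modulus evolves by itself, under a map that
is smooth, unlike one that involves `sgn`. -/
theorem abs_state_succ_corr (hP : 0 < P) (hg : 0 ≤ g) (k : ℕ) :
    |(state P S g κ (k + 1)).corr| = |corrMap P S g (|(state P S g κ k).corr|)| := by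
  set ρ := (state P S g κ k).corr with hρ
  have e : (state P S g κ (k + 1)).corr = sgn ρ * corrMap P S g |ρ| := by
    rw [corrMap, reduction, reduction, ← cross_sq hP hg, ← cross_sq hP hg, ← mul_div_assoc, mul_sub]
    have h1 : sgn ρ * |ρ| = ρ := by
      rw [← sgn_mul_eq_abs, ← mul_assoc, sgn_mul_self, one_mul]
    rw [h1, ← mul_assoc (sgn ρ), ← cross_zero_mul_one hP hg]
    rfl
  rw [e, abs_mul, abs_sgn, one_mul]

/-! ### Dependence of the state on the power -/

theorem exists_lipschitz_of_contDiffOn {s : Set (ℝ × ℝ)} (hs : IsCompact s) (hc : Convex ℝ s)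
    {f : ℝ × ℝ → ℝ} (hf : ContDiffOn ℝ 1 f s) :
    ∃ L : ℝ, ∀ x ∈ s, ∀ y ∈ s, |f x - f y| ≤ L * max |x.1 - y.1| |x.2 - y.2| := by
  obtain ⟨K, hK⟩ := (hf.locallyLipschitzOn hc).exists_lipschitzOnWith_of_compact hs
  exact ⟨K, fun x hx y hy => hK.dist_le_mul x hx y hy⟩

/-- The modulus of the correlation obeys a recursion that is Lipschitz on a compact set, so a change
of the power is amplified by at most a constant factor per step. The logarithm of a variance is a
sum of Lipschitz functions of power and modulus. -/
theorem exists_abs_log_var_sub_le (hP : 0 < P) (hg : 0 ≤ g) (hS : S.PosSemidef)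
    (hd : ∀ i, 0 < S i i) (κ : Fin 2 → ℝ) :
    ∃ Λ : ℝ, 1 ≤ Λ ∧ ∀ P' ∈ Set.Icc (P / 2) P, ∀ k i,
      |Real.log ((state P' S g κ k).var i) - Real.log ((state P S g κ k).var i)| ≤
        Λ ^ (k + 1) * (P - P') := by
  -- Powers of at least `P / 2` keep all denominators away from zero.
  set s : Set (ℝ × ℝ) := Set.Icc (P / 2) P ×ˢ Set.Icc 0 1 with hs
  have hsc : IsCompact s := isCompact_Icc.prod isCompact_Icc
  have hsv : Convex ℝ s := (convex_Icc _ _).prod (convex_Icc _ _)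
  have hx1 : ∀ x ∈ s, 0 < x.1 := fun x hx => (half_pos hP).trans_le hx.1.1
  have hden : ∀ x ∈ s, 1 + g ^ 2 + 2 * g * x.2 ≠ 0 := fun x hx => (ampDen_pos hg hx.2.1).ne'
  have hsum : ∀ i, ∀ x ∈ s, x.1 + S i i ≠ 0 := fun i x hx => (add_pos (hx1 x hx) (hd i)).ne'
  have hredpos : ∀ i, ∀ x ∈ s, 0 < reduction x.1 S g x.2 i := fun i x hx =>
    reduction_pos (hx1 x hx) hg hd hx.2.1 hx.2.2 i
  have hpsi : ContDiffOn ℝ 1 (fun x : ℝ × ℝ => ampSq x.1 g x.2) s :=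
    ContDiffOn.div (by fun_prop) (by fun_prop) hden
  have hred : ∀ i, ContDiffOn ℝ 1 (fun x : ℝ × ℝ => reduction x.1 S g x.2 i) s := by
    intro i
    refine contDiffOn_const.sub (ContDiffOn.div (hpsi.mul ?_) (by fun_prop) (hsum i))
    fin_cases i
    · simp only [Fin.zero_eta, if_true]; fun_prop
    · simp only [Fin.mk_one, one_ne_zero, if_false]; fun_prop
  have hcorr : ContDiffOn ℝ 1 (fun x : ℝ × ℝ => corrMap x.1 S g x.2) s := by
    refine ContDiffOn.div ?_ (((hred 0).mul (hred 1)).sqrt fun x hx =>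
      (mul_pos (hredpos 0 x hx) (hredpos 1 x hx)).ne') fun x hx =>
      (Real.sqrt_pos.mpr (mul_pos (hredpos 0 x hx) (hredpos 1 x hx))).ne'
    refine contDiffOn_snd.sub (((hpsi.mul (by fun_prop)).mul (by fun_prop)).mul ?_)
    refine ((contDiffOn_const.div (by fun_prop) (hsum 0)).add
      (contDiffOn_const.div (by fun_prop) (hsum 1))).sub
      (ContDiffOn.div (by fun_prop) (by fun_prop) fun x hx =>
        mul_ne_zero (hsum 0 x hx) (hsum 1 x hx))
  have hv0pos : ∀ i, ∀ x ∈ s, 0 < S i i / x.1 + κ i ^ 2 := fun i x hx =>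
    add_pos_of_pos_of_nonneg (div_pos (hd i) (hx1 x hx)) (sq_nonneg _)
  have hv0 : ∀ i, ContDiffOn ℝ 1 (fun x : ℝ × ℝ => S i i / x.1 + κ i ^ 2) s := fun i =>
    (contDiffOn_const.div contDiffOn_fst fun x hx => (hx1 x hx).ne').add contDiffOn_const
  have hc0 : ContDiffOn ℝ 1 (fun x : ℝ × ℝ => κ 0 * κ 1 /
      √((S 0 0 / x.1 + κ 0 ^ 2) * (S 1 1 / x.1 + κ 1 ^ 2))) s :=
    contDiffOn_const.div (((hv0 0).mul (hv0 1)).sqrt fun x hx =>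
      (mul_pos (hv0pos 0 x hx) (hv0pos 1 x hx)).ne') fun x hx =>
      (Real.sqrt_pos.mpr (mul_pos (hv0pos 0 x hx) (hv0pos 1 x hx))).ne'
  choose Lr hLr using fun i => exists_lipschitz_of_contDiffOn hsc hsv
    ((hred i).log fun x hx => (hredpos i x hx).ne')
  choose Lv hLv using fun i => exists_lipschitz_of_contDiffOn hsc hsv
    ((hv0 i).log fun x hx => (hv0pos i x hx).ne')
  obtain ⟨Lc, hLc⟩ := exists_lipschitz_of_contDiffOn hsc hsv hcorr
  obtain ⟨L0, hL0⟩ := exists_lipschitz_of_contDiffOn hsc hsv hc0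
  obtain ⟨L, hL1, hLr', hLv', hLc', hL0'⟩ : ∃ L : ℝ, 1 ≤ L ∧ (∀ i, Lr i ≤ L) ∧ (∀ i, Lv i ≤ L) ∧
      Lc ≤ L ∧ L0 ≤ L := by
    refine ⟨1 + ∑ i, |Lr i| + ∑ i, |Lv i| + |Lc| + |L0|, ?_, fun i => ?_, fun i => ?_, ?_, ?_⟩
    all_goals
      have a1 := Finset.sum_nonneg fun (i : Fin 2) (_ : i ∈ Finset.univ) => abs_nonneg (Lr i)
      have a2 := Finset.sum_nonneg fun (i : Fin 2) (_ : i ∈ Finset.univ) => abs_nonneg (Lv i)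
      have a3 := abs_nonneg Lc
      have a4 := abs_nonneg L0
      have a5 := le_abs_self Lc
      have a6 := le_abs_self L0
    · linarith
    · have := Finset.single_le_sum (fun (i : Fin 2) _ => abs_nonneg (Lr i)) (Finset.mem_univ i)
      linarith [le_abs_self (Lr i)]
    · have := Finset.single_le_sum (fun (i : Fin 2) _ => abs_nonneg (Lv i)) (Finset.mem_univ i)
      linarith [le_abs_self (Lv i)]
    · linarith
    · linarith
  -- The factor `2 ^ (k + 1)` absorbs the `k + 1` summands of the logarithm.
  refine ⟨2 * L, by linarith, fun P' hP' => ?_⟩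
  have hP'0 : 0 < P' := (half_pos hP).trans_le hP'.1
  have hδ : 0 ≤ P - P' := sub_nonneg.mpr hP'.2
  have hδ' : |P' - P| = P - P' := by rw [abs_sub_comm, abs_of_nonneg hδ]
  have hPm : P ∈ Set.Icc (P / 2) P := ⟨by linarith, le_rfl⟩
  have hmem (k : ℕ) : (P, |(state P S g κ k).corr|) ∈ s :=
    ⟨hPm, abs_nonneg _, abs_state_corr_le hP hg hS hd k⟩
  have hmem' (k : ℕ) : (P', |(state P' S g κ k).corr|) ∈ s :=
    ⟨hP', abs_nonneg _, abs_state_corr_le hP'0 hg hS hd k⟩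
  have hpow (k : ℕ) : P - P' ≤ L ^ k * (P - P') :=
    le_mul_of_one_le_left hδ (one_le_pow₀ hL1)
  have he (k : ℕ) : |(|(state P' S g κ k).corr| - |(state P S g κ k).corr|)| ≤
      L ^ (k + 1) * (P - P') := by
    induction k with
    | zero =>
      refine (abs_abs_sub_abs_le _ _).trans ?_
      have := hL0 _ (hmem' 0) (P, |(state P' S g κ 0).corr|) ⟨hPm, (hmem' 0).2⟩
      simp only [sub_self, abs_zero, hδ', max_eq_left hδ] at this
      refine this.trans ?_
      rw [zero_add, pow_one]
      exact mul_le_mul_of_nonneg_right hL0' hδ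
    | succ k ih =>
      rw [abs_state_succ_corr hP hg, abs_state_succ_corr hP'0 hg]
      refine (abs_abs_sub_abs_le _ _).trans ?_
      have := hLc _ (hmem' k) _ (hmem k)
      simp only [hδ'] at this
      refine this.trans ?_
      rw [pow_succ' L (k + 1), mul_assoc]
      exact mul_le_mul hLc' (max_le (hpow _) ih) (hδ.trans (le_max_left _ _)) (by linarith)
  have hdv (k : ℕ) (i : Fin 2) :
      |Real.log ((state P' S g κ k).var i) - Real.log ((state P S g κ k).var i)| ≤
        (k + 1) * (L ^ (k + 1) * (P - P')) := by
    induction k with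
    | zero =>
      have := hLv i _ (hmem' 0) (P, |(state P' S g κ 0).corr|) ⟨hPm, (hmem' 0).2⟩
      simp only [sub_self, abs_zero, hδ', max_eq_left hδ] at this
      refine this.trans ?_
      simp only [Nat.cast_zero, zero_add, pow_one, one_mul]
      exact mul_le_mul_of_nonneg_right (hLv' i) hδ
    | succ k ih =>
      rw [state_succ_var hP hg, state_succ_var hP'0 hg,
        Real.log_mul (state_var_pos hP'0 hg hS hd k i).ne' (hredpos i _ (hmem' k)).ne',
        Real.log_mul (state_var_pos hP hg hS hd k i).ne' (hredpos i _ (hmem k)).ne']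
      have h1 := hLr i _ (hmem' k) _ (hmem k)
      simp only [hδ'] at h1
      have h2 : Lr i * max (P - P') |(|(state P' S g κ k).corr| - |(state P S g κ k).corr|)| ≤
          L ^ (k + 2) * (P - P') := by
        rw [pow_succ' L (k + 1), mul_assoc]
        exact mul_le_mul (hLr' i) (max_le (hpow _) (he k)) (hδ.trans (le_max_left _ _))
          (by linarith)
      have h3 : L ^ (k + 1) * (P - P') ≤ L ^ (k + 2) * (P - P') :=
        mul_le_mul_of_nonneg_right (pow_le_pow_right₀ hL1 (by omega)) hδ
      rw [add_sub_add_comm]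
      refine (abs_add_le _ _).trans ?_
      have h4 : ((k : ℝ) + 1) * (L ^ (k + 1) * (P - P')) ≤ (k + 1) * (L ^ (k + 2) * (P - P')) :=
        mul_le_mul_of_nonneg_left h3 (by positivity)
      have h5 := h1.trans h2
      rw [show k + 1 + 1 = k + 2 from rfl]
      push_cast
      linarith
  intro k i
  refine (hdv k i).trans ?_
  rw [mul_pow, ← mul_assoc]
  refine mul_le_mul_of_nonneg_right (mul_le_mul_of_nonneg_right ?_ (by positivity)) hδ
  have : k + 1 ≤ 2 ^ (k + 1) := Nat.lt_two_pow_self.le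
  exact_mod_cast this

/-! ### Geometric decay of the variances -/

theorem var_le_of_reduction_le (hP : 0 < P) (hg : 0 ≤ g) (hS : S.PosSemidef)
    (hd : ∀ i, 0 < S i i) {c : ℝ} {i : Fin 2}
    (h : ∀ k, reduction P S g |(state P S g κ k).corr| i ≤ 1 - c) (k : ℕ) :
    (state P S g κ k).var i ≤ (state P S g κ 0).var i * (1 - c) ^ k := by
  have hc : 0 ≤ 1 - c := (reduction_pos hP hg hd (abs_nonneg _)
    (abs_state_corr_le hP hg hS hd 0) i).le.trans (h 0)
  induction k with
  | zero => simp
  | succ k ih =>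
    rw [state_succ_var hP hg, pow_succ, ← mul_assoc]
    exact mul_le_mul ih (h k) (reduction_pos hP hg hd (abs_nonneg _)
      (abs_state_corr_le hP hg hS hd k) i).le
      (mul_nonneg (state_var_pos hP hg hS hd 0 i).le (pow_nonneg hc k))

theorem reduction_le_of_le_crossSq (hP : 0 < P) (hd : ∀ i, 0 < S i i) {a b : ℝ} {i : Fin 2}
    (h : b ≤ crossSq P g a i) : reduction P S g a i ≤ 1 - b / (P + S i i) := by
  rw [reduction]
  have := div_le_div_of_nonneg_right h (add_pos hP (hd i)).le
  linarith

theorem div_le_ampSq (hP : 0 < P) (hg : 0 ≤ g) {a : ℝ} (ha : 0 ≤ a) (ha1 : a ≤ 1) :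
    P / (1 + g) ^ 2 ≤ ampSq P g a :=
  div_le_div_of_nonneg_left hP.le (ampDen_pos hg ha) (by nlinarith)

/-- For `g = 0` the correlation coefficient is multiplied by `q / √(1 - β a ^ 2)` in each step. -/
theorem corrMap_zero (hP : 0 < P) (hd : ∀ i, 0 < S i i) :
    ∃ q, 0 ≤ q ∧ ∀ a, 0 ≤ a → a ≤ 1 →
      |corrMap P S 0 a| = a * (q / √(1 - P / (P + S 1 1) * a ^ 2)) := by
  set D := 1 / (P + S 0 0) + 1 / (P + S 1 1) - (P + S 0 1) / ((P + S 0 0) * (P + S 1 1)) with hD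
  have h0 : 0 < 1 - P / (P + S 0 0) := by
    rw [sub_pos, div_lt_one (add_pos hP (hd 0))]; linarith [hd 0]
  refine ⟨|1 - P * D| / √(1 - P / (P + S 0 0)), by positivity, fun a ha _ => ?_⟩
  have e : corrMap P S 0 a = a * ((1 - P * D) / √(1 - P / (P + S 0 0)) /
      √(1 - P / (P + S 1 1) * a ^ 2)) := by
    rw [div_div, ← Real.sqrt_mul h0.le, ← mul_div_assoc, corrMap, ← hD]
    simp only [reduction, crossSq, ampSq]
    norm_num
    congr 1
    · ring
    · congr 2; ring
  rw [e, abs_mul, abs_of_nonneg ha, abs_div, abs_div, abs_of_nonneg (Real.sqrt_nonneg _),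
    abs_of_nonneg (Real.sqrt_nonneg _)]

/-- Geometric decay follows once the signal has a uniformly positive share along the error of
receiver `i`. This is automatic except for receiver `1` with `g = 0`, where the signal reaches the
error only through its correlation with the other one. There the correlation either stays bounded
below or decays geometrically, and in the latter case the variance has a positive lower bound. -/
theorem exists_geometric (hP : 0 < P) (hg : 0 ≤ g) (hS : S.PosSemidef) (hd : ∀ i, 0 < S i i)
    (i : Fin 2) (h : Tendsto (fun k => (state P S g κ k).var i) atTop (𝓝 0)) :
    ∃ c, 0 < c ∧ c < 1 ∧ ∀ k, (state P S g κ k).var i ≤ (state P S g κ 0).var i * (1 - c) ^ k := by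
  have ha0 (k : ℕ) := abs_nonneg (state P S g κ k).corr
  have ha1 (k : ℕ) := abs_state_corr_le (κ := κ) hP hg hS hd k
  suffices H : ∃ b, 0 < b ∧ ∀ k, b ≤ crossSq P g |(state P S g κ k).corr| i by
    obtain ⟨b, hb, hbk⟩ := H
    have hbc := fun k => reduction_le_of_le_crossSq (S := S) hP hd (hbk k)
    refine ⟨_, div_pos hb (add_pos hP (hd i)), ?_, var_le_of_reduction_le hP hg hS hd hbc⟩
    have := reduction_pos hP hg hd (ha0 0) (ha1 0) i
    linarith [hbc 0]
  have hamp := fun k => div_le_ampSq hP hg (ha0 k) (ha1 k)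
  have hPg : 0 < P / (1 + g) ^ 2 := by positivity
  fin_cases i
  · refine ⟨P / (1 + g) ^ 2, hPg, fun k => ?_⟩
    simp only [Fin.zero_eta, crossSq, if_true]
    have : 1 ≤ (1 + g * |(state P S g κ k).corr|) ^ 2 :=
      one_le_pow₀ (by have := mul_nonneg hg (ha0 k); linarith)
    nlinarith [hamp k]
  · simp only [Fin.mk_one] at h ⊢
    rcases hg.lt_or_eq with hg' | rfl
    · refine ⟨P / (1 + g) ^ 2 * g ^ 2, by positivity, fun k => ?_⟩
      simp only [crossSq, one_ne_zero, if_false]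
      exact mul_le_mul (hamp k) (pow_le_pow_left₀ hg (by linarith [ha0 k]) 2) (by positivity)
        (hPg.le.trans (hamp k))
    · obtain ⟨q, hq, hmap⟩ := corrMap_zero hP hd
      set β := P / (P + S 1 1) with hβ
      have hβ0 : 0 < β := div_pos hP (add_pos hP (hd 1))
      have hβ1 : β < 1 := (div_lt_one (add_pos hP (hd 1))).mpr (by linarith [hd 1])
      set a : ℕ → ℝ := fun k => |(state P S 0 κ k).corr| with ha
      have hrec (k : ℕ) : a (k + 1) = a k * (q / √(1 - β * a k ^ 2)) :=
        (abs_state_succ_corr hP le_rfl k).trans (hmap _ (ha0 k) (ha1 k))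
      have hsq (k : ℕ) : a k ^ 2 ≤ 1 := pow_le_one₀ (ha0 k) (ha1 k)
      have hpos (k : ℕ) : 0 < 1 - β * a k ^ 2 := by nlinarith [hsq k]
      have hcs (k : ℕ) : crossSq P 0 (a k) 1 = P * a k ^ 2 := by
        simp [crossSq, ampSq]
      -- The multiplier `q / √(1 - β a ^ 2)` grows with `a`. If it is at least one initially, the
      -- correlation never falls below its initial value; if it is smaller than one, it stays so.
      by_cases hcase : 0 < a 0 ∧ 1 ≤ q / √(1 - β * a 0 ^ 2)
      · have hge (k : ℕ) : a 0 ≤ a k := by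
          induction k with
          | zero => exact le_rfl
          | succ k ih =>
            refine ih.trans ?_
            rw [hrec]
            refine le_mul_of_one_le_right (ha0 k) (hcase.2.trans ?_)
            refine div_le_div_of_nonneg_left hq (Real.sqrt_pos.mpr (hpos k)) (Real.sqrt_le_sqrt ?_)
            have := pow_le_pow_left₀ (ha0 0) ih 2
            nlinarith
        refine ⟨P * a 0 ^ 2, mul_pos hP (pow_pos hcase.1 2), fun k => ?_⟩
        rw [hcs]
        exact mul_le_mul_of_nonneg_left (pow_le_pow_left₀ (ha0 0) (hge k) 2) hP.le
      · exfalso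
        obtain ⟨lam, hl0, hl1, hle⟩ : ∃ lam : ℝ, 0 ≤ lam ∧ lam < 1 ∧ ∀ k, a k ≤ lam ^ k := by
          rcases (ha0 0).lt_or_eq with h0 | h0
          · have hl : q / √(1 - β * a 0 ^ 2) < 1 := not_le.mp fun h1 => hcase ⟨h0, h1⟩
            have hl0 : 0 ≤ q / √(1 - β * a 0 ^ 2) := by positivity
            refine ⟨_, hl0, hl, fun k => ?_⟩
            suffices a k ≤ (q / √(1 - β * a 0 ^ 2)) ^ k ∧ a k ≤ a 0 from this.1
            induction k with
            | zero => exact ⟨by simpa using ha1 0, le_rfl⟩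
            | succ k ih =>
              have hfac : q / √(1 - β * a k ^ 2) ≤ q / √(1 - β * a 0 ^ 2) := by
                refine div_le_div_of_nonneg_left hq (Real.sqrt_pos.mpr (hpos 0))
                  (Real.sqrt_le_sqrt ?_)
                have := pow_le_pow_left₀ (ha0 k) ih.2 2
                nlinarith
              rw [hrec]
              refine ⟨?_, ?_⟩
              · rw [pow_succ]
                exact mul_le_mul ih.1 hfac (by positivity) (pow_nonneg hl0 k)
              · exact (mul_le_of_le_one_right (ha0 k) (hfac.trans hl.le)).trans ih.2
          · refine ⟨0, le_rfl, zero_lt_one, fun k => ?_⟩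
            have : ∀ k, a k = 0 := by
              intro k
              induction k with
              | zero => exact h0.symm
              | succ k ih => rw [hrec, ih, zero_mul]
            rw [this k]; positivity
        -- For `a ^ 2 ≤ 1` one has `1 / (1 - β a ^ 2) ≤ 1 + B a ^ 2`, hence the reduction factor is
        -- at least `exp (-B a ^ 2)`. As the squares are summable, the product of all factors stays
        -- positive.
        set B := β / (1 - β) with hB
        have hB0 : 0 < B := div_pos hβ0 (by linarith)
        have hlow (k : ℕ) : Real.exp (-(B * (lam ^ 2) ^ k)) ≤ reduction P S 0 (a k) 1 := by
          have hr : reduction P S 0 (a k) 1 = 1 - β * a k ^ 2 := by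
            rw [reduction, hcs, hβ]; ring
          rw [hr, ← Real.le_log_iff_exp_le (hpos k)]
          refine le_trans ?_ (Real.one_sub_inv_le_log_of_pos (hpos k))
          have h1 : (1 - β * a k ^ 2)⁻¹ ≤ 1 + B * a k ^ 2 := by
            rw [inv_le_iff_one_le_mul₀ (hpos k)]
            have hB' : B * (1 - β) = β := div_mul_cancel₀ _ (by linarith)
            have hk2 := sq_nonneg (a k)
            have : B * (1 - β * a k ^ 2) ≥ β := by nlinarith [hsq k, mul_pos hB0 hβ0]
            nlinarith
          have h2 : a k ^ 2 ≤ (lam ^ 2) ^ k := by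
            rw [← pow_mul, mul_comm 2 k, pow_mul]
            exact pow_le_pow_left₀ (ha0 k) (hle k) 2
          nlinarith
        have hgeo := summable_geometric_of_lt_one (sq_nonneg lam) (by nlinarith)
        have hvar (k : ℕ) : (state P S 0 κ 0).var 1 *
            Real.exp (-(B * ∑ j ∈ Finset.range k, (lam ^ 2) ^ j)) ≤ (state P S 0 κ k).var 1 := by
          induction k with
          | zero => simp
          | succ k ih =>
            rw [state_succ_var hP le_rfl, Finset.sum_range_succ, mul_add, neg_add, Real.exp_add,
              ← mul_assoc]
            exact mul_le_mul ih (hlow k) (Real.exp_pos _).le (state_var_pos hP le_rfl hS hd k 1).le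
        have hbd (k : ℕ) : (state P S 0 κ 0).var 1 *
            Real.exp (-(B * ∑' j, (lam ^ 2) ^ j)) ≤ (state P S 0 κ k).var 1 := by
          refine le_trans (mul_le_mul_of_nonneg_left (Real.exp_le_exp.mpr ?_)
            (state_var_pos hP le_rfl hS hd 0 1).le) (hvar k)
          have := hgeo.sum_le_tsum (Finset.range k) fun j _ => pow_nonneg (sq_nonneg lam) j
          nlinarith
        have := ge_of_tendsto' h hbd
        have hpos' := mul_pos (state_var_pos (κ := κ) hP le_rfl hS hd 0 1)
          (Real.exp_pos (-(B * ∑' j, (lam ^ 2) ^ j)))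
        linarith

end dynamics

end OzarowLeung

/-! ### Lower bound on the error probability, and what achievability says about the error variances
-/

theorem CenteredGaussian.measure_ge {Ω : Type*} [MeasurableSpace Ω] {X : Ω → ℝ} {v : ℝ}
    {μ : Measure Ω} [IsProbabilityMeasure μ] (h : CenteredGaussian X v μ) (hv : 0 < v) (a : ℝ) :
    μ {ω | a ≤ X ω} = gaussianReal 0 1 (Set.Ici (a / √v)) := by
  have hs := Real.sqrt_pos.mpr hv
  have h' := h.const_mul (1 / √v)
  have e : (1 / √v) ^ 2 * v = 1 := by
    rw [div_pow, Real.sq_sqrt hv.le]; field_simp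
  rw [e] at h'
  have hm := h'.map_eq
  rw [Real.toNNReal_one] at hm
  rw [← hm, Measure.map_apply h'.measurable measurableSet_Ici]
  congr 1
  ext ω
  simp only [Set.mem_ofPred_eq, Set.mem_preimage, Set.mem_Ici, one_div]
  rw [div_le_iff₀ hs]
  field_simp

theorem gaussianReal_Ici_pos (K : ℝ) : 0 < gaussianReal 0 1 (Set.Ici K) := by
  have h := gaussianReal_absolutelyContinuous' 0 (v := 1) one_ne_zero
  refine pos_iff_ne_zero.mpr fun h0 => ?_
  have := h h0
  simp at this

namespace OzarowLeung

section region

variable {P : ℝ} {S : Matrix (Fin 2) (Fin 2) ℝ} {g : ℝ} {κ : Fin 2 → ℝ}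

/-- Half the distance of neighboring message points. -/
def halfDist (m : ℕ) : ℝ := √(3 / ((m : ℝ) ^ 2 - 1))

theorem halfDist_pos {m : ℕ} (hm : 2 ≤ m) : 0 < halfDist m := Real.sqrt_pos.mpr (three_div_pos hm)

theorem pam_sub_pam {m : ℕ} (v w : Fin m) :
    pam m v - pam m w = 2 * halfDist m * ((v : ℝ) - (w : ℝ)) := by
  simp only [pam, halfDist]; ring

theorem two_mul_halfDist_le {m : ℕ} {v w : Fin m} (h : v ≠ w) :
    2 * halfDist m ≤ |pam m v - pam m w| := by
  have h0 : 0 ≤ halfDist m := Real.sqrt_nonneg _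
  rw [pam_sub_pam, abs_mul, abs_of_nonneg (by positivity)]
  refine le_mul_of_one_le_right (by positivity) ?_
  have : (1 : ℤ) ≤ |(v.val : ℤ) - (w.val : ℤ)| :=
    Int.one_le_abs (sub_ne_zero.mpr fun e => h (Fin.ext (by exact_mod_cast e)))
  exact_mod_cast this

/-- Every message point has a neighbor, and an error of at least `halfDist` towards it spoils the
decision. By symmetry of the Gaussian law the side does not matter. -/
theorem le_errorProb (hP : 0 < P) (hg : 0 ≤ g) (hS : S.PosSemidef) (hd : ∀ i, 0 < S i i) {N k : ℕ}
    (hk : k + 2 = N) {m : Fin 2 → ℕ} (hm : ∀ i, 2 ≤ m i) (i : Fin 2) :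
    gaussianReal 0 1 (Set.Ici (halfDist (m i) / √((state P S g κ k).var i))) ≤
      errorProb P S g κ N m := by
  have : ∀ i, NeZero (m i) := fun i => ⟨by have := hm i; omega⟩
  refine le_msgAvg_of_le (Msg := fun i => Fin (m i)) fun w => ?_
  have hG := centeredGaussian_evalWeight hS N (errWeight P S g κ k i)
  have hval := state_valid (κ := κ) hP hg hS hd k hk.le
  rw [hval.var_eq] at hG
  have hG' := hG.const_mul (-1)
  rw [show (-1 : ℝ) ^ 2 * (state P S g κ k).var i = (state P S g κ k).var i by ring] at hG'
  have hh := halfDist_pos (hm i)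
  -- The right neighbor is used if there is one, otherwise the left one, which exists as `2 ≤ m i`.
  rcases lt_or_ge ((w i).val + 1) (m i) with hw | hw
  · rw [← hG.measure_ge (hval.var_pos i)]
    refine measure_mono fun x hx hall => ?_
    have hne : (⟨(w i).val + 1, hw⟩ : Fin (m i)) ≠ w i := fun e => by
      have := congrArg Fin.val e; simp at this
    have h1 := hall i _ hne
    have h2 := pam_sub_pam (⟨(w i).val + 1, hw⟩ : Fin (m i)) (w i)
    have h3 := estimate_scheme (P := P) (S := S) (g := g) (κ := κ) w x.1 x.2 hP k hk i
    have h4 : halfDist (m i) ≤ evalWeight (errWeight P S g κ k i) x.1 x.2 := hx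
    rw [← h3] at h4
    simp only [Nat.cast_add, Nat.cast_one, add_sub_cancel_left, mul_one] at h2
    refine absurd h1 (not_lt.mpr (sq_le_sq.mp ?_))
    nlinarith
  · rw [← hG'.measure_ge (hval.var_pos i)]
    refine measure_mono fun x hx hall => ?_
    have hw1 : 1 ≤ (w i).val := by have := hm i; omega
    have hlt : (w i).val - 1 < m i := by omega
    have hne : (⟨(w i).val - 1, hlt⟩ : Fin (m i)) ≠ w i := fun e => by
      have := congrArg Fin.val e; simp at this; omega
    have h1 := hall i _ hne
    have h2 := pam_sub_pam (⟨(w i).val - 1, hlt⟩ : Fin (m i)) (w i)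
    have h3 := estimate_scheme (P := P) (S := S) (g := g) (κ := κ) w x.1 x.2 hP k hk i
    have h4 : halfDist (m i) ≤ -1 * evalWeight (errWeight P S g κ k i) x.1 x.2 := hx
    rw [← h3] at h4
    simp only [Nat.cast_sub hw1, Nat.cast_one, sub_sub_cancel_left, mul_neg, mul_one] at h2
    refine absurd h1 (not_lt.mpr (sq_le_sq.mp ?_))
    nlinarith

/-- If half the point distance were below `K` standard deviations, the error probability would be at
least the Gaussian tail at `K`, a positive constant. -/
theorem eventually_var_le_of_mem_region (hP : 0 < P) (hg : 0 ≤ g) (hS : S.PosSemidef)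
    (hd : ∀ i, 0 < S i i) {R : Fin 2 → ℝ} (hR : R ∈ region P S g κ) {ε K : ℝ} (hε : 0 < ε)
    (hK : 0 < K) :
    ∀ᶠ k : ℕ in atTop, ∃ m : Fin 2 → ℕ, (∀ i, 2 ≤ m i) ∧
      (∀ i, R i - ε ≤ Real.logb 2 (m i) / (k + 2 : ℕ)) ∧
      ∀ i, K ^ 2 * (state P S g κ k).var i ≤ 3 / ((m i : ℝ) ^ 2 - 1) := by
  set t := gaussianReal 0 1 (Set.Ici K) with ht
  have ht0 : 0 < t := gaussianReal_Ici_pos K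
  have htt : t ≠ ∞ := measure_ne_top _ _
  have htr : 0 < t.toReal := ENNReal.toReal_pos ht0.ne' htt
  have h := (tendsto_add_atTop_nat 2).eventually (hR.2 (min ε (t.toReal / 2)) (by positivity))
  filter_upwards [h] with k hk
  obtain ⟨m, hm, hrate, -, herr⟩ := hk
  refine ⟨m, hm, fun i => ?_, fun i => ?_⟩
  · have := hrate i
    linarith [min_le_left ε (t.toReal / 2)]
  · have hv := state_var_pos (κ := κ) hP hg hS hd k i
    by_contra hcon
    have hlt : halfDist (m i) / √((state P S g κ k).var i) ≤ K := by
      rw [div_le_iff₀ (Real.sqrt_pos.mpr hv), halfDist]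
      refine Real.sqrt_le_iff.mpr ⟨by positivity, ?_⟩
      rw [mul_pow, Real.sq_sqrt hv.le]
      exact (not_le.mp hcon).le
    have h1 : t ≤ ENNReal.ofReal (t.toReal / 2) :=
      (measure_mono (Set.Ici_subset_Ici.mpr hlt)).trans
        ((le_errorProb hP hg hS hd rfl hm i).trans
          (herr.trans (ENNReal.ofReal_le_ofReal (min_le_right _ _))))
    have h2 := ENNReal.toReal_mono ENNReal.ofReal_ne_top h1
    rw [ENNReal.toReal_ofReal (by positivity)] at h2
    linarith

theorem three_div_le_one {m : ℕ} (hm : 2 ≤ m) : 3 / ((m : ℝ) ^ 2 - 1) ≤ 1 := by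
  have : (2 : ℝ) ≤ m := by exact_mod_cast hm
  rw [div_le_one (by nlinarith)]
  nlinarith

/-- Half the point distance is at most one, so the preceding bound with large `K` forces the
variance below any `ε`, whatever the rates. -/
theorem tendsto_var_of_mem_region (hP : 0 < P) (hg : 0 ≤ g) (hS : S.PosSemidef)
    (hd : ∀ i, 0 < S i i) {R : Fin 2 → ℝ} (hR : R ∈ region P S g κ) (i : Fin 2) :
    Tendsto (fun k => (state P S g κ k).var i) atTop (𝓝 0) := by
  rw [Metric.tendsto_atTop']
  intro ε hε
  have h := eventually_var_le_of_mem_region (K := √(2 / ε)) hP hg hS hd hR one_pos (by positivity)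
  obtain ⟨k₀, hk₀⟩ := eventually_atTop.mp h
  refine ⟨k₀, fun k hk => ?_⟩
  obtain ⟨m, hm, -, hv⟩ := hk₀ k hk.le
  have h0 := state_var_pos (κ := κ) hP hg hS hd k i
  have h1 := (hv i).trans (three_div_le_one (hm i))
  rw [Real.sq_sqrt (by positivity), div_mul_eq_mul_div, div_le_one hε] at h1
  rw [Real.dist_eq, sub_zero, abs_of_pos h0]
  linarith

/-- Message sets of nearly the rates of a pair in the region, for which the error variances are
exponentially small compared to the squared distance of the message points. -/
theorem exists_message_sizes (hP : 0 < P) (hg : 0 ≤ g) (hS : S.PosSemidef)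
    (hd : ∀ i, 0 < S i i) {R : Fin 2 → ℝ} (hR : R ∈ region P S g κ) {ε : ℝ} (hε : 0 < ε) :
    ∃ c, 0 < c ∧ ∀ᶠ k : ℕ in atTop, ∃ m : Fin 2 → ℕ, (∀ i, 2 ≤ m i) ∧
      (∀ i, (k + 2 : ℕ) * (R i - ε) ≤ Real.logb 2 (m i)) ∧
      ∀ i, (m i : ℝ) ^ 2 * (state P S g κ k).var i ≤ Real.exp (-(c * k)) := by
  choose c hc0 hc1 hgeo using fun i => exists_geometric hP hg hS hd i
    (tendsto_var_of_mem_region hP hg hS hd hR i)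
  set A := ∑ i, (state P S g κ 0).var i with hA
  have hv0 (i : Fin 2) := state_var_pos (κ := κ) hP hg hS hd 0 i
  have hAi (i : Fin 2) : (state P S g κ 0).var i ≤ A :=
    Finset.single_le_sum (fun i _ => (hv0 i).le) (Finset.mem_univ i)
  -- Two sources of exponential decay: the variances themselves, which suffice for `m i = 2`, and
  -- the reduction of the rate by `ε / 2`, which matters for large message sets.
  set b := min (min (c 0) (c 1)) (ε * Real.log 2) with hb
  have hlog2 : 0 < Real.log 2 := Real.log_pos one_lt_two
  have hb0 : 0 < b := lt_min (lt_min (hc0 0) (hc0 1)) (by positivity)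
  have hbc (i : Fin 2) : b ≤ c i := by
    fin_cases i
    · exact (min_le_left _ _).trans (min_le_left _ _)
    · exact (min_le_left _ _).trans (min_le_right _ _)
  -- Half of the exponent is spent on the constant `4 * A + 16`.
  refine ⟨b / 2, by positivity, ?_⟩
  have hlim : Tendsto (fun k : ℕ => (4 * A + 16) * Real.exp (-(b / 2 * k))) atTop
      (𝓝 ((4 * A + 16) * 0)) := by
    refine Tendsto.const_mul _ (Real.tendsto_exp_neg_atTop_nhds_zero.comp ?_)
    exact (tendsto_natCast_atTop_atTop).const_mul_atTop (by positivity)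
  rw [mul_zero] at hlim
  filter_upwards [hlim.eventually (gt_mem_nhds one_pos),
    eventually_var_le_of_mem_region (K := 1) hP hg hS hd hR (half_pos hε) one_pos] with k hk1 hk2
  obtain ⟨m', hm', hrate, hvar⟩ := hk2
  set x : Fin 2 → ℝ := fun i => (2 : ℝ) ^ ((k + 2 : ℕ) * (R i - ε)) with hx
  have hx0 (i : Fin 2) : 0 < x i := Real.rpow_pos_of_pos two_pos _
  refine ⟨fun i => max 2 ⌈x i⌉₊, fun i => le_max_left _ _, fun i => ?_, fun i => ?_⟩
  · rw [← Real.logb_rpow two_pos (by norm_num : (2 : ℝ) ≠ 1) (x := (k + 2 : ℕ) * (R i - ε))]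
    refine Real.logb_le_logb_of_le one_lt_two (hx0 i) ?_
    refine (Nat.le_ceil (x i)).trans ?_
    exact_mod_cast le_max_right _ _
  · set v := (state P S g κ k).var i with hvdef
    have hvp : 0 < v := state_var_pos hP hg hS hd k i
    have hmle : ((max 2 ⌈x i⌉₊ : ℕ) : ℝ) ^ 2 ≤ 4 + 4 * x i ^ 2 := by
      have h1 : ((max 2 ⌈x i⌉₊ : ℕ) : ℝ) ≤ 2 ∨ ((max 2 ⌈x i⌉₊ : ℕ) : ℝ) ≤ 2 * x i := by
        rcases le_total ⌈x i⌉₊ 2 with h | h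
        · left; rw [max_eq_left h]; norm_num
        · rcases le_or_gt (x i) 1 with h1 | h1
          · left
            have : ⌈x i⌉₊ ≤ 1 := Nat.ceil_le.mpr (by simpa using h1)
            exact_mod_cast (max_le le_rfl (this.trans one_le_two) : max 2 ⌈x i⌉₊ ≤ 2)
          · right
            rw [max_eq_right h]
            have := Nat.ceil_lt_add_one (hx0 i).le
            linarith
      have h2 : (0 : ℝ) ≤ ((max 2 ⌈x i⌉₊ : ℕ) : ℝ) := Nat.cast_nonneg _
      rcases h1 with h1 | h1
      · nlinarith [sq_nonneg (x i)]
      · nlinarith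
    have hv1 : v ≤ A * Real.exp (-(b * k)) := by
      refine (hgeo i k).trans (mul_le_mul (hAi i) ?_ (pow_nonneg (by linarith [hc1 i]) k)
        ((hv0 i).le.trans (hAi i)))
      have h1 : 1 - c i ≤ Real.exp (-b) := by
        have := Real.add_one_le_exp (-b)
        linarith [hbc i]
      refine (pow_le_pow_left₀ (by linarith [hc1 i]) h1 k).trans_eq ?_
      rw [← Real.exp_nat_mul]; congr 1; ring
    -- The region supplies `m'` at rate `R i - ε / 2` with `v * m' ^ 2 ≤ 4`, and `x` is smaller than
    -- `m'` by the factor `2 ^ ((k + 2) ε / 2)`.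
    have hv2 : x i ^ 2 * v ≤ 4 * Real.exp (-(b * k)) := by
      have hm2 : (2 : ℝ) ≤ m' i := by exact_mod_cast hm' i
      have h1 : (2 : ℝ) ^ ((k + 2 : ℕ) * (R i - ε / 2)) ≤ m' i := by
        rw [← Real.le_logb_iff_rpow_le one_lt_two (by linarith)]
        have := hrate i
        rw [le_div_iff₀ (by positivity)] at this
        linarith
      have h2 : (x i * (2 : ℝ) ^ ((k + 2 : ℕ) * (ε / 2))) ^ 2 ≤ (m' i : ℝ) ^ 2 := by
        refine pow_le_pow_left₀ (by positivity) ?_ 2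
        have e : ((k + 2 : ℕ) : ℝ) * (R i - ε) + (k + 2 : ℕ) * (ε / 2) =
            (k + 2 : ℕ) * (R i - ε / 2) := by ring
        rw [hx, ← Real.rpow_add two_pos, e]
        exact h1
      have h3 : v * (m' i : ℝ) ^ 2 ≤ 4 := by
        have := hvar i
        rw [one_pow, one_mul, le_div_iff₀ (by nlinarith)] at this
        have h4 := (hvar i).trans (three_div_le_one (hm' i))
        rw [one_pow, one_mul] at h4
        linarith
      have h5 : ((2 : ℝ) ^ ((k + 2 : ℕ) * (ε / 2))) ^ 2 = Real.exp (Real.log 2 * ε * (k + 2 : ℕ)) := by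
        rw [← Real.rpow_natCast, ← Real.rpow_mul two_pos.le, Real.rpow_def_of_pos two_pos]
        congr 1; push_cast; ring
      have h6 : Real.exp (b * k) ≤ Real.exp (Real.log 2 * ε * (k + 2 : ℕ)) := by
        rw [Real.exp_le_exp]
        have hb1 : b ≤ ε * Real.log 2 := min_le_right _ _
        have hk0 : (0 : ℝ) ≤ k := Nat.cast_nonneg k
        push_cast
        nlinarith [mul_pos hε hlog2]
      rw [Real.exp_neg, ← div_eq_mul_inv, le_div_iff₀ (Real.exp_pos _)]
      rw [mul_pow, h5] at h2
      have h7 : 0 ≤ x i ^ 2 * v := by positivity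
      calc x i ^ 2 * v * Real.exp (b * k)
          ≤ x i ^ 2 * v * Real.exp (Real.log 2 * ε * (k + 2 : ℕ)) :=
            mul_le_mul_of_nonneg_left h6 h7
        _ = v * (x i ^ 2 * Real.exp (Real.log 2 * ε * (k + 2 : ℕ))) := by ring
        _ ≤ v * (m' i : ℝ) ^ 2 := mul_le_mul_of_nonneg_left h2 hvp.le
        _ ≤ 4 := h3
    have he : Real.exp (-(b * k)) = Real.exp (-(b / 2 * k)) * Real.exp (-(b / 2 * k)) := by
      rw [← Real.exp_add]; congr 1; ring
    have hE := Real.exp_pos (-(b / 2 * k))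
    calc ((max 2 ⌈x i⌉₊ : ℕ) : ℝ) ^ 2 * v ≤ (4 + 4 * x i ^ 2) * v :=
          mul_le_mul_of_nonneg_right hmle hvp.le
      _ ≤ (4 * A + 16) * Real.exp (-(b * k)) := by linarith
      _ = ((4 * A + 16) * Real.exp (-(b / 2 * k))) * Real.exp (-(b / 2 * k)) := by
          rw [he]; ring
      _ ≤ 1 * Real.exp (-(b / 2 * k)) := mul_le_mul_of_nonneg_right hk1.le hE.le
      _ = Real.exp (-(b / 2 * k)) := one_mul _

end region

end OzarowLeung

/-! ### Pairwise independent events -/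

/-- By Chebyshev's inequality, it is unlikely that none of many pairwise independent events of equal
probability occurs. -/
theorem measure_forall_notMem_le {Ω ι : Type*} [MeasurableSpace Ω] {μ : Measure Ω}
    [IsProbabilityMeasure μ] {s : Finset ι} (hs : s.Nonempty) {E : ι → Set Ω}
    (hE : ∀ i, MeasurableSet (E i)) {p : ℝ} (hp : 0 < p) (hEp : ∀ i ∈ s, μ.real (E i) = p)
    (hind : ∀ i ∈ s, ∀ j ∈ s, i ≠ j → μ.real (E i ∩ E j) = p * p) :
    μ {ω | ∀ i ∈ s, ω ∉ E i} ≤ ENNReal.ofReal (1 / (s.card * p)) := by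
  set X : ι → Ω → ℝ := fun i => (E i).indicator 1 with hX
  have hXm (i : ι) : Measurable (X i) := measurable_one.indicator (hE i)
  have hX2 (i : ι) : MemLp (X i) 2 μ := memLp_indicator_const 2 (hE i) 1 (Or.inr (measure_ne_top _ _))
  have hEX (i : ι) : ∫ ω, X i ω ∂μ = μ.real (E i) := integral_indicator_one (hE i)
  have hXX (i j : ι) : X i * X j = (E i ∩ E j).indicator 1 := by
    ext ω
    simp only [hX, Pi.mul_apply, Set.indicator, Set.mem_inter_iff, Pi.one_apply]
    by_cases h1 : ω ∈ E i <;> by_cases h2 : ω ∈ E j <;> simp [h1, h2]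
  have hcov (i j : ι) : cov[X i, X j; μ] = μ.real (E i ∩ E j) - μ.real (E i) * μ.real (E j) := by
    rw [covariance_eq_sub (hX2 i) (hX2 j), hXX, integral_indicator_one ((hE i).inter (hE j)), hEX,
      hEX]
  have hSum2 : MemLp (∑ i ∈ s, X i) 2 μ := memLp_finsetSum' s fun i _ => hX2 i
  have hvar : variance (∑ i ∈ s, X i) μ ≤ s.card * p := by
    rw [← covariance_self (Finset.aemeasurable_sum s fun i _ => (hXm i).aemeasurable),
      covariance_sum_sum' (fun i _ => hX2 i) (fun i _ => hX2 i)]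
    -- Pairwise independence leaves only the diagonal term `p - p * p`.
    have h1 : ∀ i ∈ s, ∑ j ∈ s, cov[X i, X j; μ] ≤ p := by
      intro i hi
      rw [Finset.sum_eq_single_of_mem i hi]
      · rw [hcov, Set.inter_self, hEp i hi]
        nlinarith
      · intro j hj hji
        rw [hcov, hind i hi j hj hji.symm, hEp i hi, hEp j hj, sub_self]
    calc ∑ i ∈ s, ∑ j ∈ s, cov[X i, X j; μ] ≤ ∑ i ∈ s, p := Finset.sum_le_sum h1
      _ = s.card * p := by simp
  have hmean : ∫ ω, (∑ i ∈ s, X i) ω ∂μ = s.card * p := by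
    simp only [Finset.sum_apply]
    rw [integral_finsetSum _ fun i _ => (hX2 i).integrable one_le_two]
    simp only [hEX]
    rw [Finset.sum_congr rfl hEp]
    simp
  have hM : 0 < s.card * p := mul_pos (by exact_mod_cast hs.card_pos) hp
  have hch := meas_ge_le_variance_div_sq hSum2 hM
  refine (measure_mono fun ω hω => ?_).trans (hch.trans (ENNReal.ofReal_le_ofReal ?_))
  · have h0 : (∑ i ∈ s, X i) ω = 0 := by
      rw [Finset.sum_apply]
      exact Finset.sum_eq_zero fun i hi => Set.indicator_of_notMem (hω i hi) _
    change s.card * p ≤ |(∑ i ∈ s, X i) ω - ∫ ω, (∑ i ∈ s, X i) ω ∂μ|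
    rw [h0, hmean, zero_sub, abs_neg, abs_of_pos hM]
  · refine (div_le_div_of_nonneg_right hvar (by positivity)).trans_eq ?_
    field_simp

/-! ### Balls in the torus -/

/-- The torus. -/
abbrev Torus (D : ℕ) : Type := Fin D → UnitAddCircle

/-- The squared distance to zero in the torus. -/
def torusSq {D : ℕ} (τ : Torus D) : ℝ := ∑ j, ‖τ j‖ ^ 2

/-- The projection to the torus. -/
def toTorus {D : ℕ} (x : Fin D → ℝ) : Torus D := fun j => (x j : UnitAddCircle)

theorem measurable_torusSq {D : ℕ} : Measurable (torusSq (D := D)) := by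
  unfold torusSq; fun_prop

instance : IsProbabilityMeasure (volume : Measure UnitAddCircle) := ⟨UnitAddCircle.measure_univ⟩

theorem measurable_coe_unitAddCircle : Measurable (fun x : ℝ => (x : UnitAddCircle)) :=
  AddCircle.measurable_mk'

theorem measurable_toTorus {D : ℕ} : Measurable (toTorus (D := D)) :=
  measurable_pi_lambda _ fun j => measurable_coe_unitAddCircle.comp (measurable_pi_apply j)

theorem measurePreserving_toTorus (D : ℕ) (a : ℝ) :
    MeasurePreserving (toTorus (D := D))
      (volume.restrict (Set.univ.pi fun _ => Set.Ioc a (a + 1))) volume := by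
  have h := measurePreserving_pi (fun _ : Fin D => (volume : Measure ℝ).restrict (Set.Ioc a (a + 1)))
    (fun _ => (volume : Measure UnitAddCircle))
    (fun _ => UnitAddCircle.measurePreserving_mk a)
  rwa [← Measure.restrict_pi_pi, ← volume_pi] at h

theorem measurePreserving_zsmul_torus {D : ℕ} {u : ℤ} (hu : u ≠ 0) :
    MeasurePreserving (fun t : Torus D => u • t) volume volume := by
  have h : MeasurePreserving (fun τ : UnitAddCircle => u • τ) volume volume :=
    Measure.measurePreserving_zsmul volume hu
  exact measurePreserving_pi (fun _ : Fin D => (volume : Measure UnitAddCircle))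
    (fun _ => (volume : Measure UnitAddCircle)) (fun _ => h)

theorem measurePreserving_sub_zsmul_torus {D : ℕ} {u : ℤ} (hu : u ≠ 0) (x : Torus D) :
    MeasurePreserving (fun t : Torus D => x - u • t) volume volume := by
  have h := (measurePreserving_add_left volume x).comp
    (measurePreserving_zsmul_torus (D := D) (neg_ne_zero.mpr hu))
  convert h using 1
  ext1 t
  simp [sub_eq_add_neg]

/-- A Euclidean ball. -/
def ballSq (D : ℕ) (ρ : ℝ) : Set (Fin D → ℝ) := {x | ∑ j, x j ^ 2 < ρ ^ 2}

theorem abs_lt_of_mem_ballSq {D : ℕ} {ρ : ℝ} (hρ : 0 ≤ ρ) {x : Fin D → ℝ} (hx : x ∈ ballSq D ρ)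
    (j : Fin D) : |x j| < ρ := by
  have h1 : x j ^ 2 ≤ ∑ j, x j ^ 2 :=
    Finset.single_le_sum (f := fun j => x j ^ 2) (fun j _ => sq_nonneg _) (Finset.mem_univ j)
  exact abs_lt_of_sq_lt_sq (h1.trans_lt hx) hρ

/-- Up to radius `1 / 2` the ball lies in a fundamental cube of the torus, on which the projection
preserves volume and norms. -/
theorem volume_torusSq_lt (D : ℕ) {ρ : ℝ} (hρ : 0 ≤ ρ) (hρ' : ρ ≤ 1 / 2) :
    volume {τ : Torus D | torusSq τ < ρ ^ 2} = volume (ballSq D ρ) := by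
  have hm : MeasurableSet {τ : Torus D | torusSq τ < ρ ^ 2} :=
    measurableSet_lt measurable_torusSq measurable_const
  rw [← (measurePreserving_toTorus D (-1 / 2)).measure_preimage hm.nullMeasurableSet,
    Measure.restrict_apply (measurable_toTorus hm)]
  congr 1
  ext x
  have hn {y : ℝ} (hy : |y| ≤ 1 / 2) : ‖(y : UnitAddCircle)‖ = |y| := by
    rw [AddCircle.norm_coe_eq_abs_iff (1 : ℝ) one_ne_zero]
    simpa using hy
  constructor
  · rintro ⟨h1, h2⟩
    have : torusSq (toTorus x) = ∑ j, x j ^ 2 := by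
      refine Finset.sum_congr rfl fun j _ => ?_
      have hj := h2 j (Set.mem_univ j)
      rw [toTorus, hn, sq_abs]
      rw [abs_le]
      constructor <;> linarith [hj.1, hj.2]
    have h1' : torusSq (toTorus x) < ρ ^ 2 := h1
    rw [this] at h1'
    exact h1'
  · intro hx
    have hb (j : Fin D) := abs_lt_of_mem_ballSq hρ hx j
    refine ⟨?_, fun j _ => ?_⟩
    · change torusSq (toTorus x) < ρ ^ 2
      have : torusSq (toTorus x) = ∑ j, x j ^ 2 := by
        refine Finset.sum_congr rfl fun j _ => ?_
        rw [toTorus, hn ((hb j).le.trans hρ'), sq_abs]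
      rw [this]
      exact hx
    · have := abs_lt.mp (hb j)
      constructor <;> linarith

theorem volume_ballSq_mul (D : ℕ) {c : ℝ} (hc : 0 < c) (ρ : ℝ) :
    volume (ballSq D (c * ρ)) = ENNReal.ofReal (c ^ D) * volume (ballSq D ρ) := by
  have h := Measure.addHaar_smul (volume : Measure (Fin D → ℝ)) c (ballSq D ρ)
  rw [Module.finrank_fin_fun, abs_of_pos (pow_pos hc D)] at h
  rw [← h]
  congr 1
  ext x
  rw [Set.mem_smul_set_iff_inv_smul_mem₀ hc.ne']
  simp only [ballSq, Set.mem_ofPred_eq, Pi.smul_apply, smul_eq_mul, mul_pow, ← Finset.mul_sum]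
  rw [inv_pow, inv_mul_lt_iff₀ (by positivity)]

/-- The volume of the ball with radius `1 / 4`. -/
def quarterBall (D : ℕ) : ℝ := (volume (ballSq D (1 / 4))).toReal

/-- The enclosing cube of side `1 / 2` is a crude bound, but it stays exponentially small after
multiplication by `b ^ D` for the `b ≤ 5 / 4` used later. -/
theorem volume_ballSq_quarter_le (D : ℕ) :
    volume (ballSq D (1 / 4)) ≤ ENNReal.ofReal ((1 / 2) ^ D) := by
  have : ballSq D (1 / 4) ⊆ Set.univ.pi fun _ => Set.Ioo (-(1 / 4) : ℝ) (1 / 4) := fun x hx j _ =>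
    abs_lt.mp (abs_lt_of_mem_ballSq (by norm_num) hx j)
  refine (measure_mono this).trans_eq ?_
  rw [Real.volume_pi_Ioo, Finset.prod_const, Finset.card_univ, Fintype.card_fin,
    ← ENNReal.ofReal_pow (by norm_num)]
  norm_num

theorem ofReal_quarterBall (D : ℕ) :
    ENNReal.ofReal (quarterBall D) = volume (ballSq D (1 / 4)) :=
  ENNReal.ofReal_toReal ((volume_ballSq_quarter_le D).trans_lt ENNReal.ofReal_lt_top).ne

theorem quarterBall_le (D : ℕ) : quarterBall D ≤ (1 / 2) ^ D :=
  ENNReal.toReal_le_of_le_ofReal (by positivity) (volume_ballSq_quarter_le D)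

theorem quarterBall_pos (D : ℕ) : 0 < quarterBall D := by
  refine ENNReal.toReal_pos ?_ ((volume_ballSq_quarter_le D).trans_lt ENNReal.ofReal_lt_top).ne
  have ho : IsOpen (ballSq D (1 / 4)) := isOpen_lt (by fun_prop) continuous_const
  exact (ho.measure_pos volume ⟨0, by simp [ballSq]⟩).ne'

theorem volume_torusSq_lt_mul (D : ℕ) {c : ℝ} (hc : 0 < c) (hc' : c ≤ 2) :
    volume {τ : Torus D | torusSq τ < (c * (1 / 4)) ^ 2} =
      ENNReal.ofReal (c ^ D * quarterBall D) := by
  rw [volume_torusSq_lt D (by positivity) (by linarith), volume_ballSq_mul D hc,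
    ENNReal.ofReal_mul (by positivity), ofReal_quarterBall]

theorem volume_torusSq_lt_quarter (D : ℕ) :
    volume {τ : Torus D | torusSq τ < 1 / 16} = ENNReal.ofReal (quarterBall D) := by
  have := volume_torusSq_lt_mul D one_pos one_le_two
  norm_num at this ⊢
  exact this

/-- For different multipliers, the points `x - u t` and `x - v t` are independent and uniform. -/
theorem measurePreserving_pair_torus {D : ℕ} {u v : ℤ} (huv : u ≠ v) :
    MeasurePreserving (fun p : Torus D × Torus D => (p.2 - u • p.1, p.2 - v • p.1))
      (volume.prod volume) (volume.prod volume) := by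
  -- The map is a composition of two shears with a swap: from `(t, x)` to `(t, x - u t)`, then `(x -
  -- u t, t)`, then `(x - u t, x - u t - (v - u) t)`. The last shear preserves volume since
  -- multiplication by `v - u ≠ 0` does.
  have h1 : MeasurePreserving (fun p : Torus D × Torus D => (p.1, p.2 - u • p.1))
      (volume.prod volume) (volume.prod volume) :=
    (MeasurePreserving.id volume).skew_product (g := fun t x => x - u • t) (by fun_prop)
      (ae_of_all _ fun t => (measurePreserving_sub_right volume (u • t)).map_eq)
  have h2 : MeasurePreserving (fun p : Torus D × Torus D => (p.1, p.1 - (v - u) • p.2))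
      (volume.prod volume) (volume.prod volume) :=
    (MeasurePreserving.id volume).skew_product (g := fun x t => x - (v - u) • t) (by fun_prop)
      (ae_of_all _ fun x =>
        (measurePreserving_sub_zsmul_torus (sub_ne_zero.mpr huv.symm) x).map_eq)
  have h3 := h2.comp ((Measure.measurePreserving_swap (μ := (volume : Measure (Torus D)))
    (ν := (volume : Measure (Torus D)))).comp h1)
  convert h3 using 1
  ext p : 1
  simp only [Function.comp_apply, Prod.swap, Prod.mk.injEq, true_and]
  rw [sub_zsmul]
  abel

/-- With high probability, one of the first `U` multiples of a random point is close to another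
random point. -/
theorem measure_forall_le_torusSq_le {D U : ℕ} (hU : 0 < U) {c : ℝ} (hc : 0 < c) (hc' : c ≤ 2) :
    ((volume : Measure (Torus D)).prod (volume : Measure (Torus D)))
      {p | ∀ u ∈ Finset.Icc 1 U, (c * (1 / 4)) ^ 2 ≤ torusSq (p.2 - (u : ℤ) • p.1)} ≤
      ENNReal.ofReal (1 / (U * (c ^ D * quarterBall D))) := by
  set A : Set (Torus D) := {τ | torusSq τ < (c * (1 / 4)) ^ 2} with hA
  have hAm : MeasurableSet A := measurableSet_lt measurable_torusSq measurable_const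
  have hAv : (volume : Measure (Torus D)).real A = c ^ D * quarterBall D := by
    rw [Measure.real, volume_torusSq_lt_mul D hc hc', ENNReal.toReal_ofReal]
    exact mul_nonneg (by positivity) (quarterBall_pos D).le
  have hpair (u v : ℕ) (huv : u ≠ v) :=
    measurePreserving_pair_torus (D := D) (u := u) (v := v) (by exact_mod_cast huv)
  have h := measure_forall_notMem_le (μ := (volume : Measure (Torus D)).prod volume)
    (s := Finset.Icc 1 U) (E := fun u => {p | p.2 - (u : ℤ) • p.1 ∈ A})
    ⟨1, by simp; omega⟩ (fun u => by
      have : Measurable fun p : Torus D × Torus D => p.2 - (u : ℤ) • p.1 := by fun_prop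
      exact this hAm)
    (p := c ^ D * quarterBall D) (mul_pos (by positivity) (quarterBall_pos D))
    (fun u _ => by
      -- The multiplier `u + 1` is auxiliary; only the first component of the pair is used.
      have h1 := (hpair u (u + 1) (by omega)).measureReal_preimage
        (hAm.prod MeasurableSet.univ).nullMeasurableSet
      rw [measureReal_prod_prod, hAv, probReal_univ, mul_one] at h1
      rw [← h1]
      congr 1
      ext p
      simp)
    (fun u _ v _ huv => by
      have h1 := (hpair u v huv).measureReal_preimage (hAm.prod hAm).nullMeasurableSet
      rw [measureReal_prod_prod, hAv] at h1
      rw [← h1]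
      rfl)
  rw [Nat.card_Icc, Nat.add_sub_cancel] at h
  refine le_trans (measure_mono ?_) h
  intro p hp u hu
  exact not_lt.mpr (hp u hu)

/-! ### Lattices and nearest neighbor quantizers -/

section latticePoint

variable {d : ℕ} (G : Matrix (Fin d) (Fin d) ℝ)

/-- The lattice points as a homomorphism. -/
def latticeHom : (Fin d → ℤ) →+ EuclideanSpace ℝ (Fin d) where
  toFun := latticePoint G
  map_zero' := by
    ext i; simp [latticePoint, Matrix.mulVec, dotProduct]
  map_add' k l := by
    ext i
    simp [latticePoint, Matrix.mulVec, dotProduct, mul_add, Finset.sum_add_distrib]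

theorem latticeHom_apply (k : Fin d → ℤ) : latticeHom G k = latticePoint G k := rfl

theorem latticePoint_zero : latticePoint G 0 = 0 := (latticeHom G).map_zero

theorem latticePoint_add (k l : Fin d → ℤ) :
    latticePoint G (k + l) = latticePoint G k + latticePoint G l := (latticeHom G).map_add k l

theorem latticePoint_neg (k : Fin d → ℤ) : latticePoint G (-k) = -latticePoint G k :=
  (latticeHom G).map_neg k

variable {G}

theorem inv_mulVec_latticePoint (hG : G.det ≠ 0) (k : Fin d → ℤ) :
    G⁻¹.mulVec (latticePoint G k).ofLp = fun i => (k i : ℝ) := by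
  rw [latticePoint, Matrix.mulVec_mulVec, Matrix.nonsing_inv_mul _ (isUnit_iff_ne_zero.mpr hG),
    Matrix.one_mulVec]

theorem latticeHom_injective (hG : G.det ≠ 0) : Function.Injective (latticeHom G) := by
  intro k l h
  have h1 := inv_mulVec_latticePoint hG k
  have h2 := inv_mulVec_latticePoint hG l
  rw [← latticeHom_apply, h, latticeHom_apply, h2] at h1
  ext i
  exact_mod_cast (congrFun h1 i).symm

/-- `G⁻¹` maps lattice points to integer vectors, so they leave every compact set. Hence a nearest
lattice point exists. -/
theorem tendsto_norm_sub_latticePoint (hG : G.det ≠ 0) (x : EuclideanSpace ℝ (Fin d)) :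
    Tendsto (fun k => ‖x - latticePoint G k‖) cofinite atTop := by
  have h1 : Tendsto (fun (k : Fin d → ℤ) i => (k i : ℝ)) cofinite (cocompact (Fin d → ℝ)) := by
    rw [← Filter.coprodᵢ_cofinite, ← Filter.coprodᵢ_cocompact]
    exact Filter.Tendsto.pi_map_coprodᵢ fun i => Int.tendsto_coe_cofinite
  have hinv : Continuous fun y : EuclideanSpace ℝ (Fin d) => G⁻¹.mulVec y.ofLp := by fun_prop
  have h3 : Tendsto (latticePoint G) cofinite (cocompact (EuclideanSpace ℝ (Fin d))) := by
    intro s hs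
    obtain ⟨K, hK, hKs⟩ := mem_cocompact.mp hs
    have hK' := (hK.image hinv).compl_mem_cocompact
    have h2 := h1 hK'
    rw [mem_map] at h2 ⊢
    filter_upwards [h2] with k hk
    refine hKs fun hmem => hk ?_
    exact ⟨latticePoint G k, hmem, inv_mulVec_latticePoint hG k⟩
  have h4 := (tendsto_dist_left_cocompact_atTop x).comp h3
  simpa only [Function.comp_def, dist_eq_norm] using h4

end latticePoint

namespace LatticeQuantizer

variable {d : ℕ}

/-- Every full-rank lattice has a nearest neighbor quantizer. -/
theorem exists_gen_eq (G : Matrix (Fin d) (Fin d) ℝ) (hG : G.det ≠ 0) :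
    ∃ Λ : LatticeQuantizer d, Λ.gen = G := by
  classical
  -- Ties are broken measurably, in favor of the first nearest point of an enumeration.
  obtain ⟨e, he⟩ := exists_surjective_nat (Fin d → ℤ)
  have hex (x : EuclideanSpace ℝ (Fin d)) :
      ∃ n, ∀ k, ‖x - latticePoint G (e n)‖ ≤ ‖x - latticePoint G k‖ := by
    obtain ⟨k, hk⟩ := (tendsto_norm_sub_latticePoint hG x).exists_forall_le
    obtain ⟨n, rfl⟩ := he k
    exact ⟨n, hk⟩
  -- Moving each point into the fundamental parallelepiped before the tie is broken makes the
  -- quantizer periodic.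
  let fl : EuclideanSpace ℝ (Fin d) → Fin d → ℤ := fun x i => ⌊G⁻¹.mulVec x.ofLp i⌋
  let red : EuclideanSpace ℝ (Fin d) → EuclideanSpace ℝ (Fin d) := fun x => x - latticePoint G (fl x)
  let q : EuclideanSpace ℝ (Fin d) → EuclideanSpace ℝ (Fin d) := fun x =>
    latticePoint G (e (Nat.find (hex x)))
  have hfl (x k) : fl (x + latticePoint G k) = fl x + k := by
    ext i
    simp only [fl, WithLp.ofLp_add, Matrix.mulVec_add, inv_mulVec_latticePoint hG, Pi.add_apply,
      Int.floor_add_intCast]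
  have hred (x k) : red (x + latticePoint G k) = red x := by
    simp only [red, hfl, latticePoint_add]; abel
  have hqm : Measurable q := by
    have h1 : Measurable fun x => Nat.find (hex x) := by
      refine measurable_find hex fun n => ?_
      have : {x | ∀ k, ‖x - latticePoint G (e n)‖ ≤ ‖x - latticePoint G k‖} =
          ⋂ k, {x | ‖x - latticePoint G (e n)‖ ≤ ‖x - latticePoint G k‖} := by
        ext; simp
      rw [this]
      exact MeasurableSet.iInter fun k => measurableSet_le (by fun_prop) (by fun_prop)
    exact (measurable_from_nat (f := fun n => latticePoint G (e n))).comp h1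
  have hflm : Measurable fun x => latticePoint G (fl x) := by
    have h1 : Measurable fl := by
      refine measurable_pi_lambda _ fun i => Int.measurable_floor.comp ?_
      have : Continuous fun x : EuclideanSpace ℝ (Fin d) => G⁻¹.mulVec x.ofLp i := by fun_prop
      exact this.measurable
    exact (measurable_of_countable (latticePoint G)).comp h1
  have hredm : Measurable red := measurable_id.sub hflm
  refine ⟨⟨G, hG, fun x => q (red x) + latticePoint G (fl x), (hqm.comp hredm).add hflm,
    fun x => ?_, fun x k => ?_, fun x k => ?_⟩, rfl⟩
  · exact ⟨e (Nat.find (hex (red x))) + fl x, (latticePoint_add _ _ _).symm⟩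
  · have h := Nat.find_spec (hex (red x)) (k - fl x)
    have e1 : x - (q (red x) + latticePoint G (fl x)) = red x - q (red x) := by
      simp only [red]; abel
    have e2 : x - latticePoint G k = red x - latticePoint G (k - fl x) := by
      simp only [red, sub_eq_add_neg k, latticePoint_add, latticePoint_neg]; abel
    rw [e1, e2]
    exact h
  · simp only [hred, hfl, latticePoint_add]; abel

variable (Λ : LatticeQuantizer d)

theorem measurable_mod : Measurable Λ.mod := measurable_id.sub Λ.measurable_quant

theorem mod_add_latticePoint (x : EuclideanSpace ℝ (Fin d)) (k : Fin d → ℤ) :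
    Λ.mod (x + latticePoint Λ.gen k) = Λ.mod x := by
  simp only [mod, Λ.quant_add]; abel

theorem norm_mod_le (x : EuclideanSpace ℝ (Fin d)) (k : Fin d → ℤ) :
    ‖Λ.mod x‖ ≤ ‖x - latticePoint Λ.gen k‖ := Λ.quant_nearest x k

theorem norm_mod_le_norm (x : EuclideanSpace ℝ (Fin d)) : ‖Λ.mod x‖ ≤ ‖x‖ := by
  simpa [latticePoint_zero] using Λ.norm_mod_le x 0

theorem mod_sub_mod (x y : EuclideanSpace ℝ (Fin d)) : Λ.mod (x - Λ.mod y) = Λ.mod (x - y) := by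
  obtain ⟨k, hk⟩ := Λ.quant_mem y
  rw [← Λ.mod_add_latticePoint (x - y) k, ← hk]
  congr 1
  simp only [mod]; abel

theorem measurableSet_cell : MeasurableSet Λ.cell := Λ.measurable_quant (measurableSet_singleton 0)

theorem mod_eq_self {x : EuclideanSpace ℝ (Fin d)} (hx : x ∈ Λ.cell) : Λ.mod x = x := by
  rw [mod, show Λ.quant x = 0 from hx, sub_zero]

/-- The additive group of the lattice points. -/
abbrev points : AddSubgroup (EuclideanSpace ℝ (Fin d)) := (latticeHom Λ.gen).range

instance : Countable Λ.points := (latticeHom Λ.gen).rangeRestrict_surjective.countable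

theorem mod_vadd (p : Λ.points) (x : EuclideanSpace ℝ (Fin d)) : Λ.mod (p +ᵥ x) = Λ.mod x := by
  obtain ⟨_, k, rfl⟩ := p
  rw [← Λ.mod_add_latticePoint x k, add_comm]
  rfl

/-- The quantizer commutes with lattice translations, so exactly one translate of each point is
quantized to zero relative to `x`. This is what makes a dithered signal uniform. -/
theorem isAddFundamentalDomain_shift (x : EuclideanSpace ℝ (Fin d)) :
    IsAddFundamentalDomain Λ.points {w | Λ.quant (w - x) = 0} volume := by
  refine IsAddFundamentalDomain.mk' ?_ fun w => ?_
  · exact ((Λ.measurable_quant.comp (measurable_id.sub_const x))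
      (measurableSet_singleton 0)).nullMeasurableSet
  · have key (k : Fin d → ℤ) : Λ.quant (latticeHom Λ.gen k + w - x) =
        Λ.quant (w - x) + latticePoint Λ.gen k := by
      rw [← Λ.quant_add]; congr 1; rw [latticeHom_apply]; abel
    obtain ⟨k, hk⟩ := Λ.quant_mem (w - x)
    refine ⟨⟨latticeHom Λ.gen (-k), ⟨-k, rfl⟩⟩, ?_, ?_⟩
    · change Λ.quant (latticeHom Λ.gen (-k) + w - x) = 0
      rw [key, hk, latticePoint_neg, add_neg_cancel]
    · rintro ⟨_, l, rfl⟩ hl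
      have hl' : Λ.quant (latticeHom Λ.gen l + w - x) = 0 := hl
      rw [key, hk, ← latticePoint_add] at hl'
      have h0 : k + l = 0 := latticeHom_injective Λ.det_gen (hl'.trans (latticePoint_zero _).symm)
      ext1
      change latticeHom Λ.gen l = latticeHom Λ.gen (-k)
      rw [eq_neg_of_add_eq_zero_right h0]

theorem isAddFundamentalDomain_cell : IsAddFundamentalDomain Λ.points Λ.cell volume := by
  have := Λ.isAddFundamentalDomain_shift 0
  simp only [sub_zero] at this
  exact this

/-- Integrals over the cell are integrals over any fundamental domain. -/
theorem setLIntegral_cell_eq {s : Set (EuclideanSpace ℝ (Fin d))}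
    (hs : IsAddFundamentalDomain Λ.points s volume) (f : EuclideanSpace ℝ (Fin d) → ℝ≥0∞) :
    ∫⁻ v in Λ.cell, f v = ∫⁻ w in s, f (Λ.mod w) := by
  rw [← Λ.isAddFundamentalDomain_cell.setLIntegral_eq hs (fun w => f (Λ.mod w))
    (fun p x => by rw [mod_vadd])]
  exact setLIntegral_congr_fun Λ.measurableSet_cell fun v hv => by rw [Λ.mod_eq_self hv]

/-- A dithered signal is uniformly distributed on the cell. -/
theorem lintegral_dither_mod_add (x : EuclideanSpace ℝ (Fin d))
    (f : EuclideanSpace ℝ (Fin d) → ℝ≥0∞) :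
    ∫⁻ v, f (Λ.mod (x + v)) ∂Λ.dither = ∫⁻ v, f v ∂Λ.dither := by
  rw [dither, ProbabilityTheory.cond, lintegral_smul_measure, lintegral_smul_measure]
  congr 1
  -- Integration over the cell is replaced by integration over the cell moved by `x`; the
  -- substitution `w = x + v` then moves it back.
  rw [Λ.setLIntegral_cell_eq (Λ.isAddFundamentalDomain_shift x) f]
  have hm : MeasurableSet {w | Λ.quant (w - x) = 0} :=
    (Λ.measurable_quant.comp (measurable_id.sub_const x)) (measurableSet_singleton 0)
  rw [← lintegral_indicator hm, ← lintegral_indicator Λ.measurableSet_cell,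
    ← lintegral_add_left_eq_self ({w | Λ.quant (w - x) = 0}.indicator fun w => f (Λ.mod w)) x]
  refine lintegral_congr fun v => ?_
  simp only [Set.indicator, cell, Set.mem_ofPred_eq, add_sub_cancel_left]
  congr

theorem isProbabilityMeasure_dither (h0 : volume Λ.cell ≠ 0) (h1 : volume Λ.cell ≠ ∞) :
    IsProbabilityMeasure Λ.dither :=
  have : IsFiniteMeasure (volume.restrict Λ.cell) := ⟨by simpa using h1.lt_top⟩
  ProbabilityTheory.cond_isProbabilityMeasure_of_finite h0 h1

/-- The bound `C` ensures integrability; without it the Bochner integral in `secondMoment` could be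
the default value `0`. -/
theorem lintegral_norm_sq_dither (hd : 0 < d) [IsProbabilityMeasure Λ.dither] {C : ℝ}
    (hC : ∀ x, ‖Λ.mod x‖ ^ 2 ≤ C) :
    ∫⁻ v, ENNReal.ofReal (‖v‖ ^ 2) ∂Λ.dither = ENNReal.ofReal (d * Λ.secondMoment) := by
  have hae : ∀ᵐ v ∂Λ.dither, ‖v‖ ^ 2 ≤ C := by
    rw [dither]
    filter_upwards [ProbabilityTheory.ae_cond_mem Λ.measurableSet_cell] with v hv
    have := hC v
    rwa [Λ.mod_eq_self hv] at this
  have hint : Integrable (fun v => ‖v‖ ^ 2) Λ.dither := by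
    refine Integrable.of_bound (by fun_prop) C ?_
    filter_upwards [hae] with v hv
    rwa [Real.norm_eq_abs, abs_of_nonneg (sq_nonneg _)]
  rw [← ofReal_integral_eq_lintegral_ofReal hint (ae_of_all _ fun _ => sq_nonneg _), secondMoment]
  congr 1
  have : (d : ℝ) ≠ 0 := by exact_mod_cast hd.ne'
  field_simp

/-! ### Scaling -/

/-- The lattice scaled by `c`. -/
def scale (c : ℝ) (hc : 0 < c) : LatticeQuantizer d where
  gen := c • Λ.gen
  det_gen := by
    rw [Matrix.det_smul]
    exact mul_ne_zero (pow_ne_zero _ hc.ne') Λ.det_gen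
  quant x := c • Λ.quant (c⁻¹ • x)
  measurable_quant := (Λ.measurable_quant.comp (measurable_const_smul c⁻¹)).const_smul c
  quant_mem x := by
    obtain ⟨k, hk⟩ := Λ.quant_mem (c⁻¹ • x)
    refine ⟨k, ?_⟩
    rw [hk]
    ext i; simp [latticePoint, Matrix.smul_mulVec]
  quant_nearest x k := by
    have h := Λ.quant_nearest (c⁻¹ • x) k
    have e1 : x - c • Λ.quant (c⁻¹ • x) = c • (c⁻¹ • x - Λ.quant (c⁻¹ • x)) := by
      rw [smul_sub, smul_inv_smul₀ hc.ne']
    have e2 : x - latticePoint (c • Λ.gen) k = c • (c⁻¹ • x - latticePoint Λ.gen k) := by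
      rw [smul_sub, smul_inv_smul₀ hc.ne']
      congr 1
      ext i; simp [latticePoint, Matrix.smul_mulVec]
    rw [e1, e2, norm_smul, norm_smul]
    exact mul_le_mul_of_nonneg_left h (norm_nonneg c)
  quant_add x k := by
    have e2 : latticePoint (c • Λ.gen) k = c • latticePoint Λ.gen k := by
      ext i; simp [latticePoint, Matrix.smul_mulVec]
    rw [e2, smul_add, inv_smul_smul₀ hc.ne', Λ.quant_add, smul_add]

theorem mod_scale (c : ℝ) (hc : 0 < c) (x : EuclideanSpace ℝ (Fin d)) :
    (Λ.scale c hc).mod x = c • Λ.mod (c⁻¹ • x) := by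
  simp only [mod, scale, smul_sub, smul_inv_smul₀ hc.ne']

theorem cell_scale (c : ℝ) (hc : 0 < c) : (Λ.scale c hc).cell = c • Λ.cell := by
  ext x
  rw [Set.mem_smul_set_iff_inv_smul_mem₀ hc.ne']
  simp [cell, scale, hc.ne']

theorem volume_cell_scale (c : ℝ) (hc : 0 < c) :
    volume (Λ.scale c hc).cell = ENNReal.ofReal (c ^ d) * volume Λ.cell := by
  rw [cell_scale, Measure.addHaar_smul, finrank_euclideanSpace_fin, abs_of_pos (pow_pos hc d)]

theorem dither_scale (c : ℝ) (hc : 0 < c) :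
    (Λ.scale c hc).dither = Λ.dither.map fun x => c • x := by
  have hk : ENNReal.ofReal (c ^ d) ≠ 0 := by simp [pow_pos hc d]
  ext s hs
  rw [Measure.map_apply (by fun_prop) hs, dither, dither,
    ProbabilityTheory.cond_apply (measurableSet_cell _), ProbabilityTheory.cond_apply
      (measurableSet_cell _), volume_cell_scale]
  have e : (Λ.scale c hc).cell ∩ s = c • (Λ.cell ∩ (fun x => c • x) ⁻¹' s) := by
    rw [cell_scale]
    ext x
    simp only [Set.mem_inter_iff, Set.mem_smul_set_iff_inv_smul_mem₀ hc.ne', Set.mem_preimage,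
      smul_inv_smul₀ hc.ne']
  rw [e, Measure.addHaar_smul, finrank_euclideanSpace_fin, abs_of_pos (pow_pos hc d),
    ENNReal.mul_inv (Or.inl hk) (Or.inl ENNReal.ofReal_ne_top), mul_mul_mul_comm,
    ENNReal.inv_mul_cancel hk ENNReal.ofReal_ne_top, one_mul]

theorem secondMoment_scale (c : ℝ) (hc : 0 < c) :
    (Λ.scale c hc).secondMoment = c ^ 2 * Λ.secondMoment := by
  rw [secondMoment, dither_scale, integral_map (by fun_prop) (by fun_prop), secondMoment]
  simp only [norm_smul, mul_pow, Real.norm_eq_abs, sq_abs]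
  rw [integral_const_mul]
  ring

end LatticeQuantizer

/-! ### A family of random lattices -/

/-- The generator matrix of the lattice of the points `(e u, y + u t)` with `u ∈ ℤ`, `y ∈ ℤ^D`. -/
def shearGen {D : ℕ} (e : ℝ) (t : Fin D → ℝ) : Matrix (Fin (D + 1)) (Fin (D + 1)) ℝ :=
  Matrix.of (Fin.cons (Pi.single 0 e) fun i => Fin.cons (t i) (Pi.single i 1))

/-- All but the first coordinate, modulo one. -/
def tailTorus {D : ℕ} (x : EuclideanSpace ℝ (Fin (D + 1))) : Torus D := toTorus (Fin.tail x.ofLp)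

theorem measurable_tailTorus {D : ℕ} : Measurable (tailTorus (D := D)) := by
  refine measurable_toTorus.comp (measurable_pi_lambda _ fun j => ?_)
  change Measurable fun x : EuclideanSpace ℝ (Fin (D + 1)) => x j.succ
  fun_prop

section shear

variable {D : ℕ} (e : ℝ) (t : Fin D → ℝ)

theorem latticePoint_shearGen_zero (k : Fin (D + 1) → ℤ) :
    latticePoint (shearGen e t) k 0 = e * k 0 := by
  simp [latticePoint, shearGen, Matrix.mulVec, dotProduct, Pi.single_apply]

theorem latticePoint_shearGen_succ (k : Fin (D + 1) → ℤ) (j : Fin D) :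
    latticePoint (shearGen e t) k j.succ = t j * k 0 + k j.succ := by
  simp [latticePoint, shearGen, Matrix.mulVec, dotProduct, Fin.sum_univ_succ, Pi.single_apply]

theorem det_shearGen (he : e ≠ 0) : (shearGen e t).det ≠ 0 := by
  intro h
  obtain ⟨v, hv, hv0⟩ := Matrix.exists_mulVec_eq_zero_iff.mpr h
  refine hv ?_
  have h0 : v 0 = 0 := by
    have := congrFun hv0 0
    simpa [shearGen, Matrix.mulVec, dotProduct, Fin.sum_univ_succ, Pi.single_apply, he] using this
  ext j
  refine Fin.cases h0 (fun j => ?_) j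
  have := congrFun hv0 j.succ
  simpa [shearGen, Matrix.mulVec, dotProduct, Fin.sum_univ_succ, Pi.single_apply, h0] using this

theorem norm_sub_shear_sq (x : EuclideanSpace ℝ (Fin (D + 1))) (k : Fin (D + 1) → ℤ) :
    ‖x - latticePoint (shearGen e t) k‖ ^ 2 =
      (x 0 - e * k 0) ^ 2 + ∑ j : Fin D, (x j.succ - t j * k 0 - k j.succ) ^ 2 := by
  rw [EuclideanSpace.norm_sq_eq, Fin.sum_univ_succ]
  simp only [PiLp.sub_apply, latticePoint_shearGen_zero, latticePoint_shearGen_succ,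
    Real.norm_eq_abs, sq_abs, sub_add_eq_sub_sub]

theorem tailTorus_sub_apply (x : EuclideanSpace ℝ (Fin (D + 1))) (u : ℤ) (j : Fin D) :
    (tailTorus x - u • toTorus t) j = ((x j.succ - t j * u : ℝ) : UnitAddCircle) := by
  simp [tailTorus, toTorus, Fin.tail, mul_comm (t j), ← zsmul_eq_mul]

/-- For a fixed multiplier `u`, the last coordinates range over a translate of `ℤ ^ D`, so the best
distance to this layer is a torus distance, attained by rounding. -/
theorem le_norm_sub_shear_sq (x : EuclideanSpace ℝ (Fin (D + 1))) (k : Fin (D + 1) → ℤ) :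
    (x 0 - e * k 0) ^ 2 + torusSq (tailTorus x - k 0 • toTorus t) ≤
      ‖x - latticePoint (shearGen e t) k‖ ^ 2 := by
  rw [norm_sub_shear_sq, torusSq]
  refine add_le_add le_rfl (Finset.sum_le_sum fun j _ => ?_)
  rw [tailTorus_sub_apply, UnitAddCircle.norm_eq, sq_abs]
  exact sq_le_sq.mpr (round_le _ _)

theorem exists_norm_sub_shear_sq (x : EuclideanSpace ℝ (Fin (D + 1))) (u : ℤ) :
    ∃ k : Fin (D + 1) → ℤ, ‖x - latticePoint (shearGen e t) k‖ ^ 2 =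
      (x 0 - e * u) ^ 2 + torusSq (tailTorus x - u • toTorus t) := by
  refine ⟨Fin.cons u fun j => round (x j.succ - t j * u), ?_⟩
  rw [norm_sub_shear_sq, torusSq]
  simp only [Fin.cons_zero, Fin.cons_succ]
  congr 1
  refine Finset.sum_congr rfl fun j _ => ?_
  rw [tailTorus_sub_apply, UnitAddCircle.norm_eq, sq_abs]

end shear

/-- A box that is a fundamental domain. -/
def shearBox (D : ℕ) (e : ℝ) : Set (EuclideanSpace ℝ (Fin (D + 1))) :=
  {x | x 0 ∈ Set.Ioc 0 e ∧ ∀ j : Fin D, x j.succ ∈ Set.Ioc (0 : ℝ) 1}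

/-- Splitting off the first coordinate. -/
def splitHead (D : ℕ) (x : EuclideanSpace ℝ (Fin (D + 1))) : ℝ × (Fin D → ℝ) :=
  (x 0, Fin.tail x.ofLp)

theorem measurePreserving_splitHead (D : ℕ) : MeasurePreserving (splitHead D) := by
  have h := (volume_preserving_piFinSuccAbove (fun _ : Fin (D + 1) => ℝ) 0).comp
    (PiLp.volume_preserving_ofLp (Fin (D + 1)))
  exact h

theorem shearBox_eq_preimage (D : ℕ) (e : ℝ) :
    shearBox D e = splitHead D ⁻¹' (Set.Ioc 0 e ×ˢ Set.univ.pi fun _ => Set.Ioc (0 : ℝ) (0 + 1)) := by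
  ext x
  simp [shearBox, splitHead, Fin.tail]

theorem measurableSet_shearBox (D : ℕ) (e : ℝ) : MeasurableSet (shearBox D e) := by
  rw [shearBox_eq_preimage]
  exact (measurePreserving_splitHead D).measurable
    (measurableSet_Ioc.prod (MeasurableSet.univ_pi fun _ => measurableSet_Ioc))

theorem map_tailTorus_shearBox (D : ℕ) (e : ℝ) :
    (volume.restrict (shearBox D e)).map tailTorus =
      ENNReal.ofReal e • (volume : Measure (Torus D)) := by
  have h1 := (measurePreserving_splitHead D).restrict_preimage
    (s := Set.Ioc 0 e ×ˢ Set.univ.pi fun _ => Set.Ioc (0 : ℝ) (0 + 1))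
    (measurableSet_Ioc.prod (MeasurableSet.univ_pi fun _ => measurableSet_Ioc))
  have e1 : tailTorus (D := D) = toTorus ∘ Prod.snd ∘ splitHead D := rfl
  rw [shearBox_eq_preimage, e1, ← Measure.map_map measurable_toTorus
    (measurable_snd.comp h1.measurable), ← Measure.map_map measurable_snd h1.measurable, h1.map_eq,
    Measure.volume_eq_prod, ← Measure.prod_restrict, Measure.map_snd_prod, Measure.map_smul,
    (measurePreserving_toTorus D 0).map_eq]
  simp

theorem lintegral_shearBox {D : ℕ} (e : ℝ) {h : Torus D → ℝ≥0∞} (hh : Measurable h) :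
    ∫⁻ x in shearBox D e, h (tailTorus x) = ENNReal.ofReal e * ∫⁻ τ, h τ := by
  rw [← lintegral_map hh measurable_tailTorus, map_tailTorus_shearBox, lintegral_smul_measure,
    smul_eq_mul]

theorem volume_shearBox (D : ℕ) (e : ℝ) : volume (shearBox D e) = ENNReal.ofReal e := by
  have := lintegral_shearBox (D := D) e (h := fun _ => 1) measurable_const
  simpa using this

namespace LatticeQuantizer

variable {D : ℕ} {e : ℝ} {t : Fin D → ℝ} {Λ : LatticeQuantizer (D + 1)}

/-- The multiplier is determined by the first coordinate, and then each integer shift by its own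
coordinate. On the box the law of the tail modulo one is uniform, whatever `t` is. -/
theorem isAddFundamentalDomain_shearBox (he : 0 < e) (hΛ : Λ.gen = shearGen e t) :
    IsAddFundamentalDomain Λ.points (shearBox D e) volume := by
  refine IsAddFundamentalDomain.mk' (measurableSet_shearBox D e).nullMeasurableSet fun x => ?_
  obtain ⟨u, hu, hu'⟩ := existsUnique_add_zsmul_mem_Ioc he (x 0) 0
  have hy (j : Fin D) := existsUnique_add_zsmul_mem_Ioc one_pos (x j.succ + t j * u) 0
  choose y hy hy' using hy
  have key (k : Fin (D + 1) → ℤ) : latticePoint (shearGen e t) k + x ∈ shearBox D e ↔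
      (x 0 + k 0 • e ∈ Set.Ioc 0 (0 + e) ∧
        ∀ j : Fin D, x j.succ + t j * k 0 + k j.succ • (1 : ℝ) ∈ Set.Ioc (0 : ℝ) (0 + 1)) := by
    simp only [shearBox, Set.mem_ofPred_eq, PiLp.add_apply, latticePoint_shearGen_zero,
      latticePoint_shearGen_succ, zero_add, zsmul_eq_mul, mul_one]
    rw [add_comm (e * _), mul_comm e]
    simp only [add_comm (t _ * _ + _), add_assoc]
  refine ⟨⟨latticeHom Λ.gen (Fin.cons u y), ⟨_, rfl⟩⟩, ?_, ?_⟩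
  · change latticePoint Λ.gen _ + x ∈ _
    rw [hΛ, key]
    exact ⟨hu, hy⟩
  · rintro ⟨_, k, rfl⟩ hk
    have hk' : latticePoint Λ.gen k + x ∈ shearBox D e := hk
    rw [hΛ, key] at hk'
    have h0 : k 0 = u := hu' _ hk'.1
    have : k = Fin.cons u y := by
      ext j
      refine Fin.cases h0 (fun j => ?_) j
      have := hk'.2 j
      rw [h0] at this
      exact hy' j _ this
    rw [this]

theorem volume_cell_shear (he : 0 < e) (hΛ : Λ.gen = shearGen e t) :
    volume Λ.cell = ENNReal.ofReal e := by
  have := Λ.setLIntegral_cell_eq (isAddFundamentalDomain_shearBox he hΛ) fun _ => 1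
  simpa [volume_shearBox] using this

theorem norm_mod_sq_le_shear (hΛ : Λ.gen = shearGen e t) (x : EuclideanSpace ℝ (Fin (D + 1)))
    (u : ℤ) : ‖Λ.mod x‖ ^ 2 ≤ (x 0 - e * u) ^ 2 + torusSq (tailTorus x - u • toTorus t) := by
  obtain ⟨k, hk⟩ := exists_norm_sub_shear_sq e t x u
  rw [← hk, ← hΛ]
  exact pow_le_pow_left₀ (norm_nonneg _) (Λ.norm_mod_le x k) 2

theorem torusSq_le (τ : Torus D) : torusSq τ ≤ D / 4 := by
  have : ∀ j, ‖τ j‖ ^ 2 ≤ 1 / 4 := fun j => by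
    have h := AddCircle.norm_le_half_period (1 : ℝ) one_ne_zero (x := τ j)
    rw [abs_one] at h
    nlinarith [norm_nonneg (τ j)]
  refine (Finset.sum_le_sum fun j _ => this j).trans_eq ?_
  simp; ring

theorem norm_mod_sq_le_dim (he : 0 < e) (he' : e ≤ 1) (hΛ : Λ.gen = shearGen e t)
    (x : EuclideanSpace ℝ (Fin (D + 1))) : ‖Λ.mod x‖ ^ 2 ≤ (D + 1 : ℕ) := by
  refine (norm_mod_sq_le_shear hΛ x (round (x 0 / e))).trans ?_
  have h1 := abs_sub_round (x 0 / e)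
  have h2 : x 0 - e * round (x 0 / e) = e * (x 0 / e - round (x 0 / e)) := by field_simp
  have h3 : |x 0 - e * round (x 0 / e)| ≤ 1 := by
    rw [h2, abs_mul, abs_of_pos he]
    nlinarith [abs_nonneg (x 0 / e - round (x 0 / e))]
  have h4 : (x 0 - e * round (x 0 / e)) ^ 2 ≤ 1 := by rw [← sq_abs]; nlinarith [abs_nonneg (x 0 - e * round (x 0 / e))]
  have h5 := torusSq_le (tailTorus x - round (x 0 / e) • toTorus t)
  push_cast
  linarith [(Nat.cast_nonneg D : (0 : ℝ) ≤ D)]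

end LatticeQuantizer

/-- The average of `f / (2 a) + g / (2 b)` is at most one, so some point makes both terms at most
one. -/
theorem exists_le_two_mul_lintegral {Ω : Type*} [MeasurableSpace Ω] {μ : Measure Ω}
    [IsProbabilityMeasure μ] {f g : Ω → ℝ≥0∞} (hf : Measurable f) (hg : Measurable g) {a b : ℝ}
    (ha : 0 < a) (hb : 0 < b) (hfa : ∫⁻ ω, f ω ∂μ ≤ ENNReal.ofReal a)
    (hgb : ∫⁻ ω, g ω ∂μ ≤ ENNReal.ofReal b) :
    ∃ ω, f ω ≤ ENNReal.ofReal (2 * a) ∧ g ω ≤ ENNReal.ofReal (2 * b) := by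
  have h2a : ENNReal.ofReal (2 * a) ≠ 0 := by simp [ha]
  have h2b : ENNReal.ofReal (2 * b) ≠ 0 := by simp [hb]
  obtain ⟨ω, hω⟩ := exists_le_lintegral (μ := μ)
    (f := fun ω => f ω / ENNReal.ofReal (2 * a) + g ω / ENNReal.ofReal (2 * b))
    ((hf.div_const _).add (hg.div_const _)).aemeasurable
  have h1 : ∫⁻ ω, (f ω / ENNReal.ofReal (2 * a) + g ω / ENNReal.ofReal (2 * b)) ∂μ ≤ 1 := by
    simp only [div_eq_mul_inv]
    rw [lintegral_add_left (hf.mul_const _), lintegral_mul_const _ hf, lintegral_mul_const _ hg,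
      ← div_eq_mul_inv, ← div_eq_mul_inv]
    refine (add_le_add (ENNReal.div_le_div_right hfa _) (ENNReal.div_le_div_right hgb _)).trans ?_
    rw [← ENNReal.ofReal_div_of_pos (by positivity), ← ENNReal.ofReal_div_of_pos (by positivity),
      ← ENNReal.ofReal_add (by positivity) (by positivity), ← ENNReal.ofReal_one]
    refine ENNReal.ofReal_le_ofReal (le_of_eq ?_)
    field_simp
    norm_num
  have h2 := hω.trans h1
  refine ⟨ω, ?_, ?_⟩
  · have := (ENNReal.div_le_iff h2a ENNReal.ofReal_ne_top).mp (le_self_add.trans h2)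
    rwa [one_mul] at this
  · have := (ENNReal.div_le_iff h2b ENNReal.ofReal_ne_top).mp (le_add_self.trans h2)
    rwa [one_mul] at this

/-! ### The norm of a Gaussian vector -/

theorem inv_one_sub_le_exp {y : ℝ} (hy : 0 ≤ y) (hy' : y ≤ 1 / 2) :
    (1 - y)⁻¹ ≤ Real.exp (y + 2 * y ^ 2) := by
  have h1 : 0 < 1 - y := by linarith
  rw [← Real.log_le_iff_le_exp (by positivity), Real.log_inv]
  have := Real.one_sub_inv_le_log_of_pos h1
  have h2 : (1 - y)⁻¹ ≤ 1 + y + 2 * y ^ 2 := by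
    rw [inv_le_iff_one_le_mul₀ h1]
    nlinarith [mul_nonneg hy hy, mul_nonneg (mul_nonneg hy hy) (by linarith : 0 ≤ 1 / 2 - y)]
  linarith

/-- The exact value is `(1 - y) ^ (-1/2)`, bounded by `inv_one_sub_le_exp`. -/
theorem lintegral_exp_sq_gaussianReal {y : ℝ} (hy : 0 ≤ y) (hy' : y ≤ 1 / 2) :
    ∫⁻ z, ENNReal.ofReal (Real.exp (y / 2 * z ^ 2)) ∂(gaussianReal 0 1) ≤
      ENNReal.ofReal (Real.exp ((y + 2 * y ^ 2) / 2)) := by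
  have h1 : 0 < 1 - y := by linarith
  rw [gaussianReal_of_var_ne_zero _ one_ne_zero, lintegral_withDensity_eq_lintegral_mul _
    (measurable_gaussianPDF 0 1) (by fun_prop)]
  have e1 : ∀ z : ℝ, (gaussianPDF 0 1 * fun z => ENNReal.ofReal (Real.exp (y / 2 * z ^ 2))) z =
      ENNReal.ofReal ((√(2 * Real.pi))⁻¹ * Real.exp (-((1 - y) / 2) * z ^ 2)) := by
    intro z
    rw [Pi.mul_apply, gaussianPDF, ← ENNReal.ofReal_mul (gaussianPDFReal_nonneg _ _ _),
      gaussianPDFReal]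
    congr 1
    simp only [NNReal.coe_one, mul_one, sub_zero]
    rw [mul_assoc, ← Real.exp_add]
    congr 2
    ring
  simp only [e1]
  rw [← ofReal_integral_eq_lintegral_ofReal
    ((integrable_exp_neg_mul_sq (by linarith : 0 < (1 - y) / 2)).const_mul _)
    (ae_of_all _ fun z => by positivity), integral_const_mul, integral_gaussian]
  refine ENNReal.ofReal_le_ofReal ?_
  have e2 : (√(2 * Real.pi))⁻¹ * √(Real.pi / ((1 - y) / 2)) = √((1 - y)⁻¹) := by
    rw [← Real.sqrt_inv, ← Real.sqrt_mul (by positivity)]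
    congr 1
    have := Real.pi_pos
    field_simp
  rw [e2, show (y + 2 * y ^ 2) / 2 = (y + 2 * y ^ 2) * (1 / 2) by ring, Real.exp_mul,
    ← Real.sqrt_eq_rpow]
  exact Real.sqrt_le_sqrt (inv_one_sub_le_exp hy hy')

/-- The norm of a Gaussian vector concentrates. -/
theorem stdGaussian_norm_sq_ge {n : ℕ} {δ : ℝ} (hδ : 0 ≤ δ) (hδ' : δ ≤ 1) :
    stdGaussian (EuclideanSpace ℝ (Fin n)) {x | n * (1 + δ) ≤ ‖x‖ ^ 2} ≤
      ENNReal.ofReal (Real.exp (-(n * δ ^ 2 / 16))) := by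
  -- The minimizer of `2 y ^ 2 - y δ`, which is `2 / n` times the Chernoff exponent.
  set y : ℝ := δ / 4 with hy
  have hm : MeasurableSet {x : EuclideanSpace ℝ (Fin n) | n * (1 + δ) ≤ ‖x‖ ^ 2} :=
    measurableSet_le measurable_const (by fun_prop)
  rw [← map_pi_eq_stdGaussian, Measure.map_apply (by fun_prop) hm]
  have h1 : ∫⁻ x : Fin n → ℝ, ∏ i, ENNReal.ofReal (Real.exp (y / 2 * x i ^ 2))
      ∂(Measure.pi fun _ => gaussianReal 0 1) ≤
        ENNReal.ofReal (Real.exp (n * ((y + 2 * y ^ 2) / 2))) := by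
    have hf : Measurable fun z : ℝ => ENNReal.ofReal (Real.exp (y / 2 * z ^ 2)) := by fun_prop
    have hind := iIndepFun_pi (μ := fun _ : Fin n => gaussianReal 0 1)
      (X := fun _ z => ENNReal.ofReal (Real.exp (y / 2 * z ^ 2))) fun _ => hf.aemeasurable
    rw [lintegral_prod_eq_prod_lintegral_of_indepFun Finset.univ
      (fun i (x : Fin n → ℝ) => ENNReal.ofReal (Real.exp (y / 2 * x i ^ 2))) hind
      fun i => hf.comp (measurable_pi_apply i)]
    have hi (i : Fin n) : ∫⁻ x : Fin n → ℝ, ENNReal.ofReal (Real.exp (y / 2 * x i ^ 2))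
        ∂(Measure.pi fun _ => gaussianReal 0 1) =
          ∫⁻ z, ENNReal.ofReal (Real.exp (y / 2 * z ^ 2)) ∂(gaussianReal 0 1) :=
      (measurePreserving_eval (fun _ : Fin n => gaussianReal 0 1) i).lintegral_comp hf
    simp only [hi]
    refine (Finset.prod_le_prod' fun i _ =>
      lintegral_exp_sq_gaussianReal (y := y) (by positivity) (by linarith)).trans_eq ?_
    rw [Finset.prod_const, Finset.card_univ, Fintype.card_fin, ← ENNReal.ofReal_pow (by positivity),
      ← Real.exp_nat_mul]
  have hsub : (WithLp.toLp 2 ⁻¹' {x : EuclideanSpace ℝ (Fin n) | n * (1 + δ) ≤ ‖x‖ ^ 2}) ⊆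
      {x | ENNReal.ofReal (Real.exp (y / 2 * (n * (1 + δ)))) ≤
        ∏ i, ENNReal.ofReal (Real.exp (y / 2 * x i ^ 2))} := by
    intro x hx
    have hx' : n * (1 + δ) ≤ ‖(WithLp.toLp 2 x : EuclideanSpace ℝ (Fin n))‖ ^ 2 := hx
    rw [EuclideanSpace.norm_sq_eq] at hx'
    simp only [Real.norm_eq_abs, sq_abs] at hx'
    rw [Set.mem_ofPred_eq, ← ENNReal.ofReal_prod_of_nonneg fun i _ => (Real.exp_pos _).le,
      ← Real.exp_sum, ← Finset.mul_sum]
    gcongr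
  refine (measure_mono hsub).trans ((meas_ge_le_lintegral_div
    (Finset.measurable_prod _ fun i _ => ?_).aemeasurable
    (by simp [Real.exp_pos]) ENNReal.ofReal_ne_top).trans ?_)
  · exact ENNReal.measurable_ofReal.comp (by fun_prop)
  refine (ENNReal.div_le_div_right h1 _).trans ?_
  rw [← ENNReal.ofReal_div_of_pos (Real.exp_pos _), ← Real.exp_sub]
  refine ENNReal.ofReal_le_ofReal (Real.exp_le_exp.mpr (le_of_eq ?_))
  rw [hy]; ring

/-! ### Overload probability and second moment of the random lattices -/

namespace LatticeQuantizer

variable {D : ℕ} {e : ℝ} {t : Fin D → ℝ} {Λ : LatticeQuantizer (D + 1)}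

/-- The nonzero multipliers that matter for the overload of a short vector. -/
def nearMultipliers (e : ℝ) : Finset ℤ := (Finset.Icc (-⌊1 / (2 * e)⌋) ⌊1 / (2 * e)⌋).erase 0

theorem card_nearMultipliers_le (he : 0 < e) : ((nearMultipliers e).card : ℝ) ≤ 1 / e := by
  have h0 : 0 ≤ ⌊1 / (2 * e)⌋ := Int.floor_nonneg.mpr (by positivity)
  have h1 : ((nearMultipliers e).card : ℤ) = 2 * ⌊1 / (2 * e)⌋ := by
    rw [nearMultipliers, Finset.card_erase_of_mem (Finset.mem_Icc.mpr ⟨neg_nonpos.mpr h0, h0⟩), Int.card_Icc]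
    omega
  have h2 : ((nearMultipliers e).card : ℝ) = 2 * (⌊1 / (2 * e)⌋ : ℝ) := by exact_mod_cast h1
  rw [h2]
  have := Int.floor_le (1 / (2 * e))
  have e1 : 1 / e = 2 * (1 / (2 * e)) := by field_simp
  linarith

/-- An overload of `s • x` means that some nonzero lattice point `l` is as near as zero, so `2 s ⟪x,
l⟫ ≥ ‖l‖ ^ 2`. This persists when `s` grows to `s₀`, so a single event covers all scales. If `‖s₀ •
x‖ < 1 / 4`, then `‖l‖ < 1`, which excludes the multiplier zero, whose layer consists of integer
vectors. -/
theorem overload_shear (he : 0 < e) (hΛ : Λ.gen = shearGen e t) {s s₀ : ℝ} (hs : 0 ≤ s)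
    (hss : s ≤ s₀) {x : EuclideanSpace ℝ (Fin (D + 1))} (hx : Λ.mod (s • x) ≠ s • x) :
    1 / 4 ≤ ‖s₀ • x‖ ∨
      ∃ u ∈ nearMultipliers e, torusSq (tailTorus (s₀ • x) - u • toTorus t) < 1 / 16 := by
  obtain ⟨k, hk⟩ := Λ.quant_mem (s • x)
  set l := latticePoint Λ.gen k with hl
  have hl0 : l ≠ 0 := fun h => hx (by rw [mod, hk, h, sub_zero])
  have h1 : ‖s • x - l‖ ≤ ‖s • x‖ := by
    have := Λ.norm_mod_le_norm (s • x)
    rwa [mod, hk] at this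
  have h2 : ‖s₀ • x - l‖ ^ 2 ≤ ‖s₀ • x‖ ^ 2 := by
    have h3 := pow_le_pow_left₀ (norm_nonneg _) h1 2
    rw [norm_sub_sq_real, inner_smul_left] at h3 ⊢
    simp only [conj_trivial] at h3 ⊢
    have h4 : 0 < ‖l‖ := norm_pos_iff.mpr hl0
    have h5 : 0 < s * inner ℝ x l := by nlinarith [sq_pos_of_pos h4]
    have h6 : 0 < inner ℝ x l := pos_of_mul_pos_right h5 hs
    nlinarith [mul_le_mul_of_nonneg_right hss h6.le]
  rcases le_or_gt (1 / 4) ‖s₀ • x‖ with h | h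
  · exact Or.inl h
  refine Or.inr ?_
  have h3 : ‖s₀ • x - l‖ ≤ ‖s₀ • x‖ :=
    (sq_le_sq₀ (norm_nonneg _) (norm_nonneg _)).mp h2
  have h4 := le_norm_sub_shear_sq e t (s₀ • x) k
  rw [← hΛ, ← hl] at h4
  have h5 : ‖s₀ • x - l‖ ^ 2 < 1 / 16 := by nlinarith [norm_nonneg (s₀ • x)]
  have h6 : 0 ≤ torusSq (tailTorus (s₀ • x) - k 0 • toTorus t) :=
    Finset.sum_nonneg fun _ _ => sq_nonneg _
  have hk0 : k 0 ≠ 0 := by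
    intro h0
    have hl1 : ‖l‖ < 1 := by
      have : ‖l‖ ≤ ‖s₀ • x‖ + ‖s₀ • x - l‖ := by
        have := norm_sub_le (s₀ • x) (s₀ • x - l)
        rwa [sub_sub_cancel] at this
      linarith
    refine hl0 ?_
    ext j
    refine Fin.cases ?_ (fun j => ?_) j
    · rw [hl, hΛ, latticePoint_shearGen_zero, h0]; simp
    · have hj : |l j.succ| < 1 := by
        have := PiLp.norm_apply_le l j.succ
        rw [Real.norm_eq_abs] at this
        linarith
      rw [hl, hΛ, latticePoint_shearGen_succ, h0] at hj ⊢
      simp only [Int.cast_zero, mul_zero, zero_add] at hj ⊢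
      have : |k j.succ| < 1 := by exact_mod_cast hj
      rw [Int.abs_lt_one_iff.mp this]
      simp
  refine ⟨k 0, ?_, by nlinarith⟩
  have h7 : |(s₀ • x) 0| < 1 / 4 := by
    have := PiLp.norm_apply_le (s₀ • x) 0
    rw [Real.norm_eq_abs] at this
    linarith
  have h8 : |(s₀ • x) 0 - e * k 0| < 1 / 4 := abs_lt_of_sq_lt_sq (by nlinarith) (by norm_num)
  rw [abs_lt] at h7 h8
  rw [nearMultipliers, Finset.mem_erase, Finset.mem_Icc]
  have h9 : -(1 / (2 * e)) ≤ k 0 ∧ (k 0 : ℝ) ≤ 1 / (2 * e) := by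
    rw [← neg_div, div_le_iff₀ (by positivity), le_div_iff₀ (by positivity)]
    constructor <;> nlinarith
  refine ⟨hk0, ?_, Int.le_floor.mpr h9.2⟩
  have : -k 0 ≤ ⌊1 / (2 * e)⌋ := Int.le_floor.mpr (by push_cast; linarith [h9.1])
  linarith

/-- The probability of an overload, averaged over the random lattices. -/
theorem lintegral_overload_le (he : 0 < e) (μ : Measure (EuclideanSpace ℝ (Fin (D + 1))))
    [IsProbabilityMeasure μ] :
    ((volume : Measure (Torus D)).prod μ) {p | 1 / 4 ≤ ‖p.2‖ ∨
      ∃ u ∈ nearMultipliers e, torusSq (tailTorus p.2 - u • p.1) < 1 / 16} ≤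
      μ {y | 1 / 4 ≤ ‖y‖} + ENNReal.ofReal (quarterBall D / e) := by
  have hsub : {p : Torus D × EuclideanSpace ℝ (Fin (D + 1)) | 1 / 4 ≤ ‖p.2‖ ∨
      ∃ u ∈ nearMultipliers e, torusSq (tailTorus p.2 - u • p.1) < 1 / 16} ⊆
      (Prod.snd ⁻¹' {y | 1 / 4 ≤ ‖y‖}) ∪
        ⋃ u ∈ nearMultipliers e, {p | torusSq (tailTorus p.2 - u • p.1) < 1 / 16} := by
    rintro p (h | ⟨u, hu, h⟩)
    · exact Or.inl h
    · exact Or.inr (Set.mem_biUnion hu h)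
  refine (measure_mono hsub).trans ((measure_union_le _ _).trans (add_le_add ?_ ?_))
  · have hm : MeasurableSet {y : EuclideanSpace ℝ (Fin (D + 1)) | 1 / 4 ≤ ‖y‖} :=
      measurableSet_le measurable_const (by fun_prop)
    exact (measurePreserving_snd.measure_preimage hm.nullMeasurableSet).le
  · refine (measure_biUnion_finset_le _ _).trans ?_
    -- For `u ≠ 0` the point `u t` is uniform on the torus, so each multiplier contributes the
    -- volume of one ball.
    have hu : ∀ u ∈ nearMultipliers e, ((volume : Measure (Torus D)).prod μ)
        {p | torusSq (tailTorus p.2 - u • p.1) < 1 / 16} ≤ ENNReal.ofReal (quarterBall D) := by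
      intro u hu
      have hm : MeasurableSet {τ : Torus D | torusSq τ < 1 / 16} :=
        measurableSet_lt measurable_torusSq measurable_const
      have hm' : MeasurableSet {p : Torus D × EuclideanSpace ℝ (Fin (D + 1)) |
          torusSq (tailTorus p.2 - u • p.1) < 1 / 16} := by
        have : Measurable fun p : Torus D × EuclideanSpace ℝ (Fin (D + 1)) =>
            tailTorus p.2 - u • p.1 :=
          (measurable_tailTorus.comp measurable_snd).sub (by fun_prop)
        exact this hm
      rw [Measure.prod_apply_symm hm']
      calc ∫⁻ y, volume ((fun t => (t, y)) ⁻¹' {p : Torus D × EuclideanSpace ℝ (Fin (D + 1)) |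
            torusSq (tailTorus p.2 - u • p.1) < 1 / 16}) ∂μ
          = ∫⁻ y, ENNReal.ofReal (quarterBall D) ∂μ := by
            refine lintegral_congr fun y => ?_
            rw [← volume_torusSq_lt_quarter]
            exact (measurePreserving_sub_zsmul_torus (Finset.ne_of_mem_erase hu)
              (tailTorus y)).measure_preimage hm.nullMeasurableSet
        _ ≤ ENNReal.ofReal (quarterBall D) := by simp
    refine (Finset.sum_le_sum hu).trans ?_
    rw [Finset.sum_const, nsmul_eq_mul, ← ENNReal.ofReal_natCast,
      ← ENNReal.ofReal_mul (Nat.cast_nonneg _)]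
    refine ENNReal.ofReal_le_ofReal ?_
    rw [div_eq_mul_one_div, mul_comm]
    exact mul_le_mul_of_nonneg_left (card_nearMultipliers_le he) (quarterBall_pos D).le

theorem isProbabilityMeasure_dither_shear (he : 0 < e) (hΛ : Λ.gen = shearGen e t) :
    IsProbabilityMeasure Λ.dither :=
  Λ.isProbabilityMeasure_dither (by simp [volume_cell_shear he hΛ, he])
    (by simp [volume_cell_shear he hΛ])

theorem ofReal_dim_mul_secondMoment (he : 0 < e) (he' : e ≤ 1) (hΛ : Λ.gen = shearGen e t) :
    ENNReal.ofReal ((D + 1 : ℕ) * Λ.secondMoment) =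
      (ENNReal.ofReal e)⁻¹ * ∫⁻ w in shearBox D e, ENNReal.ofReal (‖Λ.mod w‖ ^ 2) := by
  have := isProbabilityMeasure_dither_shear he hΛ
  rw [← Λ.lintegral_norm_sq_dither (Nat.succ_pos D) (norm_mod_sq_le_dim he he' hΛ), dither,
    ProbabilityTheory.cond, lintegral_smul_measure, volume_cell_shear he hΛ,
    Λ.setLIntegral_cell_eq (isAddFundamentalDomain_shearBox he hΛ)]
  rfl

theorem secondMoment_nonneg {d : ℕ} (Λ : LatticeQuantizer d) : 0 ≤ Λ.secondMoment := by
  rw [secondMoment]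
  have : 0 ≤ ∫ v, ‖v‖ ^ 2 ∂Λ.dither := integral_nonneg fun _ => sq_nonneg _
  positivity

/-- If the tail of a point is within `ρ` of one of the first `U` multiples of `t`, the squared
distance to the lattice is at most `ρ ^ 2 + h ^ 2`. On the exceptional set, of volume at most `a`,
the trivial bound by the dimension is used. -/
theorem dim_mul_secondMoment_le (he : 0 < e) (he' : e ≤ 1) (hΛ : Λ.gen = shearGen e t) {U : ℕ}
    {ρ h a : ℝ} (hU : e * U ≤ h) (ha : 0 ≤ a) (hE : volume {τ : Torus D | ∀ u ∈ Finset.Icc 1 U,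
      ρ ^ 2 ≤ torusSq (τ - (u : ℤ) • toTorus t)} ≤ ENNReal.ofReal a) :
    (D + 1 : ℕ) * Λ.secondMoment ≤ ρ ^ 2 + h ^ 2 + (D + 1 : ℕ) * a := by
  set E := {τ : Torus D | ∀ u ∈ Finset.Icc 1 U, ρ ^ 2 ≤ torusSq (τ - (u : ℤ) • toTorus t)} with hEd
  have hEm : MeasurableSet E := by
    have : E = ⋂ u ∈ Finset.Icc 1 U, {τ | ρ ^ 2 ≤ torusSq (τ - (u : ℤ) • toTorus t)} := by
      ext; simp [hEd]
    rw [this]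
    exact Finset.measurableSet_biInter _ fun u _ =>
      measurableSet_le measurable_const (measurable_torusSq.comp (by fun_prop))
  rw [← ENNReal.ofReal_le_ofReal_iff (by positivity), ofReal_dim_mul_secondMoment he he' hΛ]
  have hH : Measurable fun τ : Torus D => ENNReal.ofReal (ρ ^ 2 + h ^ 2) +
      E.indicator (fun _ => ENNReal.ofReal (D + 1 : ℕ)) τ :=
    (measurable_const.indicator hEm).const_add _
  calc (ENNReal.ofReal e)⁻¹ * ∫⁻ w in shearBox D e, ENNReal.ofReal (‖Λ.mod w‖ ^ 2)
      ≤ (ENNReal.ofReal e)⁻¹ * ∫⁻ w in shearBox D e, (ENNReal.ofReal (ρ ^ 2 + h ^ 2) +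
          E.indicator (fun _ => ENNReal.ofReal (D + 1 : ℕ)) (tailTorus w)) := by
        refine mul_le_mul_right (setLIntegral_mono' (measurableSet_shearBox D e) fun w hw => ?_) _
        by_cases hwE : tailTorus w ∈ E
        · rw [Set.indicator_of_mem hwE]
          exact (ENNReal.ofReal_le_ofReal (norm_mod_sq_le_dim he he' hΛ w)).trans le_add_self
        · refine le_add_right (ENNReal.ofReal_le_ofReal ?_)
          simp only [hEd, Set.mem_ofPred_eq, not_forall, not_le] at hwE
          obtain ⟨u, hu, hlt⟩ := hwE
          refine (norm_mod_sq_le_shear hΛ w u).trans ?_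
          -- The difference lies between `-e u` and `0`, because `0 < w 0 ≤ e` and `u ≥ 1`.
          have h1 : |w 0 - e * (u : ℤ)| ≤ h := by
            have hw0 := hw.1
            have hu1 : (1 : ℝ) ≤ u := by exact_mod_cast (Finset.mem_Icc.mp hu).1
            have hu2 : (u : ℝ) ≤ U := by exact_mod_cast (Finset.mem_Icc.mp hu).2
            rw [abs_le]
            push_cast
            constructor
            · nlinarith [hw0.1]
            · nlinarith [hw0.2]
          have h2 : (w 0 - e * (u : ℤ)) ^ 2 ≤ h ^ 2 := by
            rw [← sq_abs]; exact pow_le_pow_left₀ (abs_nonneg _) h1 2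
          linarith
    _ = ENNReal.ofReal (ρ ^ 2 + h ^ 2) + ENNReal.ofReal (D + 1 : ℕ) * volume E := by
        rw [lintegral_shearBox e hH, ← mul_assoc, ENNReal.inv_mul_cancel (by simp [he])
          ENNReal.ofReal_ne_top, one_mul, lintegral_add_left measurable_const,
          lintegral_indicator_const hEm, lintegral_const, measure_univ, mul_one]
    _ ≤ ENNReal.ofReal (ρ ^ 2 + h ^ 2) + ENNReal.ofReal (D + 1 : ℕ) * ENNReal.ofReal a := by
        gcongr
    _ = _ := by
        rw [← ENNReal.ofReal_mul (by positivity), ← ENNReal.ofReal_add (by positivity)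
          (by positivity)]

/-- Points within `1 / 4` of the lattice have their tails in few small balls, so at least half of
the box is farther away. The bound limits the scaling factor when the lattice is normalized. -/
theorem le_dim_mul_secondMoment (he : 0 < e) (he' : e ≤ 1 / 10)
    (hq : quarterBall D ≤ e / 2) (hΛ : Λ.gen = shearGen e t) :
    1 / 32 ≤ (D + 1 : ℕ) * Λ.secondMoment := by
  -- A distance below `1 / 4` in the first coordinate and `0 < w 0 ≤ e` force `|u| ≤ 1 / (4 e) + 1`.
  set K : ℤ := ⌊1 / (4 * e) + 1⌋ with hK
  set B := {τ : Torus D | ∃ u ∈ Finset.Icc (-K) K, torusSq (τ - u • toTorus t) < 1 / 16} with hB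
  have hBU : B = ⋃ u ∈ Finset.Icc (-K) K, {τ | torusSq (τ - u • toTorus t) < 1 / 16} := by
    ext τ; simp only [hB, Set.mem_ofPred_eq, Set.mem_iUnion, exists_prop]
  have hm : MeasurableSet {τ : Torus D | torusSq τ < 1 / 16} :=
    measurableSet_lt measurable_torusSq measurable_const
  have hmu (u : ℤ) : MeasurableSet {τ : Torus D | torusSq (τ - u • toTorus t) < 1 / 16} :=
    (measurable_id.sub_const (u • toTorus t)) hm
  have hBm : MeasurableSet B := by
    rw [hBU]
    exact Finset.measurableSet_biUnion _ fun u _ => hmu u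
  have hK0 : 0 ≤ K := Int.floor_nonneg.mpr (by positivity)
  have hBv : volume B ≤ ENNReal.ofReal (1 / 2) := by
    rw [hBU]
    refine (measure_biUnion_finset_le _ _).trans ?_
    have : ∀ u ∈ Finset.Icc (-K) K, volume {τ : Torus D | torusSq (τ - u • toTorus t) < 1 / 16} =
        ENNReal.ofReal (quarterBall D) := fun u _ => by
      rw [← volume_torusSq_lt_quarter]
      exact (measurePreserving_sub_right volume (u • toTorus t)).measure_preimage
        hm.nullMeasurableSet
    rw [Finset.sum_congr rfl this, Finset.sum_const, nsmul_eq_mul, ← ENNReal.ofReal_natCast,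
      ← ENNReal.ofReal_mul (Nat.cast_nonneg _)]
    refine ENNReal.ofReal_le_ofReal ?_
    have hc : (((Finset.Icc (-K) K).card : ℕ) : ℤ) = 2 * K + 1 := by
      rw [Int.card_Icc]; omega
    have hc' : ((Finset.Icc (-K) K).card : ℝ) = 2 * K + 1 := by exact_mod_cast hc
    rw [hc']
    have h1 : (K : ℝ) ≤ 1 / (4 * e) + 1 := Int.floor_le _
    have h2 : (0 : ℝ) ≤ K := by exact_mod_cast hK0
    have h3 := (quarterBall_pos D).le
    calc (2 * (K : ℝ) + 1) * quarterBall D ≤ (2 * (1 / (4 * e) + 1) + 1) * (e / 2) := by gcongr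
      _ = 1 / 4 + 3 / 2 * e := by field_simp; ring
      _ ≤ 1 / 2 := by linarith
  have hBc : ENNReal.ofReal (1 / 2) ≤ volume Bᶜ := by
    rw [prob_compl_eq_one_sub hBm]
    refine ENNReal.le_sub_of_add_le_left (hBv.trans_lt ENNReal.ofReal_lt_top).ne ?_
    calc volume B + ENNReal.ofReal (1 / 2) ≤ ENNReal.ofReal (1 / 2) + ENNReal.ofReal (1 / 2) := by
          gcongr
      _ = 1 := by rw [← ENNReal.ofReal_add (by norm_num) (by norm_num)]; norm_num
  rw [← ENNReal.ofReal_le_ofReal_iff (mul_nonneg (Nat.cast_nonneg _) Λ.secondMoment_nonneg),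
    ofReal_dim_mul_secondMoment he (he'.trans (by norm_num)) hΛ]
  have hH : Measurable (Bᶜ.indicator fun _ : Torus D => ENNReal.ofReal (1 / 16)) :=
    measurable_const.indicator hBm.compl
  calc ENNReal.ofReal (1 / 32)
      = ENNReal.ofReal (1 / 16) * ENNReal.ofReal (1 / 2) := by
        rw [← ENNReal.ofReal_mul (by norm_num)]; norm_num
    _ ≤ ENNReal.ofReal (1 / 16) * volume Bᶜ := by gcongr
    _ = (ENNReal.ofReal e)⁻¹ *
        ∫⁻ w in shearBox D e, Bᶜ.indicator (fun _ => ENNReal.ofReal (1 / 16)) (tailTorus w) := by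
        rw [lintegral_shearBox e hH, ← mul_assoc, ENNReal.inv_mul_cancel (by simp [he])
          ENNReal.ofReal_ne_top, one_mul, lintegral_indicator_const hBm.compl]
    _ ≤ _ := by
        refine mul_le_mul_right (setLIntegral_mono' (measurableSet_shearBox D e) fun w hw => ?_) _
        by_cases hwB : tailTorus w ∈ B
        · rw [Set.indicator_of_notMem (by simpa using hwB)]
          exact zero_le
        · rw [Set.indicator_of_mem (by simpa using hwB)]
          refine ENNReal.ofReal_le_ofReal ?_
          by_contra! hlt
          refine hwB ?_
          obtain ⟨k, hk⟩ := Λ.quant_mem w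
          rw [mod, hk] at hlt
          have h4 := le_norm_sub_shear_sq e t w k
          rw [← hΛ] at h4
          have h6 : 0 ≤ torusSq (tailTorus w - k 0 • toTorus t) :=
            Finset.sum_nonneg fun _ _ => sq_nonneg _
          refine ⟨k 0, ?_, by nlinarith⟩
          have h8 : |w 0 - e * k 0| < 1 / 4 := abs_lt_of_sq_lt_sq (by nlinarith) (by norm_num)
          rw [abs_lt] at h8
          have hw0 := hw.1
          have h9 : -(1 / (4 * e) + 1) ≤ k 0 ∧ (k 0 : ℝ) ≤ 1 / (4 * e) + 1 := by
            have e1 : (1 / (4 * e) + 1) * e = 1 / 4 + e := by field_simp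
            constructor
            · rw [neg_le, ← mul_le_mul_iff_left₀ he, e1]
              nlinarith [hw0.1, hw0.2]
            · rw [← mul_le_mul_iff_left₀ he, e1]
              nlinarith [hw0.1, hw0.2]
          rw [Finset.mem_Icc]
          refine ⟨?_, Int.le_floor.mpr h9.2⟩
          have : -k 0 ≤ K := Int.le_floor.mpr (by push_cast; linarith [h9.1])
          linarith

end LatticeQuantizer

/-! ### Existence of good lattices of given second moment -/

namespace LatticeQuantizer

theorem toTorus_surjective (D : ℕ) : Function.Surjective (toTorus (D := D)) := by
  intro τ
  have h (j : Fin D) : ∃ x : ℝ, (x : UnitAddCircle) = τ j := QuotientAddGroup.mk_surjective (τ j)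
  choose x hx using h
  exact ⟨x, funext hx⟩

/-- The covolume `e = q b ^ D` exceeds the volume `q` of the ball of radius `1 / 4` by the factor `b
^ D`, so short Gaussian vectors rarely overload. It is smaller than the volume `q b ^ (2 D)` of the
ball of radius `b ^ 2 / 4` by the same factor, so almost every point has a lattice point within
about this distance. As `b ^ 4 = 1 + δ`, the two radii nearly agree. -/
theorem exists_good_shear {D : ℕ} {δ b s₀ : ℝ} (hδ : 0 < δ) (hδ' : δ ≤ 1) (hb : 1 ≤ b)
    (hbδ : b ^ 4 = 1 + δ) (hbD : 2 ≤ b ^ D) (he : quarterBall D * b ^ D ≤ δ / 8)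
    (he' : quarterBall D * b ^ D ≤ 1 / 10) (hs₀ : 0 < s₀)
    (hs : (D + 1 : ℕ) * (1 + δ) * s₀ ^ 2 = 1 / 16) :
    ∃ Λ : LatticeQuantizer (D + 1), IsProbabilityMeasure Λ.dither ∧
      (∀ x, ‖Λ.mod x‖ ^ 2 ≤ (D + 1 : ℕ)) ∧ 1 / 32 ≤ (D + 1 : ℕ) * Λ.secondMoment ∧
      (D + 1 : ℕ) * Λ.secondMoment ≤ (1 + 2 * δ) / 16 + (D + 1 : ℕ) * (16 / (δ * b ^ D)) ∧
      ∀ s, 0 ≤ s → s ≤ s₀ →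
        stdGaussian (EuclideanSpace ℝ (Fin (D + 1))) {x | Λ.mod (s • x) ≠ s • x} ≤
          ENNReal.ofReal (2 * ((b ^ D)⁻¹ + Real.exp (-((D + 1 : ℕ) * δ ^ 2 / 16)))) := by
  set q := quarterBall D with hq
  set e := q * b ^ D with hedef
  have hq0 : 0 < q := quarterBall_pos D
  have hbD0 : 0 < b ^ D := by positivity
  have he0 : 0 < e := by positivity
  have hc2 : b ^ 2 ≤ 2 := by nlinarith [sq_nonneg (b ^ 2 - 1)]
  -- As many multiples as possible while the first coordinate is off by at most `e U ≤ δ / 4`.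
  set U := ⌊δ / (4 * e)⌋₊ with hU
  have hx : 1 ≤ δ / (8 * e) := by rw [le_div_iff₀ (by positivity)]; linarith
  have hx2 : δ / (4 * e) = 2 * (δ / (8 * e)) := by field_simp; norm_num
  have hU1 : δ / (8 * e) ≤ U := by
    have := Nat.lt_floor_add_one (δ / (4 * e))
    rw [← hU] at this
    linarith
  have hU0 : 0 < U := by
    have : (0 : ℝ) < U := lt_of_lt_of_le (by positivity) hU1
    exact_mod_cast this
  have hU2 : e * U ≤ δ / 4 := by
    have := Nat.floor_le (by positivity : 0 ≤ δ / (4 * e))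
    rw [← hU, le_div_iff₀ (by positivity)] at this
    linarith
  set μ : Measure (EuclideanSpace ℝ (Fin (D + 1))) :=
    (stdGaussian (EuclideanSpace ℝ (Fin (D + 1)))).map fun x => s₀ • x with hμ
  have hμp : IsProbabilityMeasure μ := Measure.isProbabilityMeasure_map (by fun_prop)
  set O : Set (Torus D × EuclideanSpace ℝ (Fin (D + 1))) := {p | 1 / 4 ≤ ‖p.2‖ ∨
      ∃ u ∈ nearMultipliers e, torusSq (tailTorus p.2 - u • p.1) < 1 / 16} with hO
  set E : Set (Torus D × Torus D) := {p | ∀ u ∈ Finset.Icc 1 U,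
    (b ^ 2 * (1 / 4)) ^ 2 ≤ torusSq (p.2 - (u : ℤ) • p.1)} with hE
  have hOm : MeasurableSet O := by
    have : O = {p | 1 / 4 ≤ ‖p.2‖} ∪ ⋃ u ∈ nearMultipliers e,
        {p | torusSq (tailTorus p.2 - u • p.1) < 1 / 16} := by
      ext p; simp only [hO, Set.mem_union, Set.mem_ofPred_eq, Set.mem_iUnion, exists_prop]
    rw [this]
    refine (measurableSet_le measurable_const (by fun_prop)).union
      (Finset.measurableSet_biUnion _ fun u _ => measurableSet_lt (measurable_torusSq.comp
        ((measurable_tailTorus.comp measurable_snd).sub (by fun_prop))) measurable_const)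
  have hEm : MeasurableSet E := by
    have : E = ⋂ u ∈ Finset.Icc 1 U, {p | (b ^ 2 * (1 / 4)) ^ 2 ≤
        torusSq (p.2 - (u : ℤ) • p.1)} := by
      ext p; simp only [hE, Set.mem_iInter, Set.mem_ofPred_eq]
    rw [this]
    exact Finset.measurableSet_biInter _ fun u _ =>
      measurableSet_le measurable_const (measurable_torusSq.comp (by fun_prop))
  have hf : ∫⁻ τ : Torus D, volume (Prod.mk τ ⁻¹' E) ≤ ENNReal.ofReal (8 / (δ * b ^ D)) := by
    rw [← Measure.prod_apply hEm]
    refine (measure_forall_le_torusSq_le hU0 (by positivity) hc2).trans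
      (ENNReal.ofReal_le_ofReal ?_)
    rw [div_le_div_iff₀ (by positivity) (by positivity), one_mul]
    calc δ * b ^ D = 8 * (δ / (8 * e) * ((b ^ 2) ^ D * q)) := by
          rw [hedef, ← pow_mul, mul_comm 2 D, pow_mul]; field_simp
      _ ≤ 8 * (U * ((b ^ 2) ^ D * q)) := by gcongr
  have hg : ∫⁻ τ : Torus D, μ (Prod.mk τ ⁻¹' O) ≤
      ENNReal.ofReal ((b ^ D)⁻¹ + Real.exp (-((D + 1 : ℕ) * δ ^ 2 / 16))) := by
    rw [← Measure.prod_apply hOm]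
    refine (lintegral_overload_le he0 μ).trans ?_
    rw [add_comm, ENNReal.ofReal_add (by positivity) (by positivity)]
    refine add_le_add (ENNReal.ofReal_le_ofReal (le_of_eq ?_)) ?_
    · rw [hedef, ← hq]; field_simp
    · rw [hμ, Measure.map_apply (by fun_prop) (measurableSet_le measurable_const (by fun_prop))]
      refine (measure_mono ?_).trans (stdGaussian_norm_sq_ge hδ.le hδ')
      intro x hx
      have hx' : 1 / 4 ≤ ‖s₀ • x‖ := hx
      rw [norm_smul, Real.norm_eq_abs, abs_of_pos hs₀] at hx'
      have h1 : (1 / 4) ^ 2 ≤ (s₀ * ‖x‖) ^ 2 := pow_le_pow_left₀ (by norm_num) hx' 2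
      have h2 : s₀ ^ 2 * ((D + 1 : ℕ) * (1 + δ)) ≤ s₀ ^ 2 * ‖x‖ ^ 2 := by nlinarith
      exact le_of_mul_le_mul_left h2 (by positivity)
  -- One shear that is good for both criteria, within a factor of two.
  obtain ⟨τ, hτ1, hτ2⟩ := exists_le_two_mul_lintegral (measurable_measure_prodMk_left hEm)
    (measurable_measure_prodMk_left hOm) (by positivity) (by positivity) hf hg
  obtain ⟨t, rfl⟩ := toTorus_surjective D τ
  obtain ⟨Λ, hΛ⟩ := exists_gen_eq (shearGen e t) (det_shearGen e t he0.ne')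
  refine ⟨Λ, isProbabilityMeasure_dither_shear he0 hΛ,
    norm_mod_sq_le_dim he0 (he'.trans (by norm_num)) hΛ,
    le_dim_mul_secondMoment he0 he' (by rw [hedef]; nlinarith) hΛ, ?_, fun s hs0 hss => ?_⟩
  · have h := dim_mul_secondMoment_le he0 (he'.trans (by norm_num)) hΛ hU2 (by positivity) hτ1
    refine h.trans (add_le_add ?_ (le_of_eq (by ring)))
    have : (b ^ 2 * (1 / 4)) ^ 2 = (1 + δ) / 16 := by rw [← hbδ]; ring
    rw [this]
    nlinarith
  · refine le_trans ?_ hτ2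
    rw [hμ, Measure.map_apply (by fun_prop) (measurable_prodMk_left hOm)]
    refine measure_mono fun x hx => ?_
    exact overload_shear he0 hΛ hs0 hss hx

/-- The parameters for which the random lattice is good. -/
theorem exists_shear_parameter {D : ℕ} {x δ : ℝ} (hx16 : 16 ≤ x) (hDn : (D : ℝ) = x ^ 4 - 1)
    (hδ : δ = 1 / x) (hexp' : Real.exp (-x) ≤ 1 / (1000 * x ^ 12)) :
    ∃ b : ℝ, 1 ≤ b ∧ b ^ 4 = 1 + δ ∧ 2 ≤ b ^ D ∧ (b ^ D)⁻¹ ≤ 1 / (1000 * x ^ 12) ∧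
      quarterBall D * b ^ D ≤ δ / 8 ∧ quarterBall D * b ^ D ≤ 1 / 10 := by
  have hx0 : 0 < x := by linarith
  have hx1 : 1 ≤ x := by linarith
  have hx2 : 256 ≤ x ^ 2 := by nlinarith
  have hx3 : 256 * x ≤ x ^ 3 := by nlinarith
  have hx4 : 256 * x ^ 2 ≤ x ^ 4 := by nlinarith
  have hδ0 : 0 < δ := by rw [hδ]; positivity
  have hδ16 : δ ≤ 1 / 16 := by rw [hδ]; gcongr
  have hδx1 : δ * x = 1 := by rw [hδ]; field_simp
  set b := (1 + δ) ^ (1 / 4 : ℝ) with hb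
  have hb1 : 1 ≤ b := Real.one_le_rpow (by linarith) (by norm_num)
  have hb4 : b ^ 4 = 1 + δ := by
    rw [hb, ← Real.rpow_natCast, ← Real.rpow_mul (by linarith)]; norm_num
  have hb54 : b ≤ 5 / 4 := by
    by_contra! h
    have := pow_lt_pow_left₀ h (by norm_num) (by norm_num : (4 : ℕ) ≠ 0)
    rw [hb4] at this
    norm_num at this
    linarith
  -- `log b ≥ δ / 8` and `D δ / 8 = (x ^ 3 - δ) / 8`, which is more than `x` for `x ≥ 16`.
  have hbD : Real.exp x ≤ b ^ D := by
    have h1 : δ / 2 ≤ Real.log (1 + δ) := by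
      refine le_trans ?_ (Real.one_sub_inv_le_log_of_pos (by linarith))
      have : (1 + δ)⁻¹ ≤ 1 - δ / 2 := by
        rw [inv_le_iff_one_le_mul₀ (by linarith)]
        nlinarith
      linarith
    have h2 : b ^ D = Real.exp (D * (Real.log (1 + δ) * (1 / 4))) := by
      rw [hb, Real.rpow_def_of_pos (by linarith), ← Real.exp_nat_mul]
    rw [h2]
    refine Real.exp_le_exp.mpr ?_
    have h3 : x ≤ D * (δ / 2 * (1 / 4)) := by
      have : D * (δ / 2 * (1 / 4)) = (x ^ 3 - δ) / 8 := by
        rw [hDn]; linear_combination (x ^ 3 / 8) * hδx1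
      rw [this]
      nlinarith
    refine h3.trans ?_
    gcongr
  have hbD0 : 0 < b ^ D := by positivity
  have hbinv : (b ^ D)⁻¹ ≤ 1 / (1000 * x ^ 12) := by
    refine le_trans ?_ hexp'
    rw [Real.exp_neg]
    exact inv_anti₀ (Real.exp_pos _) hbD
  have hbD2 : 2 ≤ b ^ D := by
    have := Real.add_one_le_exp x
    linarith
  have hx12 : 1 ≤ x ^ 12 := one_le_pow₀ hx1
  have hx11 : 1 ≤ x ^ 11 := one_le_pow₀ hx1
  have he : quarterBall D * b ^ D ≤ 1 / (1000 * x ^ 12) := by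
    refine le_trans ?_ hexp'
    have h1 : quarterBall D * b ^ D ≤ (1 / 2) ^ D * (5 / 4) ^ D :=
      mul_le_mul (quarterBall_le D) (pow_le_pow_left₀ (by linarith) hb54 D) hbD0.le (by positivity)
    refine h1.trans ?_
    rw [← mul_pow]
    have h2 : (1 / 2 : ℝ) * (5 / 4) ≤ Real.exp (-(3 / 8)) := by
      have := Real.add_one_le_exp (-(3 / 8) : ℝ)
      linarith
    refine (pow_le_pow_left₀ (by norm_num) h2 D).trans ?_
    rw [← Real.exp_nat_mul]
    refine Real.exp_le_exp.mpr ?_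
    rw [hDn]
    nlinarith
  have he1 : quarterBall D * b ^ D ≤ δ / 8 := by
    refine he.trans ?_
    have e1 : 1 / (1000 * x ^ 12) = 1 / 1000 * (δ * (x ^ 11)⁻¹) := by rw [hδ]; field_simp
    have := mul_le_mul_of_nonneg_left (inv_le_one_of_one_le₀ hx11) hδ0.le
    rw [e1]
    linarith
  have he2 : quarterBall D * b ^ D ≤ 1 / 10 := he1.trans (by linarith)
  exact ⟨b, hb1, hb4, hbD2, hbinv, he1, he2⟩

/-- Rescaling a good lattice to a given second moment. -/
theorem exists_rescaled {d : ℕ} {Pt δ s₀ η : ℝ} (hPt : 0 < Pt) (hδ0 : 0 < δ) (hδ : δ ≤ 1 / 4)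
    (hs₀0 : 0 ≤ s₀) (hs₀2 : 16 * d * (1 + δ) * s₀ ^ 2 = 1) (Λ : LatticeQuantizer d)
    [IsProbabilityMeasure Λ.dither] (hmod : ∀ x, ‖Λ.mod x‖ ^ 2 ≤ d)
    (hlow : 1 / 32 ≤ d * Λ.secondMoment) (hup : d * Λ.secondMoment ≤ (1 + 3 * δ) / 16)
    (hover : ∀ s, 0 ≤ s → s ≤ s₀ →
      stdGaussian (EuclideanSpace ℝ (Fin d)) {x | Λ.mod (s • x) ≠ s • x} ≤ ENNReal.ofReal η) :
    ∃ Λ' : LatticeQuantizer d, Λ'.secondMoment = Pt ∧ IsProbabilityMeasure Λ'.dither ∧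
      (∀ x, ‖Λ'.mod x‖ ^ 2 ≤ 32 * (d : ℝ) ^ 2 * Pt) ∧
      ∀ s, 0 ≤ s → s ^ 2 ≤ Pt * (1 - 4 * δ) →
        stdGaussian (EuclideanSpace ℝ (Fin d)) {x | Λ'.mod (s • x) ≠ s • x} ≤
          ENNReal.ofReal η := by
  have hn0 : (0 : ℝ) ≤ d := Nat.cast_nonneg d
  have hsm : 0 < Λ.secondMoment := pos_of_mul_pos_right (lt_of_lt_of_le (by norm_num) hlow) hn0
  set c := √(Pt / Λ.secondMoment) with hc
  have hc0 : 0 < c := Real.sqrt_pos.mpr (by positivity)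
  have hc2 : c ^ 2 = Pt / Λ.secondMoment := Real.sq_sqrt (by positivity)
  refine ⟨Λ.scale c hc0, ?_, ?_, fun y => ?_, fun s hs hsP => ?_⟩
  · rw [secondMoment_scale, hc2]; field_simp
  · rw [dither_scale]
    exact Measure.isProbabilityMeasure_map (by fun_prop)
  · rw [mod_scale, norm_smul, mul_pow, Real.norm_eq_abs, sq_abs, hc2]
    calc Pt / Λ.secondMoment * ‖Λ.mod (c⁻¹ • y)‖ ^ 2 ≤ Pt / Λ.secondMoment * d := by
          gcongr; exact hmod _
      _ = Pt * d / Λ.secondMoment := by ring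
      _ ≤ 32 * (d : ℝ) ^ 2 * Pt := by
          rw [div_le_iff₀ hsm]
          have := mul_le_mul_of_nonneg_left hlow (mul_nonneg hPt.le hn0)
          linarith
  -- The loss `4 δ` is chosen such that `(1 + 3 δ) (1 + δ) (1 - 4 δ) ≤ 1`: one factor from the
  -- second moment, one from the norm of the Gaussian vector.
  · have hcs : c⁻¹ * s ≤ s₀ := by
      refine (sq_le_sq₀ (by positivity) hs₀0).mp ?_
      have h1 : Λ.secondMoment / Pt * s ^ 2 ≤ Λ.secondMoment * (1 - 4 * δ) := by
        rw [div_mul_eq_mul_div, div_le_iff₀ hPt]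
        have := mul_le_mul_of_nonneg_left hsP hsm.le
        linarith
      have h2 : 0 ≤ 1 - 4 * δ := by linarith
      have h3 : 0 < 16 * d * (1 + δ) := by
        refine lt_of_le_of_ne (by positivity) fun h => ?_
        rw [← h, zero_mul] at hs₀2
        exact zero_ne_one hs₀2
      refine le_of_mul_le_mul_left ?_ h3
      rw [hs₀2, mul_pow, inv_pow, hc2, inv_div]
      calc 16 * d * (1 + δ) * (Λ.secondMoment / Pt * s ^ 2)
          ≤ 16 * d * (1 + δ) * (Λ.secondMoment * (1 - 4 * δ)) := by gcongr
        _ = d * Λ.secondMoment * (16 * (1 + δ) * (1 - 4 * δ)) := by ring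
        _ ≤ (1 + 3 * δ) / 16 * (16 * (1 + δ) * (1 - 4 * δ)) := by gcongr
        _ = 1 - (13 * δ ^ 2 + 12 * δ ^ 3) := by ring
        _ ≤ 1 := sub_le_self _ (by positivity)
    refine (measure_mono ?_).trans (hover (c⁻¹ * s) (by positivity) hcs)
    intro y hy h
    refine hy ?_
    rw [mod_scale, smul_smul, h, smul_smul, mul_inv_cancel_left₀ hc0.ne']

/-- The choice is `δ = d ^ (-1/4)`. All failure terms are exponentially small in `x = d ^ (1/4)`,
hence far below `d ^ (-3) = x ^ (-12)`. -/
theorem eventually_exists_good {Pt : ℝ} (hPt : 0 < Pt) : ∀ᶠ d : ℕ in atTop,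
    ∃ Λ : LatticeQuantizer d, Λ.secondMoment = Pt ∧ IsProbabilityMeasure Λ.dither ∧
      (∀ x, ‖Λ.mod x‖ ^ 2 ≤ 32 * (d : ℝ) ^ 2 * Pt) ∧
      ∀ s, 0 ≤ s → s ^ 2 ≤ Pt * (1 - 4 * (d : ℝ) ^ (-(1 / 4) : ℝ)) →
        stdGaussian (EuclideanSpace ℝ (Fin d)) {x | Λ.mod (s • x) ≠ s • x} ≤
          ENNReal.ofReal (((d : ℝ) ^ 3)⁻¹) := by
  have hx : Tendsto (fun d : ℕ => (d : ℝ) ^ (1 / 4 : ℝ)) atTop atTop :=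
    (tendsto_rpow_atTop (by norm_num)).comp tendsto_natCast_atTop_atTop
  have hexp := (Real.tendsto_pow_mul_exp_neg_atTop_nhds_zero 12).comp hx
  filter_upwards [hx.eventually_ge_atTop 16, eventually_ge_atTop 1,
    hexp.eventually_le_const (by norm_num : (0 : ℝ) < 1 / 1000)] with d hx16 hd1 hxe
  obtain ⟨D, rfl⟩ : ∃ D, d = D + 1 := ⟨d - 1, by omega⟩
  set n : ℝ := ((D + 1 : ℕ) : ℝ) with hn
  have hn0 : 0 < n := by rw [hn]; positivity
  set x := n ^ (1 / 4 : ℝ) with hxd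
  have hx0 : 0 < x := by linarith
  have hx4 : x ^ 4 = n := by
    rw [hxd, ← Real.rpow_natCast, ← Real.rpow_mul hn0.le]; norm_num
  have hDn : (D : ℝ) = x ^ 4 - 1 := by rw [hx4, hn]; push_cast; ring
  have hδx : n ^ (-(1 / 4) : ℝ) = 1 / x := by rw [Real.rpow_neg hn0.le, ← hxd, one_div]
  rw [hδx]
  set δ := 1 / x with hδ
  have hδ0 : 0 < δ := by positivity
  have hδ16 : δ ≤ 1 / 16 := by rw [hδ]; gcongr
  have hδx1 : δ * x = 1 := by rw [hδ]; field_simp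
  have hexp' : Real.exp (-x) ≤ 1 / (1000 * x ^ 12) := by
    rw [le_div_iff₀ (by positivity)]
    simp only [Function.comp_apply] at hxe
    change x ^ 12 * Real.exp (-x) ≤ 1 / 1000 at hxe
    linarith
  have hx1 : 1 ≤ x := by linarith
  have hx2 : 256 ≤ x ^ 2 := by nlinarith
  have hx3 : 4096 ≤ x ^ 3 := by nlinarith
  obtain ⟨b, hb1, hb4, hbD2, hbinv, he1, he2⟩ := exists_shear_parameter hx16 hDn hδ hexp'
  have hbD0 : 0 < b ^ D := by positivity
  set s₀ := √(1 / (16 * n * (1 + δ))) with hs₀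
  have hs₀2 : s₀ ^ 2 = 1 / (16 * n * (1 + δ)) := Real.sq_sqrt (by positivity)
  have hs₀0 : 0 < s₀ := Real.sqrt_pos.mpr (by positivity)
  obtain ⟨Λ, hprob, hmod, hlow, hup, hover⟩ := exists_good_shear hδ0 (by linarith) hb1 hb4 hbD2 he1
    he2 hs₀0 (by rw [hs₀2, ← hn]; field_simp)
  rw [← hn] at hmod hlow hup hover
  have hsm : 0 < Λ.secondMoment := pos_of_mul_pos_right (lt_of_lt_of_le (by norm_num) hlow) hn0.le
  have hup' : n * Λ.secondMoment ≤ (1 + 3 * δ) / 16 := by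
    refine hup.trans ?_
    have h1 : n * (16 / (δ * b ^ D)) = 16 * x ^ 5 * (b ^ D)⁻¹ := by
      rw [← hx4, hδ]; field_simp
    have h2 : 16 * x ^ 5 * (b ^ D)⁻¹ ≤ 16 * x ^ 5 * (1 / (1000 * x ^ 12)) := by gcongr
    have h3 : 16 * x ^ 5 * (1 / (1000 * x ^ 12)) ≤ δ / 16 := by
      have h6 : (x ^ 6)⁻¹ ≤ 1 := inv_le_one_of_one_le₀ (one_le_pow₀ hx1)
      have e1 : 16 * x ^ 5 * (1 / (1000 * x ^ 12)) = 16 / 1000 * (δ * (x ^ 6)⁻¹) := by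
        rw [hδ]; field_simp
      rw [e1]
      have := mul_le_mul_of_nonneg_left h6 hδ0.le
      linarith
    rw [h1]
    linarith
  refine exists_rescaled hPt hδ0 (by linarith) hs₀0.le (by rw [hs₀2, ← hn]; field_simp) Λ hmod hlow hup'
    fun s hs hss => (hover s hs hss).trans (ENNReal.ofReal_le_ofReal ?_)
  have h1 : Real.exp (-(n * δ ^ 2 / 16)) ≤ 1 / (1000 * x ^ 12) := by
    refine le_trans (Real.exp_le_exp.mpr ?_) hexp'
    have : n * δ ^ 2 / 16 = x ^ 2 / 16 := by rw [← hx4, hδ]; field_simp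
    rw [this]
    nlinarith
  have h2 : (n ^ 3)⁻¹ = 1 / x ^ 12 := by rw [← hx4]; field_simp
  have h3 : 1 / (1000 * x ^ 12) = 1 / x ^ 12 / 1000 := by field_simp
  have h4 : 0 < 1 / x ^ 12 := by positivity
  rw [h2]
  linarith

end LatticeQuantizer

/-! ### Dynamics of the modulo-lattice scheme -/

namespace LFC

variable {N : ℕ} {m : Fin 2 → ℕ} (L : LFC N m)

theorem feedback_add (i : Fin 2) (n : Fin N) (y y' : {k : Fin N // k < n} → ℝ) :
    L.feedback i n (fun k => y k + y' k) = L.feedback i n y + L.feedback i n y' := by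
  simp only [feedback, mul_add, Finset.sum_add_distrib]

theorem input_def (w : ∀ i, Fin (m i)) (u : ℝ) (z : Fin N → EuclideanSpace ℝ (Fin 2))
    (n : Fin N) : L.input w u z n =
      L.codebook n w u - ∑ i, L.feedback i n fun k => L.input w u z k.1 + z k.1 i := by
  rw [input]

theorem codebookBar_def (w : ∀ i, Fin (m i)) (u : ℝ) (n : Fin N) : L.codebookBar n w u =
    L.codebook n w u - ∑ i, L.feedback i n fun k => L.codebookBar k.1 w u := by
  rw [codebookBar, input_def]
  simp [codebookBar]

/-- The part of the input that is due to the noise. -/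
def noiseInput (w : ∀ i, Fin (m i)) (u : ℝ) (z : Fin N → EuclideanSpace ℝ (Fin 2)) (n : Fin N) :
    ℝ := L.input w u z n - L.codebookBar n w u

/-- The input is affine in the noise, and its noise part obeys the feedback recursion without
codebook. -/
theorem noiseInput_eq (w : ∀ i, Fin (m i)) (u : ℝ) (z : Fin N → EuclideanSpace ℝ (Fin 2))
    (n : Fin N) : L.noiseInput w u z n =
      -∑ i, L.feedback i n fun k => L.noiseInput w u z k.1 + z k.1 i := by
  have h (i : Fin 2) : L.feedback i n (fun k => L.input w u z k.1 + z k.1 i) =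
      L.feedback i n (fun k => L.noiseInput w u z k.1 + z k.1 i) +
        L.feedback i n (fun k => L.codebookBar k.1 w u) := by
    rw [← feedback_add]
    congr 1
    ext k
    simp only [noiseInput]
    ring
  rw [noiseInput, input_def, codebookBar_def]
  simp only [h, Finset.sum_add_distrib]
  ring

theorem feedback_of_val_eq_zero (i : Fin 2) {n : Fin N} (hn : n.val = 0)
    (y : {k : Fin N // k < n} → ℝ) : L.feedback i n y = 0 := by
  have : IsEmpty {k : Fin N // k < n} := ⟨fun k => by have : k.1.val < n.val := k.2; omega⟩
  simp [feedback]

theorem measurable_feedback {Ω : Type*} [MeasurableSpace Ω] (i : Fin 2) (n : Fin N)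
    {y : {k : Fin N // k < n} → Ω → ℝ} (hy : ∀ k, Measurable (y k)) :
    Measurable fun ω => L.feedback i n fun k => y k ω := by
  unfold feedback
  exact Finset.measurable_sum _ fun k _ => (hy k).const_mul _

theorem measurable_codebookBar (hL : ∀ n w, Measurable (L.codebook n w)) (n : Fin N)
    (w : ∀ i, Fin (m i)) : Measurable (L.codebookBar n w) := by
  induction n using WellFoundedLT.induction with
  | ind n ih =>
    have : L.codebookBar n w = fun u => L.codebook n w u -
        ∑ i, L.feedback i n fun k => L.codebookBar k.1 w u := funext fun u => L.codebookBar_def w u n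
    rw [this]
    exact (hL n w).sub (Finset.measurable_sum _ fun i _ =>
      L.measurable_feedback i n fun k => ih k.1 k.2)

/-- What the modulo-lattice scheme adds to the codebook element of step `n`, as a function of the
noise `z` of the broadcast channel and the noise `zt` of the feedback channel. -/
def latticeInput {d : ℕ} (Λ : LatticeQuantizer d) (γ : ℝ)
    (z : Fin N → Fin d → EuclideanSpace ℝ (Fin 2)) (zt : Fin N → EuclideanSpace ℝ (Fin d))
    (n : Fin N) : EuclideanSpace ℝ (Fin d) :=
  if n.val = 0 then 0
  else γ⁻¹ • Λ.mod (-(γ • WithLp.toLp 2 fun j => ∑ i, L.feedback i n fun k =>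
    latticeInput Λ γ z zt k.1 j + z k.1 j i) - zt n)
termination_by n.val
decreasing_by exact k.2

variable {d : ℕ} (Λ : LatticeQuantizer d) (γ : ℝ)

theorem latticeInput_zero (z : Fin N → Fin d → EuclideanSpace ℝ (Fin 2))
    (zt : Fin N → EuclideanSpace ℝ (Fin d)) {n : Fin N} (hn : n.val = 0) :
    L.latticeInput Λ γ z zt n = 0 := by
  rw [latticeInput, if_pos hn]

theorem latticeInput_def (z : Fin N → Fin d → EuclideanSpace ℝ (Fin 2))
    (zt : Fin N → EuclideanSpace ℝ (Fin d)) {n : Fin N} (hn : n.val ≠ 0) :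
    L.latticeInput Λ γ z zt n = γ⁻¹ • Λ.mod (-(γ • WithLp.toLp 2 fun j => ∑ i, L.feedback i n
      fun k => L.latticeInput Λ γ z zt k.1 j + z k.1 j i) - zt n) := by
  rw [latticeInput, if_neg hn]

theorem measurable_latticeInput (n : Fin N) :
    Measurable fun x : (Fin N → Fin d → EuclideanSpace ℝ (Fin 2)) ×
      (Fin N → EuclideanSpace ℝ (Fin d)) => L.latticeInput Λ γ x.1 x.2 n := by
  induction n using WellFoundedLT.induction with
  | ind n ih =>
    by_cases hn : n.val = 0
    · simp only [L.latticeInput_zero Λ γ _ _ hn]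
      exact measurable_const
    · simp only [L.latticeInput_def Λ γ _ _ hn]
      refine (Λ.measurable_mod.comp (Measurable.sub (Measurable.neg (Measurable.const_smul
        ((WithLp.measurable_toLp 2 _).comp (measurable_pi_lambda _ fun j =>
          Finset.measurable_sum _ fun i _ => L.measurable_feedback i n fun k => ?_)) γ)) ?_)).const_smul γ⁻¹
      · have := ih k.1 k.2
        fun_prop
      · fun_prop

/-- The equivalent noise of the broadcast channel for the instance `j`. -/
def equivNoise (z : Fin N → Fin d → EuclideanSpace ℝ (Fin 2))
    (zt : Fin N → EuclideanSpace ℝ (Fin d)) (j : Fin d) (n : Fin N) : EuclideanSpace ℝ (Fin 2) :=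
  WithLp.toLp 2 fun i => z n j i - if n.val = 0 then 0 else γ⁻¹ * zt n j

/-- The argument of the modulo operation of step `n` as long as there was no overload. -/
def linearArg (w : ∀ i, Fin (m i)) (u : ℝ) (z : Fin N → Fin d → EuclideanSpace ℝ (Fin 2))
    (zt : Fin N → EuclideanSpace ℝ (Fin d)) (n : Fin N) : EuclideanSpace ℝ (Fin d) :=
  WithLp.toLp 2 fun j => γ * L.noiseInput w u (equivNoise γ z zt j) n - zt n j

variable {γ} (hγ : γ ≠ 0)
include hγ

/-- By strong induction: without earlier overloads, what was added in step `k` is the noise input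
minus `γ⁻¹` times the feedback noise. Moving the latter into the channel noise turns the lattice
recursion into that of the noiseless code over the equivalent channel. -/
theorem latticeInput_eq (w : ∀ i, Fin (m i)) (u : ℝ)
    (z : Fin N → Fin d → EuclideanSpace ℝ (Fin 2)) (zt : Fin N → EuclideanSpace ℝ (Fin d))
    {n : Fin N} (hn : n.val ≠ 0)
    (h : ∀ k < n, k.val ≠ 0 → Λ.mod (L.linearArg γ w u z zt k) = L.linearArg γ w u z zt k) :
    L.latticeInput Λ γ z zt n = γ⁻¹ • Λ.mod (L.linearArg γ w u z zt n) := by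
  induction n using WellFoundedLT.induction with
  | ind n ih =>
    have key : ∀ k < n, ∀ j i, L.latticeInput Λ γ z zt k j + z k j i =
        L.noiseInput w u (equivNoise γ z zt j) k + equivNoise γ z zt j k i := by
      intro k hk j i
      -- Step `0` uses no feedback, so its equivalent noise is the plain channel noise.
      by_cases hk0 : k.val = 0
      · rw [latticeInput_zero (hn := hk0), noiseInput_eq]
        simp [feedback_of_val_eq_zero (hn := hk0), equivNoise, hk0]
      · rw [ih k hk hk0 fun l hl => h l (hl.trans hk), h k hk hk0]
        simp only [linearArg, equivNoise, PiLp.smul_apply, smul_eq_mul, hk0, if_false]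
        field_simp
        ring
    rw [latticeInput_def (hn := hn)]
    congr 2
    ext j
    simp only [linearArg, PiLp.sub_apply, PiLp.neg_apply, PiLp.smul_apply, smul_eq_mul]
    rw [noiseInput_eq]
    have : ∀ i, (L.feedback i n fun k => L.latticeInput Λ γ z zt k.1 j + z k.1 j i) =
        L.feedback i n fun k => L.noiseInput w u (equivNoise γ z zt j) k.1 +
          equivNoise γ z zt j k.1 i := fun i => by
      congr 1; ext k; exact key k.1 k.2 j i
    simp only [this]
    ring

/-- Without overload, the outputs are those of the code over the equivalent channel. -/
theorem codebookBar_add_latticeInput (w : ∀ i, Fin (m i)) (u : ℝ)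
    (z : Fin N → Fin d → EuclideanSpace ℝ (Fin 2)) (zt : Fin N → EuclideanSpace ℝ (Fin d))
    (h : ∀ k, k.val ≠ 0 → Λ.mod (L.linearArg γ w u z zt k) = L.linearArg γ w u z zt k)
    (w' : ∀ i, Fin (m i)) (u' : ℝ) (j : Fin d)
    (hw : ∀ n, L.noiseInput w' u' (equivNoise γ z zt j) n =
      L.noiseInput w u (equivNoise γ z zt j) n) (n : Fin N) (i : Fin 2) :
    L.codebookBar n w' u' + L.latticeInput Λ γ z zt n j + z n j i =
      L.output w' u' (equivNoise γ z zt j) i n := by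
  have e : L.output w' u' (equivNoise γ z zt j) i n = L.codebookBar n w' u' +
      L.noiseInput w u (equivNoise γ z zt j) n + equivNoise γ z zt j n i := by
    rw [← hw, noiseInput, output]; ring
  rw [e]
  by_cases hn0 : n.val = 0
  · rw [latticeInput_zero (hn := hn0), noiseInput_eq]
    simp [feedback_of_val_eq_zero (hn := hn0), equivNoise, hn0]
  · rw [L.latticeInput_eq Λ hγ w u z zt hn0 fun k _ => h k, h n hn0]
    simp only [linearArg, equivNoise, PiLp.smul_apply, smul_eq_mul, hn0, if_false]
    field_simp
    ring

end LFC

/-! ### Rounds and blocks -/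

theorem extendZero_apply {N : ℕ} {s : Set (Fin N)} (f : Fin N → ℝ) (k : Fin N) (hk : k ∈ s) :
    extendZero (fun x : s => f x.1) k.val = f k := by
  rw [extendZero, dif_pos ⟨k.isLt, hk⟩]

theorem measurable_extendZero {N : ℕ} {s : Set (Fin N)} (k : ℕ) :
    Measurable fun y : s → ℝ => extendZero y k := by
  unfold extendZero
  by_cases h : ∃ hk : k < N, (⟨k, hk⟩ : Fin N) ∈ s
  · simp only [h, dite_true]
    exact measurable_pi_apply _
  · simp only [h, dite_false]
    exact measurable_const

section slots

variable {NC d N : ℕ} (hN : 2 * NC * d ≤ N)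

theorem block_lt {b j : ℕ} (hN : 2 * NC * d ≤ N) (hb : b < 2 * NC) (hj : j < d) :
    b * d + j < N := by
  have h1 : (b + 1) * d ≤ 2 * NC * d := Nat.mul_le_mul_right d hb
  rw [Nat.add_mul, Nat.one_mul] at h1
  omega

/-- The round in which step `n` of the instance at position `j` with parity `p` is sent. -/
def slot (n : Fin NC) (p : Fin 2) (j : Fin d) : Fin N :=
  ⟨(2 * n.val + p.val) * d + j.val, block_lt hN (by omega) j.isLt⟩

/-- The round in which the feedback for step `n` is sent. -/
def fbSlot (n : Fin NC) (p : Fin 2) (j : Fin d) : Fin N :=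
  ⟨(2 * n.val + p.val - 1) * d + j.val, block_lt hN (by omega) j.isLt⟩

theorem block_injective {b b' j j' : ℕ} (hj : j < d) (hj' : j' < d)
    (h : b * d + j = b' * d + j') : b = b' ∧ j = j' := by
  have hd : 0 < d := by omega
  have h1 : (b * d + j) / d = (b' * d + j') / d := by rw [h]
  have h2 : (b * d + j) % d = (b' * d + j') % d := by rw [h]
  rw [mul_comm b, mul_comm b', Nat.mul_add_div hd, Nat.mul_add_div hd, Nat.div_eq_of_lt hj,
    Nat.div_eq_of_lt hj'] at h1
  rw [mul_comm b, mul_comm b', Nat.mul_add_mod, Nat.mul_add_mod, Nat.mod_eq_of_lt hj,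
    Nat.mod_eq_of_lt hj'] at h2
  exact ⟨by omega, h2⟩

theorem slot_injective (p : Fin 2) :
    Function.Injective fun x : Fin d × Fin NC => slot hN x.2 p x.1 := by
  rintro ⟨j, n⟩ ⟨j', n'⟩ h
  obtain ⟨h1, h2⟩ := block_injective j.isLt j'.isLt (Fin.mk.inj h)
  exact Prod.ext (Fin.ext h2) (Fin.ext (by omega))

/-- For `n = 0` and `p = 0` the truncated subtraction gives block `0`. No feedback is sent there,
but the block differs from `1, 3, …`, so injectivity survives. -/
theorem fbSlot_injective (p : Fin 2) :
    Function.Injective fun x : Fin d × Fin NC => fbSlot hN x.2 p x.1 := by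
  rintro ⟨j, n⟩ ⟨j', n'⟩ h
  obtain ⟨h1, h2⟩ := block_injective j.isLt j'.isLt (Fin.mk.inj h)
  refine Prod.ext (Fin.ext h2) (Fin.ext ?_)
  change n.val = n'.val
  simp only at h1
  omega

theorem div_block {b j : ℕ} (hj : j < d) : (b * d + j) / d = b := by
  rw [mul_comm, Nat.mul_add_div (by omega), Nat.div_eq_of_lt hj, add_zero]

theorem mod_block {b j : ℕ} (hj : j < d) : (b * d + j) % d = j := by
  rw [mul_comm, Nat.mul_add_mod, Nat.mod_eq_of_lt hj]

theorem div_two_mul_block {n p j : ℕ} (hp : p < 2) (hj : j < d) :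
    ((2 * n + p) * d + j) / (2 * d) = n := by
  rw [mul_comm 2 d, ← Nat.div_div_eq_div_mul, div_block hj]
  omega

end slots

namespace LFC

variable {NC : ℕ} {m : Fin 2 → ℕ} (L : LFC NC m) {d : ℕ} (hd : 0 < d) (Λ : LatticeQuantizer d)
  (γ : ℝ) {N : ℕ} (hN : 2 * NC * d ≤ N)

/-- The noise of the broadcast channel, sorted by step and position. -/
def blockNoise (p : Fin 2) (z : Fin N → EuclideanSpace ℝ (Fin 2)) (n : Fin NC) (j : Fin d) :
    EuclideanSpace ℝ (Fin 2) := z (slot hN n p j)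

/-- The noise of the feedback channel, sorted by step and position. -/
def fbBlockNoise (p : Fin 2) (zt : Fin N → ℝ) (n : Fin NC) : EuclideanSpace ℝ (Fin d) :=
  WithLp.toLp 2 fun j => zt (fbSlot hN n p j)

/-- What the modulo-lattice scheme adds to the codebook elements. -/
def slotInput (p : Fin 2) (z : Fin N → EuclideanSpace ℝ (Fin 2)) (zt : Fin N → ℝ) (n : Fin NC) :
    EuclideanSpace ℝ (Fin d) :=
  L.latticeInput Λ γ (blockNoise hN p z) (fbBlockNoise hN p zt) n

/-- The feedback elements of one block, for the modulo-lattice scheme. -/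
def slotFeedback (i : Fin 2) (p : Fin 2) (w : ∀ i, Fin d × Fin 2 → Fin (m i))
    (u : Fin d × Fin 2 → ℝ) (z : Fin N → EuclideanSpace ℝ (Fin 2)) (zt : Fin N → ℝ) (n : Fin NC) :
    EuclideanSpace ℝ (Fin d) :=
  WithLp.toLp 2 fun j => L.feedback i n fun k =>
    L.codebookBar k.1 (fun i => w i (j, p)) (u (j, p)) + L.slotInput Λ γ hN p z zt k.1 j +
      z (slot hN k.1 p j) i

variable {γ} (w : ∀ i, Fin d × Fin 2 → Fin (m i)) (q : MLRandomness NC d)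
  (z : Fin N → EuclideanSpace ℝ (Fin 2)) (zt : Fin N → ℝ)

theorem fb_mlScheme {i : Fin 2} {t : Fin N} {n : Fin NC} {p : Fin 2} {j : Fin d}
    (hn : (t.val / d + 1) / 2 = n.val) (hp : (t.val / d + 1) % 2 = p.val) (hj : t.val % d = j.val)
    (h0 : n.val ≠ 0) (y : Set.Iic t → ℝ) :
    (mlScheme L hd Λ (fun _ => γ) N).fb i t q y =
      Λ.mod (γ • (WithLp.toLp 2 fun j => L.feedback i n fun k =>
        extendZero y ((2 * k.1.val + p.val) * d + j.val)) + q.1 (i, n, p)) j := by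
  obtain ⟨n, hnl⟩ := n
  obtain ⟨p, hpl⟩ := p
  obtain ⟨j, hjl⟩ := j
  simp only at hn hp hj h0
  subst hn hp hj
  simp only [mlScheme, dif_pos hnl, if_neg h0]

theorem enc_mlScheme {t : Fin N} {n : Fin NC} {p : Fin 2} {j : Fin d}
    (hn : t.val / (2 * d) = n.val) (hp : t.val / d % 2 = p.val) (hj : t.val % d = j.val)
    (y : Set.Iio t → ℝ) :
    (mlScheme L hd Λ (fun _ => γ) N).enc t w q y =
      if n.val = 0 then L.codebook n (fun i => w i (j, p)) (q.2 (j, p)) else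
      γ⁻¹ * Λ.mod (γ • (WithLp.toLp 2 fun j => L.codebook n (fun i => w i (j, p)) (q.2 (j, p))) -
        ((WithLp.toLp 2 fun j : Fin d => extendZero y ((2 * n.val + p.val - 1) * d + j.val)) -
          ∑ i, q.1 (i, n, p)) -
        γ • (WithLp.toLp 2 fun j => L.codebookBar n (fun i => w i (j, p)) (q.2 (j, p)))) j +
      L.codebookBar n (fun i => w i (j, p)) (q.2 (j, p)) := by
  obtain ⟨n, hnl⟩ := n
  obtain ⟨p, hpl⟩ := p
  obtain ⟨j, hjl⟩ := j
  simp only at hn hp hj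
  subst hn hp hj
  simp only [mlScheme, dif_pos hnl]

/-- The inputs of the earlier steps are a hypothesis because the lemma serves inside the induction
for `input_slot`. -/
theorem fbInput_fbSlot_of_input (i : Fin 2) (p : Fin 2) (n : Fin NC) (hn : n.val ≠ 0) (j : Fin d)
    (h : ∀ k < n, ∀ j, (mlScheme L hd Λ (fun _ => γ) N).input w q z zt (slot hN k p j) =
      L.codebookBar k (fun i => w i (j, p)) (q.2 (j, p)) + L.slotInput Λ γ hN p z zt k j) :
    (mlScheme L hd Λ (fun _ => γ) N).fbInput w q z zt i (fbSlot hN n p j) =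
      Λ.mod (γ • L.slotFeedback Λ γ hN i p w q.2 z zt n + q.1 (i, n, p)) j := by
  have hb : (fbSlot hN n p j).val / d = 2 * n.val + p.val - 1 := div_block j.isLt
  have hn' : ((fbSlot hN n p j).val / d + 1) / 2 = n.val := by rw [hb]; omega
  have hp' : ((fbSlot hN n p j).val / d + 1) % 2 = p.val := by rw [hb]; omega
  have hj' : (fbSlot hN n p j).val % d = j.val := mod_block j.isLt
  have hF : (WithLp.toLp 2 fun j' : Fin d => L.feedback i n fun k =>
      extendZero (fun s : Set.Iic (fbSlot hN n p j) =>
        (mlScheme L hd Λ (fun _ => γ) N).bcOutput w q z zt i s.1)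
          ((2 * k.1.val + p.val) * d + j'.val)) = L.slotFeedback Λ γ hN i p w q.2 z zt n := by
    rw [slotFeedback]
    refine congrArg (WithLp.toLp 2) (funext fun j' => congrArg (L.feedback i n) (funext fun k => ?_))
    have hk : k.1.val < n.val := k.2
    -- The whole block of step `k < n` is over before the feedback block of step `n` begins. The
    -- free block in between is the reason for interleaving two parities.
    have hle : slot hN k.1 p j' ≤ fbSlot hN n p j := by
      rw [Fin.le_def]
      simp only [slot, fbSlot]
      have h1 : (2 * k.1.val + p.val + 1) * d ≤ (2 * n.val + p.val - 1) * d :=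
        Nat.mul_le_mul_right d (by omega)
      rw [Nat.add_mul (2 * k.1.val + p.val)] at h1
      have := j'.isLt
      omega
    have := extendZero_apply (s := Set.Iic (fbSlot hN n p j))
      (fun s => (mlScheme L hd Λ (fun _ => γ) N).bcOutput w q z zt i s) (slot hN k.1 p j') hle
    refine this.trans ?_
    rw [MacScheme.bcOutput, h k.1 k.2 j']
  rw [MacScheme.fbInput, L.fb_mlScheme hd Λ q hn' hp' hj' hn, hF]

/-- The inputs of the modulo-lattice scheme: the dithers cancel. -/
theorem input_slot (p : Fin 2) (n : Fin NC) (j : Fin d) :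
    (mlScheme L hd Λ (fun _ => γ) N).input w q z zt (slot hN n p j) =
      L.codebookBar n (fun i => w i (j, p)) (q.2 (j, p)) + L.slotInput Λ γ hN p z zt n j := by
  induction n using WellFoundedLT.induction generalizing j with
  | ind n ih =>
    have hn' : (slot hN n p j).val / (2 * d) = n.val := div_two_mul_block p.isLt j.isLt
    have hp' : ((slot hN n p j).val / d) % 2 = p.val := by
      rw [show (slot hN n p j).val / d = 2 * n.val + p.val from div_block j.isLt]; omega
    have hj' : (slot hN n p j).val % d = j.val := mod_block j.isLt
    rw [MacScheme.input, L.enc_mlScheme hd Λ w q hn' hp' hj']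
    by_cases hn : n.val = 0
    · rw [if_pos hn, slotInput, latticeInput_zero (hn := hn), codebookBar_def]
      simp [feedback_of_val_eq_zero (hn := hn)]
    · rw [if_neg hn, add_comm]
      congr 1
      have hy : (WithLp.toLp 2 fun j' : Fin d => extendZero
          (fun k : Set.Iio (slot hN n p j) => (mlScheme L hd Λ (fun _ => γ) N).macOutput w q z zt k.1)
            ((2 * n.val + p.val - 1) * d + j'.val)) =
          (∑ i, Λ.mod (γ • L.slotFeedback Λ γ hN i p w q.2 z zt n + q.1 (i, n, p))) +
            fbBlockNoise hN p zt n := by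
        ext j'
        -- The feedback for step `n` is sent in the block just before, so Terminal A has the
        -- complete vector.
        have hlt : fbSlot hN n p j' < slot hN n p j := by
          rw [Fin.lt_def]
          simp only [slot, fbSlot]
          have h1 : (2 * n.val + p.val - 1 + 1) * d ≤ (2 * n.val + p.val) * d :=
            Nat.mul_le_mul_right d (by omega)
          rw [Nat.add_mul _ 1] at h1
          have := j'.isLt
          omega
        have := extendZero_apply (s := Set.Iio (slot hN n p j))
          (fun s => (mlScheme L hd Λ (fun _ => γ) N).macOutput w q z zt s) (fbSlot hN n p j') hlt
        refine this.trans ?_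
        rw [MacScheme.macOutput_eq,
          L.fbInput_fbSlot_of_input hd Λ hN w q z zt 0 p n hn j' fun k hk j => ih k hk j,
          L.fbInput_fbSlot_of_input hd Λ hN w q z zt 1 p n hn j' fun k hk j => ih k hk j]
        simp [fbBlockNoise, Fin.sum_univ_two]
      rw [hy, slotInput, latticeInput_def (hn := hn), PiLp.smul_apply, smul_eq_mul]
      refine congrArg (fun v : EuclideanSpace ℝ (Fin d) => γ⁻¹ * v j) ?_
      -- Inner residues may be replaced by their arguments under the outer modulo operation, and
      -- then the dithers cancel.
      have hmm (x a b v v' : EuclideanSpace ℝ (Fin d)) :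
          Λ.mod (x - (Λ.mod (a + v) + Λ.mod (b + v') - (v + v'))) = Λ.mod (x - (a + b)) := by
        have h1 : x - (Λ.mod (a + v) + Λ.mod (b + v') - (v + v')) =
          (x + (v + v') - Λ.mod (a + v)) - Λ.mod (b + v') := by abel
        rw [h1, Λ.mod_sub_mod]
        have h2 : x + (v + v') - Λ.mod (a + v) - (b + v') = x + v - b - Λ.mod (a + v) := by abel
        rw [h2, Λ.mod_sub_mod]
        congr 1; abel
      rw [Fin.sum_univ_two, Fin.sum_univ_two]
      have h3 (θ θb F0 F1 m0 m1 ζ v0 v1 : EuclideanSpace ℝ (Fin d)) :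
          θ - (m0 + m1 + ζ - (v0 + v1)) - θb = (θ - θb - ζ) - (m0 + m1 - (v0 + v1)) := by abel
      rw [h3 _ _ 0 0, hmm]
      congr 1
      ext j'
      -- The difference of the two codebooks is the feedback of the noise-free outputs; it cancels
      -- the deterministic part of the feedback elements.
      simp only [slotFeedback, PiLp.sub_apply, PiLp.add_apply, PiLp.neg_apply, PiLp.smul_apply,
        smul_eq_mul, codebookBar_def L _ _ n]
      have h4 (i : Fin 2) : (L.feedback i n fun k =>
          L.codebookBar k.1 (fun i => w i (j', p)) (q.2 (j', p)) +
            L.slotInput Λ γ hN p z zt k.1 j' + z (slot hN k.1 p j') i) =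
          (L.feedback i n fun k => L.codebookBar k.1 (fun i => w i (j', p)) (q.2 (j', p))) +
          (L.feedback i n fun k => L.latticeInput Λ γ (blockNoise hN p z) (fbBlockNoise hN p zt)
            k.1 j' + blockNoise hN p z k.1 j' i) := by
        rw [← feedback_add]
        refine congrArg (L.feedback i n) (funext fun k => ?_)
        simp only [slotInput, blockNoise]; ring
      simp only [h4, Fin.sum_univ_two]
      ring

theorem fbInput_fbSlot (i : Fin 2) (p : Fin 2) (n : Fin NC) (hn : n.val ≠ 0) (j : Fin d) :
    (mlScheme L hd Λ (fun _ => γ) N).fbInput w q z zt i (fbSlot hN n p j) =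
      Λ.mod (γ • L.slotFeedback Λ γ hN i p w q.2 z zt n + q.1 (i, n, p)) j :=
  L.fbInput_fbSlot_of_input hd Λ hN w q z zt i p n hn j fun k _ j =>
    L.input_slot hd Λ hN w q z zt p k j

theorem input_of_le (t : Fin N) (ht : 2 * NC * d ≤ t.val) :
    (mlScheme L hd Λ (fun _ => γ) N).input w q z zt t = 0 := by
  have : ¬ t.val / (2 * d) < NC := by
    rw [not_lt, Nat.le_div_iff_mul_le (by omega)]
    calc NC * (2 * d) = 2 * NC * d := by ring
      _ ≤ _ := ht
  simp only [MacScheme.input, mlScheme, this, dite_false]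

theorem fbInput_eq_zero (i : Fin 2) (t : Fin N)
    (ht : (t.val / d + 1) / 2 = 0 ∨ NC ≤ (t.val / d + 1) / 2) :
    (mlScheme L hd Λ (fun _ => γ) N).fbInput w q z zt i t = 0 := by
  simp only [MacScheme.fbInput, mlScheme]
  rcases ht with h | h
  · split_ifs <;> rfl
  · rw [dif_neg (not_lt.mpr h)]

/-! ### Measurability -/

theorem isMeasurable_mlScheme (hL : ∀ n w, Measurable (L.codebook n w)) :
    (mlScheme L hd Λ (fun _ => γ) N).IsMeasurable := by
  have hq2 (j : Fin d) (p : Fin 2) {E : Type} [MeasurableSpace E] :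
      Measurable fun x : MLRandomness NC d × E => x.1.2 (j, p) := by fun_prop
  have hq1 (a : Fin 2 × Fin NC × Fin 2) {E : Type} [MeasurableSpace E] :
      Measurable fun x : MLRandomness NC d × E => x.1.1 a := by fun_prop
  have htoLp {Ω : Type} [MeasurableSpace Ω] {f : Fin d → Ω → ℝ} (hf : ∀ j, Measurable (f j)) :
      Measurable fun ω => (WithLp.toLp 2 fun j => f j ω : EuclideanSpace ℝ (Fin d)) :=
    (WithLp.measurable_toLp 2 _).comp (measurable_pi_lambda _ hf)
  have happ {Ω : Type} [MeasurableSpace Ω] {f : Ω → EuclideanSpace ℝ (Fin d)} (hf : Measurable f)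
      (j : Fin d) : Measurable fun ω => f ω j := by fun_prop
  have hcb (n : Fin NC) (w : ∀ i, Fin d × Fin 2 → Fin (m i)) (j : Fin d) (p : Fin 2) {E : Type}
      [MeasurableSpace E] : Measurable fun x : MLRandomness NC d × E =>
        L.codebook n (fun i => w i (j, p)) (x.1.2 (j, p)) := (hL _ _).comp (hq2 j p)
  have hcb' (n : Fin NC) (w : ∀ i, Fin d × Fin 2 → Fin (m i)) (j : Fin d) (p : Fin 2) {E : Type}
      [MeasurableSpace E] : Measurable fun x : MLRandomness NC d × E =>
        L.codebookBar n (fun i => w i (j, p)) (x.1.2 (j, p)) :=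
    (L.measurable_codebookBar hL _ _).comp (hq2 j p)
  constructor
  · intro t w
    by_cases hn : t.val / (2 * d) < NC
    · have h := fun (q : MLRandomness NC d) y => L.enc_mlScheme hd Λ (γ := γ) (N := N) w q
        (t := t) (n := ⟨_, hn⟩) (p := ⟨_, Nat.mod_lt _ two_pos⟩) (j := ⟨_, Nat.mod_lt _ hd⟩)
        rfl rfl rfl y
      simp only [h]
      by_cases h0 : t.val / (2 * d) = 0
      · simp only [h0, if_true]
        exact hcb _ w _ _
      · simp only [h0, if_false]
        refine ((happ (Λ.measurable_mod.comp ?_) _).const_mul _).add (hcb' _ w _ _)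
        refine ((htoLp fun j => hcb _ w j _).const_smul γ |>.sub
          ((htoLp fun j => (measurable_extendZero _).comp measurable_snd).sub
            (Finset.measurable_sum _ fun i _ => hq1 _))).sub
          ((htoLp fun j => hcb' _ w j _).const_smul γ)
    · simp only [mlScheme, hn, dite_false]
      exact measurable_const
  · intro i t
    by_cases hn : (t.val / d + 1) / 2 < NC
    · by_cases h0 : (t.val / d + 1) / 2 = 0
      · simp only [mlScheme, h0, if_true, dite_eq_ite, ite_self]
        exact measurable_const
      · have h := fun (q : MLRandomness NC d) y => L.fb_mlScheme hd Λ (γ := γ) (N := N) q (i := i)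
          (t := t) (n := ⟨_, hn⟩) (p := ⟨_, Nat.mod_lt _ two_pos⟩) (j := ⟨_, Nat.mod_lt _ hd⟩)
          rfl rfl rfl h0 y
        simp only [h]
        refine happ (Λ.measurable_mod.comp (((htoLp fun j => L.measurable_feedback i _
          fun k => (measurable_extendZero _).comp measurable_snd).const_smul γ).add (hq1 _))) _
    · simp only [mlScheme, hn, dite_false]
      exact measurable_const

theorem measurable_slotInput (p : Fin 2) (n : Fin NC) :
    Measurable fun x : (Fin N → EuclideanSpace ℝ (Fin 2)) × (Fin N → ℝ) =>
      L.slotInput Λ γ hN p x.1 x.2 n := by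
  refine (L.measurable_latticeInput Λ γ n).comp (Measurable.prodMk ?_ ?_)
  · exact measurable_pi_lambda _ fun n => measurable_pi_lambda _ fun j => by
      change Measurable fun c : (Fin N → EuclideanSpace ℝ (Fin 2)) × (Fin N → ℝ) => c.1 (slot hN n p j)
      fun_prop
  · refine measurable_pi_lambda _ fun n => (WithLp.measurable_toLp 2 _).comp
      (measurable_pi_lambda _ fun j => ?_)
    fun_prop

theorem measurable_slotFeedback (hL : ∀ n w, Measurable (L.codebook n w)) (i p : Fin 2)
    (n : Fin NC) : Measurable fun x : (Fin d × Fin 2 → ℝ) ×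
      ((Fin N → EuclideanSpace ℝ (Fin 2)) × (Fin N → ℝ)) =>
        L.slotFeedback Λ γ hN i p w x.1 x.2.1 x.2.2 n := by
  refine (WithLp.measurable_toLp 2 _).comp (measurable_pi_lambda _ fun j =>
    L.measurable_feedback i n fun k => ?_)
  have h1 := (L.measurable_codebookBar hL k.1 fun i => w i (j, p)).comp
    (show Measurable fun x : (Fin d × Fin 2 → ℝ) × ((Fin N → EuclideanSpace ℝ (Fin 2)) ×
      (Fin N → ℝ)) => x.1 (j, p) by fun_prop)
  have h2 := (L.measurable_slotInput Λ (γ := γ) hN p k.1).comp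
    (show Measurable fun x : (Fin d × Fin 2 → ℝ) × ((Fin N → EuclideanSpace ℝ (Fin 2)) ×
      (Fin N → ℝ)) => x.2 from measurable_snd)
  refine (h1.add ?_).add (by fun_prop)
  exact (show Measurable fun v : EuclideanSpace ℝ (Fin d) => v j by fun_prop).comp h2

end LFC

/-! ### Gaussian forms in the noise of one parity -/

section blockForm

variable {NC d N : ℕ} (hN : 2 * NC * d ≤ N) (p : Fin 2) {S : Matrix (Fin 2) (Fin 2) ℝ} {vt : ℝ}

instance isProbabilityMeasure_macNoise (N : ℕ) (S : Matrix (Fin 2) (Fin 2) ℝ) (vt : ℝ) :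
    IsProbabilityMeasure (macNoise N S vt) := by
  unfold macNoise; infer_instance

/-- A linear form in the noise of the instance at position `j`. -/
def slotForm (A : Fin NC → Fin 2 → ℝ) (B : Fin NC → ℝ)
    (ω : (Fin N → EuclideanSpace ℝ (Fin 2)) × (Fin N → ℝ)) (j : Fin d) : ℝ :=
  ∑ k, ∑ i, A k i * ω.1 (slot hN k p j) i + ∑ k, B k * ω.2 (fbSlot hN k p j)

/-- Different positions and steps use different rounds, so the forms at different `j` are
independent with equal variance. -/
theorem centeredGaussian_sum_slotForm (hS : S.PosSemidef) (hvt : 0 ≤ vt)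
    (A : Fin NC → Fin 2 → ℝ) (B : Fin NC → ℝ) (a : Fin d → ℝ) :
    CenteredGaussian (fun ω => ∑ j, a j * slotForm hN p A B ω j)
      ((∑ k, ∑ i, ∑ j, A k i * S i j * A k j + vt * ∑ k, B k ^ 2) * ∑ j, a j ^ 2)
      (macNoise N S vt) := by
  have h1 := CenteredGaussian.pi_sum (ι := Fin d × Fin NC) (m := fun _ => multivariateGaussian 0 S)
    fun x => (CenteredGaussian.sum_mul_multivariateGaussian hS (A x.2)).const_mul (a x.1)
  have h2 := CenteredGaussian.pi_sum (ι := Fin d × Fin NC) (m := fun _ => gaussianReal 0 vt.toNNReal)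
    fun x => (CenteredGaussian.id_gaussianReal hvt).const_mul (a x.1 * B x.2)
  have hmp := (measurePreserving_comp_injective (multivariateGaussian 0 S)
    (slot_injective hN p)).prod (measurePreserving_comp_injective (gaussianReal 0 vt.toNNReal)
    (fbSlot_injective hN p))
  have h := (h1.prod_add h2).comp hmp
  convert h using 1
  · ext ω
    simp only [slotForm, Prod.map_fst, Prod.map_snd, Fintype.sum_prod_type, mul_add, Finset.mul_sum,
      Finset.sum_add_distrib, mul_assoc]
  · simp only [Fintype.sum_prod_type, mul_pow]
    simp only [← Finset.sum_mul, ← Finset.mul_sum, mul_assoc]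
    ring
  · rfl

theorem measurable_slotForm (A : Fin NC → Fin 2 → ℝ) (B : Fin NC → ℝ) :
    Measurable fun ω : (Fin N → EuclideanSpace ℝ (Fin 2)) × (Fin N → ℝ) =>
      (WithLp.toLp 2 (slotForm hN p A B ω) : EuclideanSpace ℝ (Fin d)) := by
  refine (WithLp.measurable_toLp 2 _).comp (measurable_pi_lambda _ fun j => ?_)
  unfold slotForm
  fun_prop

theorem map_slotForm (hS : S.PosSemidef) (hvt : 0 ≤ vt) (A : Fin NC → Fin 2 → ℝ)
    (B : Fin NC → ℝ) : (macNoise N S vt).map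
      (fun ω => (WithLp.toLp 2 (slotForm hN p A B ω) : EuclideanSpace ℝ (Fin d))) =
      (stdGaussian (EuclideanSpace ℝ (Fin d))).map
        fun x => √(∑ k, ∑ i, ∑ j, A k i * S i j * A k j + vt * ∑ k, B k ^ 2) • x := by
  refine CenteredGaussian.map_vector_eq (measurable_slotForm hN p A B) ?_
    (centeredGaussian_sum_slotForm hN p hS hvt A B)
  exact add_nonneg (Finset.sum_nonneg fun k _ => OzarowLeung.quadForm_nonneg hS _) (by positivity)

theorem centeredGaussian_slotForm (hS : S.PosSemidef) (hvt : 0 ≤ vt) (A : Fin NC → Fin 2 → ℝ)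
    (B : Fin NC → ℝ) (j : Fin d) :
    CenteredGaussian (fun ω => slotForm hN p A B ω j)
      (∑ k, ∑ i, ∑ j, A k i * S i j * A k j + vt * ∑ k, B k ^ 2) (macNoise N S vt) := by
  have h := centeredGaussian_sum_slotForm hN p hS hvt A B (Pi.single j 1)
  have e1 : ∀ ω, ∑ j', (Pi.single j 1 : Fin d → ℝ) j' * slotForm hN p A B ω j' =
      slotForm hN p A B ω j := fun ω => by
    rw [Finset.sum_eq_single j]
    · simp
    · intro b _ hb; simp [hb]
    · simp
  have e2 : ∑ j', (Pi.single j 1 : Fin d → ℝ) j' ^ 2 = 1 := by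
    rw [Finset.sum_eq_single j]
    · simp
    · intro b _ hb; simp [hb]
    · simp
  simp only [e1, e2, mul_one] at h
  exact h

end blockForm

namespace OzarowLeung

variable {P : ℝ} {T : Matrix (Fin 2) (Fin 2) ℝ} {g : ℝ} {κ : Fin 2 → ℝ}

variable (P T g κ) in
/-- The coefficients of the noise in the transmission of step `n`. -/
def noiseCoeff (n : ℕ) : ℕ → Fin 2 → ℝ := if n < 2 then 0 else (inputWeight P T g κ (n - 2)).2

variable (P T g κ) in
/-- The coefficient of the seed in the transmission of step `n`. -/
def seedCoeff (n : ℕ) : ℝ := if n < 2 then 0 else (inputWeight P T g κ (n - 2)).1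

theorem noiseCoeff_eq_zero {n k : ℕ} (h : n ≤ k) : noiseCoeff P T g κ n k = 0 := by
  unfold noiseCoeff
  split_ifs with h2
  · rfl
  · exact inputWeight_snd_eq_zero P T g κ (n - 2) (by omega)

variable {NC : ℕ} {m : Fin 2 → ℕ}

theorem codebookBar_scheme_of_lt_two (w : ∀ i, Fin (m i)) (u : ℝ) (n : Fin NC) (i : Fin 2)
    (hn : n.val = i.val) :
    (scheme P T g κ NC m).codebookBar n w u = √P * pam (m i) (w i) :=
  input_scheme_of_lt_two w u 0 n i hn

theorem codebookBar_scheme (hP : 0 < P) (w : ∀ i, Fin (m i)) (u : ℝ) (n : Fin NC)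
    (hn : 2 ≤ n.val) :
    (scheme P T g κ NC m).codebookBar n w u = seedCoeff P T g κ n * u := by
  obtain ⟨n, hnN⟩ := n
  obtain ⟨k, rfl⟩ := Nat.exists_eq_add_of_le' (show 2 ≤ n from hn)
  rw [LFC.codebookBar, input_scheme (hP := hP), evalWeight, seedCoeff]
  simp

theorem noiseInput_scheme (hP : 0 < P) (w : ∀ i, Fin (m i)) (u : ℝ)
    (z : Fin NC → EuclideanSpace ℝ (Fin 2)) (n : Fin NC) :
    (scheme P T g κ NC m).noiseInput w u z n =
      ∑ k : Fin NC, ∑ i, noiseCoeff P T g κ n k i * z k i := by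
  rcases lt_or_ge n.val 2 with h2 | h2
  · rw [LFC.noiseInput, codebookBar_scheme_of_lt_two w u n ⟨n, h2⟩ rfl,
      input_scheme_of_lt_two w u z n ⟨n, h2⟩ rfl]
    simp [noiseCoeff, h2]
  · rw [LFC.noiseInput, codebookBar_scheme hP w u n h2]
    obtain ⟨n, hnN⟩ := n
    obtain ⟨k, rfl⟩ := Nat.exists_eq_add_of_le' (show 2 ≤ n from h2)
    rw [input_scheme (hP := hP), evalWeight]
    simp [noiseCoeff, seedCoeff]

/-- The transmission power as sum of the powers of the seed and of the noise. -/
theorem seedCoeff_sq_add (hP : 0 < P) (hg : 0 ≤ g) (hT : T.PosSemidef) (hd : ∀ i, 0 < T i i)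
    (n : Fin NC) (hn : 2 ≤ n.val) :
    seedCoeff P T g κ n ^ 2 + ∑ k : Fin NC, ∑ i, ∑ j,
      noiseCoeff P T g κ n k i * T i j * noiseCoeff P T g κ n k j = P := by
  obtain ⟨n, hnN⟩ := n
  obtain ⟨k, rfl⟩ := Nat.exists_eq_add_of_le' (show 2 ≤ n from hn)
  have h := covForm_inputWeight (state_valid (κ := κ) hP hg hT hd k hnN.le) hP hg hT
  rw [covForm_apply, Finset.sum_range] at h
  refine Eq.trans ?_ h
  simp [noiseCoeff, seedCoeff, sq]

end OzarowLeung

/-! ### Overload events and the power of the lattice part of the input -/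

namespace OzarowLeung

variable (P : ℝ) (T : Matrix (Fin 2) (Fin 2) ℝ) (g : ℝ) (κ : Fin 2 → ℝ) {NC d N : ℕ}
  {m : Fin 2 → ℕ} (hN : 2 * NC * d ≤ N) (γ : ℝ) (p : Fin 2)

/-- The argument of the modulo operation of step `n`, as long as there was no overload. -/
def argVec (n : Fin NC) (ω : (Fin N → EuclideanSpace ℝ (Fin 2)) × (Fin N → ℝ)) :
    EuclideanSpace ℝ (Fin d) :=
  WithLp.toLp 2 (slotForm hN p (fun k i => γ * noiseCoeff P T g κ n k i)
    -- Earlier feedback noises enter through the equivalent noise, except that of step `0`; the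
    -- current one enters directly.
    (fun k => -((if k.val = 0 then 0 else ∑ i, noiseCoeff P T g κ n k i) + if k = n then 1 else 0))
    ω)

/-- The power of the noise in the transmission of step `n`. -/
def noisePow (n : Fin NC) : ℝ :=
  ∑ k : Fin NC, ∑ i, ∑ j, noiseCoeff P T g κ n k i * T i j * noiseCoeff P T g κ n k j

/-- The event that the modulo operation of step `n` is not trivial. -/
def overload (Λ : LatticeQuantizer d) (n : Fin NC) :
    Set ((Fin N → EuclideanSpace ℝ (Fin 2)) × (Fin N → ℝ)) :=
  {ω | Λ.mod (argVec P T g κ hN γ p n ω) ≠ argVec P T g κ hN γ p n ω}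

variable {P T g κ γ p}

theorem measurable_argVec (n : Fin NC) : Measurable (argVec P T g κ hN γ p n) :=
  measurable_slotForm hN p _ _

theorem measurableSet_overload (Λ : LatticeQuantizer d) (n : Fin NC) :
    MeasurableSet (overload P T g κ hN γ p Λ n) :=
  (measurableSet_eq_fun (Λ.measurable_mod.comp (measurable_argVec hN n))
    (measurable_argVec hN n)).compl

theorem linearArg_scheme (hP : 0 < P) (hγ : γ ≠ 0) (w : ∀ i, Fin (m i)) (u : ℝ) (n : Fin NC)
    (ω : (Fin N → EuclideanSpace ℝ (Fin 2)) × (Fin N → ℝ)) :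
    (scheme P T g κ NC m).linearArg γ w u (LFC.blockNoise hN p ω.1)
      (LFC.fbBlockNoise hN p ω.2) n = argVec P T g κ hN γ p n ω := by
  rw [LFC.linearArg, argVec]
  refine congrArg (WithLp.toLp 2) (funext fun j => ?_)
  rw [noiseInput_scheme hP, slotForm]
  have h1 (k : Fin NC) : ∑ i, noiseCoeff P T g κ n k i *
      LFC.equivNoise γ (LFC.blockNoise hN p ω.1) (LFC.fbBlockNoise hN p ω.2) j k i =
      ∑ i, noiseCoeff P T g κ n k i * ω.1 (slot hN k p j) i -
        γ⁻¹ * ((if k.val = 0 then 0 else ∑ i, noiseCoeff P T g κ n k i) *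
          ω.2 (fbSlot hN k p j)) := by
    simp only [LFC.equivNoise, LFC.blockNoise, LFC.fbBlockNoise, Fin.sum_univ_two]
    split_ifs <;> ring
  have h2 : ∑ k : Fin NC, (if k = n then (1 : ℝ) else 0) * ω.2 (fbSlot hN k p j) =
      ω.2 (fbSlot hN n p j) := by simp
  simp only [h1, Finset.sum_sub_distrib, neg_mul, add_mul, Finset.sum_neg_distrib,
    Finset.sum_add_distrib, h2, ← Finset.mul_sum, mul_assoc, LFC.fbBlockNoise]
  field_simp
  ring

section variance

variable {S : Matrix (Fin 2) (Fin 2) ℝ} {vt : ℝ} (hvt : 0 ≤ vt)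
  (hT : ∀ a : Fin 2 → ℝ, ∑ i, ∑ j, a i * T i j * a j =
    ∑ i, ∑ j, a i * S i j * a j + γ⁻¹ ^ 2 * vt * (∑ i, a i) ^ 2)
include hvt hT

/-- Only an inequality, since step `0` carries no feedback noise. -/
theorem slotVar_le (c : Fin NC → Fin 2 → ℝ) :
    ∑ k, ∑ i, ∑ j, c k i * S i j * c k j +
      vt * ∑ k : Fin NC, (-(if k.val = 0 then 0 else γ⁻¹ * ∑ i, c k i)) ^ 2 ≤
        ∑ k, ∑ i, ∑ j, c k i * T i j * c k j := by
  rw [Finset.mul_sum, ← Finset.sum_add_distrib]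
  refine Finset.sum_le_sum fun k _ => ?_
  rw [hT]
  refine add_le_add le_rfl ?_
  split_ifs
  · simp only [neg_zero, ne_eq, OfNat.ofNat_ne_zero, not_false_eq_true, zero_pow, mul_zero]
    positivity
  · exact le_of_eq (by ring)

/-- By causality the coefficient at `k = n` vanishes, so the current feedback noise adds `vt`
without a cross term. -/
theorem argVar_le (hγ : γ ≠ 0) (n : Fin NC) :
    ∑ k : Fin NC, ∑ i, ∑ j, γ * noiseCoeff P T g κ n k i * S i j * (γ * noiseCoeff P T g κ n k j) +
      vt * ∑ k : Fin NC, (-((if k.val = 0 then 0 else ∑ i, noiseCoeff P T g κ n k i) +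
        if k = n then 1 else 0)) ^ 2 ≤ γ ^ 2 * noisePow P T g κ n + vt := by
  have h := mul_le_mul_of_nonneg_left (slotVar_le hvt hT fun (k : Fin NC) i => noiseCoeff P T g κ n k i)
    (sq_nonneg γ)
  have h1 : ∑ k : Fin NC, ∑ i, ∑ j,
      γ * noiseCoeff P T g κ n k i * S i j * (γ * noiseCoeff P T g κ n k j) =
      γ ^ 2 * ∑ k : Fin NC, ∑ i, ∑ j, noiseCoeff P T g κ n k i * S i j * noiseCoeff P T g κ n k j := by
    simp only [Finset.mul_sum]
    refine Finset.sum_congr rfl fun k _ => Finset.sum_congr rfl fun i _ =>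
      Finset.sum_congr rfl fun j _ => by ring
  have h2 (k : Fin NC) : (-((if k.val = 0 then 0 else ∑ i, noiseCoeff P T g κ n k i) +
      if k = n then 1 else 0)) ^ 2 =
      γ ^ 2 * (-(if k.val = 0 then 0 else γ⁻¹ * ∑ i, noiseCoeff P T g κ n k i)) ^ 2 +
        if k = n then 1 else 0 := by
    by_cases hk : k = n
    · subst hk
      simp [noiseCoeff_eq_zero]
    · split_ifs
      · simp
      · field_simp
        ring
  have h3 : ∑ k : Fin NC, (if k = n then (1 : ℝ) else 0) = 1 := by simp
  rw [h1]
  simp only [h2, Finset.sum_add_distrib, h3, ← Finset.mul_sum]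
  rw [noisePow]
  linarith

theorem lintegral_norm_sq_argVec_le (hS : S.PosSemidef) (hγ : γ ≠ 0) (n : Fin NC) :
    ∫⁻ ω, ENNReal.ofReal (‖argVec P T g κ hN γ p n ω‖ ^ 2) ∂(macNoise N S vt) ≤
      ENNReal.ofReal (d * (γ ^ 2 * noisePow P T g κ n + vt)) := by
  have hm := measurable_argVec (P := P) (T := T) (g := g) (κ := κ) (γ := γ) (p := p) hN n
  have e (ω : (Fin N → EuclideanSpace ℝ (Fin 2)) × (Fin N → ℝ)) :
      ENNReal.ofReal (‖argVec P T g κ hN γ p n ω‖ ^ 2) =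
        ∑ j, ENNReal.ofReal (argVec P T g κ hN γ p n ω j ^ 2) := by
    rw [EuclideanSpace.real_norm_sq_eq, ENNReal.ofReal_sum_of_nonneg fun _ _ => sq_nonneg _]
  simp only [e]
  have hmj (j : Fin d) : Measurable fun ω =>
      ENNReal.ofReal (argVec P T g κ hN γ p n ω j ^ 2) :=
    (((show Measurable fun v : EuclideanSpace ℝ (Fin d) => v j by fun_prop).comp hm).pow_const
      2).ennreal_ofReal
  rw [lintegral_finsetSum _ fun j _ => hmj j]
  have h (j : Fin d) : ∫⁻ ω, ENNReal.ofReal (argVec P T g κ hN γ p n ω j ^ 2) ∂(macNoise N S vt) ≤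
      ENNReal.ofReal (γ ^ 2 * noisePow P T g κ n + vt) := by
    have := (centeredGaussian_slotForm hN p hS hvt (fun k i => γ * noiseCoeff P T g κ n k i)
      (fun k => -((if k.val = 0 then 0 else ∑ i, noiseCoeff P T g κ n k i) +
        if k = n then 1 else 0)) j).lintegral_sq
    exact this.trans_le (ENNReal.ofReal_le_ofReal (argVar_le hvt hT hγ n))
  refine (Finset.sum_le_sum fun j _ => h j).trans_eq ?_
  rw [Finset.sum_const, Finset.card_univ, Fintype.card_fin, nsmul_eq_mul,
    ENNReal.ofReal_mul (Nat.cast_nonneg d), ENNReal.ofReal_natCast]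

theorem measure_overload_le (hS : S.PosSemidef) (hγ : γ ≠ 0) {Λ : LatticeQuantizer d} {c η : ℝ}
    (hΛ : ∀ s, 0 ≤ s → s ^ 2 ≤ c →
      stdGaussian (EuclideanSpace ℝ (Fin d)) {x | Λ.mod (s • x) ≠ s • x} ≤ ENNReal.ofReal η)
    {n : Fin NC} (hc : γ ^ 2 * noisePow P T g κ n + vt ≤ c) :
    macNoise N S vt (overload P T g κ hN γ p Λ n) ≤ ENNReal.ofReal η := by
  have hmap := map_slotForm hN p hS hvt (fun k i => γ * noiseCoeff P T g κ n k i)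
    (fun k => -((if k.val = 0 then 0 else ∑ i, noiseCoeff P T g κ n k i) + if k = n then 1 else 0))
  have hv0 : 0 ≤ ∑ k : Fin NC, ∑ i, ∑ j,
      γ * noiseCoeff P T g κ n k i * S i j * (γ * noiseCoeff P T g κ n k j) +
      vt * ∑ k : Fin NC, (-((if k.val = 0 then 0 else ∑ i, noiseCoeff P T g κ n k i) +
        if k = n then 1 else 0)) ^ 2 :=
    add_nonneg (Finset.sum_nonneg fun k _ =>
      quadForm_nonneg hS fun i => γ * noiseCoeff P T g κ n k i) (by positivity)
  have hms : MeasurableSet {v | Λ.mod v ≠ v} :=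
    (measurableSet_eq_fun Λ.measurable_mod measurable_id).compl
  have h1 : macNoise N S vt (overload P T g κ hN γ p Λ n) =
      ((macNoise N S vt).map (argVec P T g κ hN γ p n)) {v | Λ.mod v ≠ v} := by
    rw [Measure.map_apply (measurable_argVec hN n) hms]
    rfl
  rw [h1]
  unfold argVec
  rw [hmap, Measure.map_apply (by fun_prop) hms]
  refine hΛ _ (Real.sqrt_nonneg _) ?_
  rw [Real.sq_sqrt hv0]
  exact (argVar_le hvt hT hγ n).trans hc

end variance

/-- Off the overload events, the modulo operation acts on the linear form. -/
theorem slotInput_scheme (hP : 0 < P) (hγ : γ ≠ 0) (hm : ∀ i, 2 ≤ m i) (Λ : LatticeQuantizer d)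
    {n : Fin NC} (hn : n.val ≠ 0) (ω : (Fin N → EuclideanSpace ℝ (Fin 2)) × (Fin N → ℝ))
    (h : ∀ k, ω ∉ overload P T g κ hN γ p Λ k) :
    (scheme P T g κ NC m).slotInput Λ γ hN p ω.1 ω.2 n =
      γ⁻¹ • Λ.mod (argVec P T g κ hN γ p n ω) := by
  have : ∀ i, NeZero (m i) := fun i => ⟨by have := hm i; omega⟩
  -- The noise part does not depend on messages and seed, so arbitrary values are inserted.
  rw [LFC.slotInput, LFC.latticeInput_eq _ Λ hγ (fun _ => 0) 0 _ _ hn, linearArg_scheme hN hP hγ]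
  intro k _ _
  rw [linearArg_scheme hN hP hγ]
  exact not_not.mp (h k)

/-- Off the overload events the residue is no longer than its argument, whose power is known. On
them the uniform bound `C` is weighted with their probability. -/
theorem lintegral_norm_sq_slotInput_le {S : Matrix (Fin 2) (Fin 2) ℝ} {vt : ℝ} (hvt : 0 ≤ vt)
    (hT : ∀ a : Fin 2 → ℝ, ∑ i, ∑ j, a i * T i j * a j =
      ∑ i, ∑ j, a i * S i j * a j + γ⁻¹ ^ 2 * vt * (∑ i, a i) ^ 2) (hT0 : T.PosSemidef)
    (hP : 0 < P) (hS : S.PosSemidef) (hγ : γ ≠ 0) (hm : ∀ i, 2 ≤ m i) {Λ : LatticeQuantizer d}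
    {C η : ℝ} (hC0 : 0 ≤ C) (hη : 0 ≤ η) (hC : ∀ x, ‖Λ.mod x‖ ^ 2 ≤ C)
    (hov : ∀ k : Fin NC, macNoise N S vt (overload P T g κ hN γ p Λ k) ≤ ENNReal.ofReal η)
    {n : Fin NC} (hn : n.val ≠ 0) :
    ∫⁻ ω, ENNReal.ofReal (‖(scheme P T g κ NC m).slotInput Λ γ hN p ω.1 ω.2 n‖ ^ 2)
      ∂(macNoise N S vt) ≤
        ENNReal.ofReal (d * noisePow P T g κ n + γ⁻¹ ^ 2 * (d * vt + C * (NC * η))) := by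
  set A := ⋃ k : Fin NC, overload P T g κ hN γ p Λ k with hA
  have hAm : MeasurableSet A := MeasurableSet.iUnion fun k => measurableSet_overload hN Λ k
  have hnp : 0 ≤ noisePow P T g κ n := Finset.sum_nonneg fun k _ =>
    quadForm_nonneg hT0 fun i => noiseCoeff P T g κ n k i
  have hAle : macNoise N S vt A ≤ ENNReal.ofReal (NC * η) := by
    refine (measure_iUnion_le _).trans ?_
    rw [tsum_fintype]
    refine (Finset.sum_le_sum fun k _ => hov k).trans_eq ?_
    rw [Finset.sum_const, Finset.card_univ, Fintype.card_fin, nsmul_eq_mul,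
      ENNReal.ofReal_mul (Nat.cast_nonneg _), ENNReal.ofReal_natCast]
  have hpt (ω : (Fin N → EuclideanSpace ℝ (Fin 2)) × (Fin N → ℝ)) :
      ENNReal.ofReal (‖(scheme P T g κ NC m).slotInput Λ γ hN p ω.1 ω.2 n‖ ^ 2) ≤
      ENNReal.ofReal (γ⁻¹ ^ 2) * (ENNReal.ofReal (‖argVec P T g κ hN γ p n ω‖ ^ 2) +
        A.indicator (fun _ => ENNReal.ofReal C) ω) := by
    by_cases hω : ω ∈ A
    · rw [Set.indicator_of_mem hω, LFC.slotInput, LFC.latticeInput_def (hn := hn), norm_smul,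
        mul_pow, Real.norm_eq_abs, sq_abs, ENNReal.ofReal_mul (sq_nonneg _)]
      gcongr
      exact (ENNReal.ofReal_le_ofReal (hC _)).trans le_add_self
    · rw [Set.indicator_of_notMem hω, slotInput_scheme hN hP hγ hm Λ hn ω (by
        simpa [hA] using hω), norm_smul, mul_pow, Real.norm_eq_abs, sq_abs,
        ENNReal.ofReal_mul (sq_nonneg _), add_zero]
      gcongr
      exact Λ.norm_mod_le_norm _
  have hmeas := measurable_argVec (P := P) (T := T) (g := g) (κ := κ) (γ := γ) (p := p) hN n
  calc ∫⁻ ω, ENNReal.ofReal (‖(scheme P T g κ NC m).slotInput Λ γ hN p ω.1 ω.2 n‖ ^ 2)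
        ∂(macNoise N S vt)
      ≤ ∫⁻ ω, ENNReal.ofReal (γ⁻¹ ^ 2) * (ENNReal.ofReal (‖argVec P T g κ hN γ p n ω‖ ^ 2) +
          A.indicator (fun _ => ENNReal.ofReal C) ω) ∂(macNoise N S vt) := lintegral_mono hpt
    _ = ENNReal.ofReal (γ⁻¹ ^ 2) *
          (∫⁻ ω, ENNReal.ofReal (‖argVec P T g κ hN γ p n ω‖ ^ 2) ∂(macNoise N S vt) +
            ENNReal.ofReal C * macNoise N S vt A) := by
        rw [lintegral_const_mul' _ _ ENNReal.ofReal_ne_top, lintegral_add_left (by fun_prop),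
          lintegral_indicator_const hAm]
    _ ≤ ENNReal.ofReal (γ⁻¹ ^ 2) * (ENNReal.ofReal (d * (γ ^ 2 * noisePow P T g κ n + vt)) +
          ENNReal.ofReal C * ENNReal.ofReal (NC * η)) := by
        gcongr
        exact lintegral_norm_sq_argVec_le hN hvt hT hS hγ n
    _ = _ := by
        rw [← ENNReal.ofReal_mul hC0, ← ENNReal.ofReal_add (by positivity) (by positivity),
          ← ENNReal.ofReal_mul (sq_nonneg _)]
        congr 1
        field_simp
        ring

end OzarowLeung

/-! ### Sums over blocks -/

theorem sum_range_mul_block (F : ℕ → ℝ≥0∞) (M d : ℕ) :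
    ∑ t ∈ Finset.range (M * d), F t =
      ∑ b ∈ Finset.range M, ∑ j ∈ Finset.range d, F (b * d + j) := by
  induction M with
  | zero => simp
  | succ M ih => rw [Nat.succ_mul, Finset.sum_range_add, ih, Finset.sum_range_succ]

theorem sum_rounds_le {N NC d : ℕ} (hN : 2 * NC * d ≤ N) {f : Fin N → ℝ≥0∞} {B : ℝ≥0∞}
    (h0 : ∀ t : Fin N, 2 * NC * d ≤ t.val → f t = 0)
    (hB : ∀ b (hb : b < 2 * NC), ∑ j : Fin d, f ⟨b * d + j, block_lt hN hb j.isLt⟩ ≤ B) :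
    ∑ t, f t ≤ (2 * NC : ℕ) * B := by
  set F : ℕ → ℝ≥0∞ := fun t => if h : t < N then f ⟨t, h⟩ else 0 with hF
  have e1 : ∑ t, f t = ∑ t ∈ Finset.range N, F t := by
    rw [Finset.sum_range]
    exact Finset.sum_congr rfl fun t _ => by simp [hF]
  have e2 : ∑ t ∈ Finset.range N, F t = ∑ t ∈ Finset.range (2 * NC * d), F t := by
    symm
    refine Finset.sum_subset (Finset.range_subset_range.mpr hN) fun t ht ht' => ?_
    have h1 : t < N := Finset.mem_range.mp ht
    simp only [hF, h1, dite_true]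
    exact h0 _ (not_lt.mp fun h => ht' (Finset.mem_range.mpr h))
  rw [e1, e2, sum_range_mul_block]
  calc ∑ b ∈ Finset.range (2 * NC), ∑ j ∈ Finset.range d, F (b * d + j)
      ≤ ∑ b ∈ Finset.range (2 * NC), B := by
        refine Finset.sum_le_sum fun b hb => ?_
        refine le_trans (le_of_eq ?_) (hB b (Finset.mem_range.mp hb))
        rw [Finset.sum_range]
        refine Finset.sum_congr rfl fun j _ => ?_
        have := block_lt hN (Finset.mem_range.mp hb) j.isLt
        simp only [hF, this, dite_true]
    _ = _ := by simp

section msgAvg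

variable {Msg : Fin 2 → Type} [∀ i, Fintype (Msg i)]

theorem sum_msgAvg {ι : Type*} (s : Finset ι) (f : ι → (∀ i, Msg i) → ℝ≥0∞) :
    ∑ t ∈ s, msgAvg (f t) = msgAvg fun w => ∑ t ∈ s, f t w := by
  simp only [msgAvg, div_eq_mul_inv]
  rw [← Finset.sum_mul, Finset.sum_comm]

theorem lintegral_msgAvg {Ω : Type*} [MeasurableSpace Ω] {μ : Measure Ω}
    {f : (∀ i, Msg i) → Ω → ℝ≥0∞} (hf : ∀ w, Measurable (f w)) :
    ∫⁻ ω, msgAvg (fun w => f w ω) ∂μ = msgAvg fun w => ∫⁻ ω, f w ω ∂μ := by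
  simp only [msgAvg, div_eq_mul_inv]
  rw [lintegral_mul_const _ (Finset.measurable_sum _ fun w _ => hf w),
    lintegral_finsetSum _ fun w _ => hf w]

/-- One coordinate of a uniformly distributed tuple of messages is uniform. -/
theorem msgAvg_apply {ι : Type} [Fintype ι] [DecidableEq ι] {m : Fin 2 → ℕ} (hm : ∀ i, m i ≠ 0)
    (i : Fin 2) (x : ι) (f : Fin (m i) → ℝ≥0∞) :
    msgAvg (Msg := fun i => ι → Fin (m i)) (fun w => f (w i x)) =
      msgAvg (Msg := fun i => Fin (m i)) fun w => f (w i) := by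
  have : ∀ i, NeZero (m i) := fun i => ⟨hm i⟩
  rw [msgAvg_coord (Msg := fun i => ι → Fin (m i)) i fun v => f (v x),
    msgAvg_coord (Msg := fun i => Fin (m i)) i f]
  have h := Fintype.sum_piFinset_apply f Finset.univ x
  rw [Fintype.piFinset_univ] at h
  rw [h, Fintype.card_fun, Finset.card_univ, nsmul_eq_mul]
  have hpos : 0 < Fintype.card ι := Fintype.card_pos_iff.mpr ⟨x⟩
  have hc : (Fintype.card (Fin (m i)) ^ Fintype.card ι : ℕ) =
      Fintype.card (Fin (m i)) ^ (Fintype.card ι - 1) * Fintype.card (Fin (m i)) := by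
    rw [← pow_succ, Nat.sub_add_cancel hpos]
  rw [hc, Nat.cast_mul, ENNReal.mul_div_mul_left]
  · simp [hm i]
  · exact ENNReal.natCast_ne_top _

end msgAvg

theorem lintegral_affine_sq_gaussianReal (b c : ℝ) :
    ∫⁻ u, ENNReal.ofReal ((b * u + c) ^ 2) ∂(gaussianReal 0 1) = ENNReal.ofReal (b ^ 2 + c ^ 2) := by
  have h2 : MemLp (fun u : ℝ => u) 2 (gaussianReal 0 1) := memLp_id_gaussianReal' 2 (by simp)
  have hi1 : Integrable (fun u : ℝ => u) (gaussianReal 0 1) := h2.integrable one_le_two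
  have hi2 : Integrable (fun u : ℝ => u ^ 2) (gaussianReal 0 1) := h2.integrable_sq
  have hs : ∫ u, u ^ 2 ∂(gaussianReal 0 1) = 1 := by
    have := variance_eq_integral (μ := gaussianReal 0 1) (X := id) (by fun_prop)
    simp [variance_id_gaussianReal, integral_id_gaussianReal] at this
    exact this.symm
  have hm : ∫ u, u ∂(gaussianReal 0 1) = 0 := integral_id_gaussianReal
  have e (u : ℝ) : (b * u + c) ^ 2 = b ^ 2 * u ^ 2 + (2 * b * c) * u + c ^ 2 := by ring
  have hi : Integrable (fun u : ℝ => b ^ 2 * u ^ 2 + (2 * b * c) * u) (gaussianReal 0 1) :=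
    (hi2.const_mul _).add (hi1.const_mul _)
  have hi' : Integrable (fun u : ℝ => (b * u + c) ^ 2) (gaussianReal 0 1) := by
    simp only [e]
    exact hi.add (integrable_const _)
  rw [← ofReal_integral_eq_lintegral_ofReal hi' (ae_of_all _ fun _ => sq_nonneg _)]
  congr 1
  simp only [e]
  rw [integral_add hi (integrable_const _), integral_add (hi2.const_mul _) (hi1.const_mul _),
    integral_const_mul, integral_const_mul, hs, hm]
  simp

/-! ### The power of the feedback -/

section randomness

variable {NC d : ℕ} {Λ : LatticeQuantizer d} [IsProbabilityMeasure Λ.dither]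

instance isProbabilityMeasure_mlRandomnessLaw : IsProbabilityMeasure (mlRandomnessLaw NC Λ) := by
  unfold mlRandomnessLaw; infer_instance

/-- `F` does not depend on the dithers, so given seeds and noise the residue is uniform on the cell.
It applies to the feedback elements because the dithers cancel in all inputs. -/
theorem lintegral_mod_dither {Ω : Type*} [MeasurableSpace Ω] {μ : Measure Ω}
    [IsProbabilityMeasure μ] {F : (Fin d × Fin 2 → ℝ) × Ω → EuclideanSpace ℝ (Fin d)}
    (hF : Measurable F) (a : Fin 2 × Fin NC × Fin 2) :
    ∫⁻ x, ENNReal.ofReal (‖Λ.mod (F (x.1.2, x.2) + x.1.1 a)‖ ^ 2) ∂((mlRandomnessLaw NC Λ).prod μ) =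
      ∫⁻ v, ENNReal.ofReal (‖v‖ ^ 2) ∂Λ.dither := by
  have hm : Measurable fun x : MLRandomness NC d × Ω =>
      ENNReal.ofReal (‖Λ.mod (F (x.1.2, x.2) + x.1.1 a)‖ ^ 2) := by
    have h1 : Measurable fun x : MLRandomness NC d × Ω => F (x.1.2, x.2) :=
      hF.comp ((measurable_snd.comp measurable_fst).prodMk measurable_snd)
    have h2 : Measurable fun x : MLRandomness NC d × Ω => x.1.1 a :=
      (measurable_pi_apply a).comp (measurable_fst.comp measurable_fst)
    exact ((Λ.measurable_mod.comp (h1.add h2)).norm.pow_const 2).ennreal_ofReal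
  rw [lintegral_prod_symm _ hm.aemeasurable]
  have h1 (ω : Ω) : ∫⁻ q : MLRandomness NC d,
      ENNReal.ofReal (‖Λ.mod (F (q.2, ω) + q.1 a)‖ ^ 2) ∂(mlRandomnessLaw NC Λ) =
        ∫⁻ v, ENNReal.ofReal (‖v‖ ^ 2) ∂Λ.dither := by
    have hm' : Measurable fun q : MLRandomness NC d =>
        ENNReal.ofReal (‖Λ.mod (F (q.2, ω) + q.1 a)‖ ^ 2) := by
      have h1 : Measurable fun q : MLRandomness NC d => F (q.2, ω) :=
        hF.comp (measurable_snd.prodMk measurable_const)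
      have h2 : Measurable fun q : MLRandomness NC d => q.1 a :=
        (measurable_pi_apply a).comp measurable_fst
      exact ((Λ.measurable_mod.comp (h1.add h2)).norm.pow_const 2).ennreal_ofReal
    rw [mlRandomnessLaw, lintegral_prod_symm _ hm'.aemeasurable]
    have h2 (s : Fin d × Fin 2 → ℝ) : ∫⁻ V : Fin 2 × Fin NC × Fin 2 → EuclideanSpace ℝ (Fin d),
        ENNReal.ofReal (‖Λ.mod (F (s, ω) + V a)‖ ^ 2) ∂(Measure.pi fun _ => Λ.dither) =
          ∫⁻ v, ENNReal.ofReal (‖v‖ ^ 2) ∂Λ.dither := by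
      rw [(measurePreserving_eval (fun _ : Fin 2 × Fin NC × Fin 2 => Λ.dither) a).lintegral_comp
        (f := fun v => ENNReal.ofReal (‖Λ.mod (F (s, ω) + v)‖ ^ 2))
        ((Λ.measurable_mod.comp (measurable_const.add measurable_id)).norm.pow_const
          2).ennreal_ofReal]
      exact Λ.lintegral_dither_mod_add (F (s, ω)) fun v => ENNReal.ofReal (‖v‖ ^ 2)
    simp only [h2, lintegral_const, measure_univ, mul_one]
  simp only [h1, lintegral_const, measure_univ, mul_one]

/-- A single seed is standard Gaussian. -/
theorem measurePreserving_seed (x : Fin d × Fin 2) :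
    MeasurePreserving (fun q : MLRandomness NC d => q.2 x) (mlRandomnessLaw NC Λ)
      (gaussianReal 0 1) :=
  (measurePreserving_eval (fun _ : Fin d × Fin 2 => gaussianReal 0 1) x).comp measurePreserving_snd

end randomness

theorem sum_lintegral_sq_apply {Ω : Type*} [MeasurableSpace Ω] {μ : Measure Ω} {d : ℕ}
    {V : Ω → EuclideanSpace ℝ (Fin d)} (hV : Measurable V) :
    ∑ j, ∫⁻ ω, ENNReal.ofReal (V ω j ^ 2) ∂μ = ∫⁻ ω, ENNReal.ofReal (‖V ω‖ ^ 2) ∂μ := by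
  have hmj (j : Fin d) : Measurable fun ω => ENNReal.ofReal (V ω j ^ 2) :=
    (((show Measurable fun v : EuclideanSpace ℝ (Fin d) => v j by fun_prop).comp hV).pow_const
      2).ennreal_ofReal
  rw [← lintegral_finsetSum _ fun j _ => hmj j]
  refine lintegral_congr fun ω => ?_
  rw [EuclideanSpace.real_norm_sq_eq, ENNReal.ofReal_sum_of_nonneg fun _ _ => sq_nonneg _]

namespace LFC

variable {NC : ℕ} {m : Fin 2 → ℕ} (L : LFC NC m) {d : ℕ} (hd : 0 < d) (Λ : LatticeQuantizer d)
  [IsProbabilityMeasure Λ.dither] {γ : ℝ} {N : ℕ} (hN : 2 * NC * d ≤ N)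

-- Each block that carries feedback has power `d` times the second moment, all other blocks have
-- none, and there are at most `2 NC` blocks.
include hN in
theorem feedbackPower_le (hL : ∀ n w, Measurable (L.codebook n w)) {C : ℝ}
    (hC : ∀ x, ‖Λ.mod x‖ ^ 2 ≤ C) (S : Matrix (Fin 2) (Fin 2) ℝ) (vt : ℝ)
    (w : ∀ i, Fin d × Fin 2 → Fin (m i)) (i : Fin 2) :
    ∑ t, ∫⁻ x, ENNReal.ofReal
      ((mlScheme L hd Λ (fun _ => γ) N).fbInput w x.1 x.2.1 x.2.2 i t ^ 2)
        ∂((mlRandomnessLaw NC Λ).prod (macNoise N S vt)) ≤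
      ENNReal.ofReal (N * Λ.secondMoment) := by
  have hsm := Λ.secondMoment_nonneg
  have hsum := sum_rounds_le hN (B := ENNReal.ofReal (d * Λ.secondMoment))
    (f := fun t => ∫⁻ x, ENNReal.ofReal
      ((mlScheme L hd Λ (fun _ => γ) N).fbInput w x.1 x.2.1 x.2.2 i t ^ 2)
        ∂((mlRandomnessLaw NC Λ).prod (macNoise N S vt))) ?_ ?_
  · refine hsum.trans ?_
    rw [← ENNReal.ofReal_natCast, ← ENNReal.ofReal_mul (Nat.cast_nonneg _)]
    refine ENNReal.ofReal_le_ofReal ?_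
    have : ((2 * NC : ℕ) : ℝ) * d ≤ N := by exact_mod_cast hN
    rw [← mul_assoc]
    gcongr
  · intro t ht
    have hz : NC ≤ (t.val / d + 1) / 2 := by
      have : 2 * NC ≤ t.val / d := (Nat.le_div_iff_mul_le hd).mpr ht
      omega
    simp only [L.fbInput_eq_zero hd Λ w _ _ _ i t (Or.inr hz)]
    simp
  · intro b hb
    by_cases hz : (b + 1) / 2 = 0 ∨ NC ≤ (b + 1) / 2
    · refine le_of_eq_of_le (Finset.sum_eq_zero fun j _ => ?_) zero_le
      have hbd : (b * d + j.val) / d = b := div_block j.isLt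
      have := fun q z zt => L.fbInput_eq_zero hd Λ (γ := γ) w q z zt i
        ⟨b * d + j, block_lt hN hb j.isLt⟩ (by rwa [hbd])
      simp only [this]
      simp
    · rw [not_or, not_le] at hz
      set n : Fin NC := ⟨(b + 1) / 2, hz.2⟩ with hn
      set p : Fin 2 := ⟨(b + 1) % 2, Nat.mod_lt _ two_pos⟩ with hp
      have hslot (j : Fin d) : (⟨b * d + j, block_lt hN hb j.isLt⟩ : Fin N) = fbSlot hN n p j := by
        rw [fbSlot]
        congr 3
        simp only [hn, hp]
        omega
      set F : (Fin d × Fin 2 → ℝ) × ((Fin N → EuclideanSpace ℝ (Fin 2)) × (Fin N → ℝ)) →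
          EuclideanSpace ℝ (Fin d) :=
        fun x => γ • L.slotFeedback Λ γ hN i p w x.1 x.2.1 x.2.2 n with hFdef
      have hF : Measurable F :=
        (L.measurable_slotFeedback Λ (γ := γ) hN w hL i p n).const_smul γ
      have hF' : Measurable fun x : MLRandomness NC d × ((Fin N → EuclideanSpace ℝ (Fin 2)) ×
          (Fin N → ℝ)) => Λ.mod (F (x.1.2, x.2) + x.1.1 (i, n, p)) :=
        Λ.measurable_mod.comp ((hF.comp
          ((measurable_snd.comp measurable_fst).prodMk measurable_snd)).add
            ((measurable_pi_apply (i, n, p)).comp (measurable_fst.comp measurable_fst)))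
      simp only [hslot, L.fbInput_fbSlot hd Λ hN w _ _ _ i p n hz.1]
      refine le_of_eq ((sum_lintegral_sq_apply hF').trans ?_)
      rw [lintegral_mod_dither hF, Λ.lintegral_norm_sq_dither hd hC]

end LFC

/-! ### The power of Terminal A -/

namespace OzarowLeung

variable {P : ℝ} {T : Matrix (Fin 2) (Fin 2) ℝ} {g : ℝ} {κ : Fin 2 → ℝ} {NC d N : ℕ}
  {m : Fin 2 → ℕ} (hN : 2 * NC * d ≤ N) {γ : ℝ} {p : Fin 2} (hd : 0 < d)
  {Λ : LatticeQuantizer d} [IsProbabilityMeasure Λ.dither]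

variable (P T g κ) in
/-- The power of the codebook element of step `n`. -/
def codebookPow (n : ℕ) : ℝ := if n < 2 then P else seedCoeff P T g κ n ^ 2

theorem noisePow_of_lt_two {n : Fin NC} (hn : n.val < 2) : noisePow P T g κ n = 0 := by
  simp [noisePow, noiseCoeff, hn]

theorem codebookPow_add_noisePow (hP : 0 < P) (hg : 0 ≤ g) (hT : T.PosSemidef)
    (hT' : ∀ i, 0 < T i i) (n : Fin NC) : codebookPow P T g κ n + noisePow P T g κ n = P := by
  rcases lt_or_ge n.val 2 with h | h
  · rw [noisePow_of_lt_two h, codebookPow, if_pos h, add_zero]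
  · rw [codebookPow, if_neg (not_lt.mpr h), noisePow]
    exact seedCoeff_sq_add hP hg hT hT' n h

/-- The power of the sum of a codebook element and an independent quantity. -/
theorem msgAvg_lintegral_codebookBar_add_sq {Ω : Type*} [MeasurableSpace Ω] {μ : Measure Ω}
    [IsProbabilityMeasure μ] (hP : 0 < P) (hm : ∀ i, 2 ≤ m i) (n : Fin NC) (x : Fin d × Fin 2)
    {s : Ω → ℝ} (hs : Measurable s) :
    (msgAvg (Msg := fun i => Fin d × Fin 2 → Fin (m i)) fun w => ∫⁻ y, ENNReal.ofReal
      (((scheme P T g κ NC m).codebookBar n (fun i => w i x) (y.1.2 x) + s y.2) ^ 2)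
        ∂((mlRandomnessLaw NC Λ).prod μ)) =
      ENNReal.ofReal (codebookPow P T g κ n) + ∫⁻ ω, ENNReal.ofReal (s ω ^ 2) ∂μ := by
  have : ∀ i, NeZero (m i) := fun i => ⟨by have := hm i; omega⟩
  have hsq : Measurable fun ω => ENNReal.ofReal (s ω ^ 2) := (hs.pow_const 2).ennreal_ofReal
  have hadd : ENNReal.ofReal (codebookPow P T g κ n) + ∫⁻ ω, ENNReal.ofReal (s ω ^ 2) ∂μ =
      ∫⁻ ω, ENNReal.ofReal (codebookPow P T g κ n + s ω ^ 2) ∂μ := by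
    have h0 : 0 ≤ codebookPow P T g κ n := by
      unfold codebookPow; split_ifs
      exacts [hP.le, sq_nonneg _]
    simp only [ENNReal.ofReal_add h0 (sq_nonneg _)]
    rw [lintegral_add_left measurable_const, lintegral_const, measure_univ, mul_one]
  rw [hadd]
  rcases lt_or_ge n.val 2 with h | h
  · set i : Fin 2 := ⟨n.val, h⟩
    have e (w : ∀ i, Fin d × Fin 2 → Fin (m i)) : ∫⁻ y, ENNReal.ofReal
        (((scheme P T g κ NC m).codebookBar n (fun i => w i x) (y.1.2 x) + s y.2) ^ 2)
          ∂((mlRandomnessLaw NC Λ).prod μ) =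
        ∫⁻ ω, ENNReal.ofReal ((√P * pam (m i) (w i x) + s ω) ^ 2) ∂μ := by
      simp only [codebookBar_scheme_of_lt_two _ _ n i rfl]
      exact measurePreserving_snd.lintegral_comp
        (f := fun ω => ENNReal.ofReal ((√P * pam (m i) (w i x) + s ω) ^ 2))
        ((measurable_const.add hs).pow_const 2).ennreal_ofReal
    simp only [e]
    have hmw (w : ∀ i, Fin d × Fin 2 → Fin (m i)) : Measurable fun ω =>
        ENNReal.ofReal ((√P * pam (m i) (w i x) + s ω) ^ 2) :=
      ((measurable_const.add hs).pow_const 2).ennreal_ofReal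
    rw [← lintegral_msgAvg hmw]
    refine lintegral_congr fun ω => ?_
    rw [msgAvg_apply (fun i => NeZero.ne _) i x
      fun v => ENNReal.ofReal ((√P * pam (m i) v + s ω) ^ 2), msgAvg_pam hm, Real.sq_sqrt hP.le,
      codebookPow, if_pos h]
  · have e (w : ∀ i, Fin d × Fin 2 → Fin (m i)) : ∫⁻ y, ENNReal.ofReal
        (((scheme P T g κ NC m).codebookBar n (fun i => w i x) (y.1.2 x) + s y.2) ^ 2)
          ∂((mlRandomnessLaw NC Λ).prod μ) =
        ∫⁻ ω, ENNReal.ofReal (codebookPow P T g κ n + s ω ^ 2) ∂μ := by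
      simp only [codebookBar_scheme hP _ _ n h]
      have hx : Measurable fun y : MLRandomness NC d × Ω => y.1.2 x :=
        (measurable_pi_apply x).comp (measurable_snd.comp measurable_fst)
      have hy : Measurable fun y : MLRandomness NC d × Ω =>
          ENNReal.ofReal ((seedCoeff P T g κ n * y.1.2 x + s y.2) ^ 2) :=
        (((hx.const_mul _).add (hs.comp measurable_snd)).pow_const 2).ennreal_ofReal
      rw [lintegral_prod_symm _ hy.aemeasurable]
      refine lintegral_congr fun ω => ?_
      rw [(measurePreserving_seed x).lintegral_comp
        (f := fun u => ENNReal.ofReal ((seedCoeff P T g κ n * u + s ω) ^ 2))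
        (((measurable_id.const_mul _).add measurable_const).pow_const 2).ennreal_ofReal,
        lintegral_affine_sq_gaussianReal, codebookPow, if_neg (not_lt.mpr h)]
    simp only [e]
    exact msgAvg_const _

/-- Codebook and noise part together have the power `P` of the code. Feedback noise and overloads
account for the remaining terms of `hP'`. -/
theorem feedforwardPower_le {S : Matrix (Fin 2) (Fin 2) ℝ} {vt : ℝ} (hvt : 0 ≤ vt)
    (hT : ∀ a : Fin 2 → ℝ, ∑ i, ∑ j, a i * T i j * a j =
      ∑ i, ∑ j, a i * S i j * a j + γ⁻¹ ^ 2 * vt * (∑ i, a i) ^ 2) (hT0 : T.PosSemidef)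
    (hT1 : ∀ i, 0 < T i i) (hg : 0 ≤ g)
    (hP : 0 < P) (hS : S.PosSemidef) (hγ : γ ≠ 0) (hm : ∀ i, 2 ≤ m i)
    {C η : ℝ} (hC0 : 0 ≤ C) (hη : 0 ≤ η) (hC : ∀ x, ‖Λ.mod x‖ ^ 2 ≤ C)
    (hov : ∀ (p : Fin 2) (k : Fin NC), macNoise N S vt (overload P T g κ hN γ p Λ k) ≤
      ENNReal.ofReal η) {P' : ℝ}
    (hP' : d * P + γ⁻¹ ^ 2 * (d * vt + C * (NC * η)) ≤ d * P') :
    ∑ t, (msgAvg fun w => ∫⁻ x, ENNReal.ofReal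
      ((mlScheme (scheme P T g κ NC m) hd Λ (fun _ => γ) N).input w x.1 x.2.1 x.2.2 t ^ 2)
        ∂((mlRandomnessLaw NC Λ).prod (macNoise N S vt))) ≤ ENNReal.ofReal (N * P') := by
  have : ∀ i, NeZero (m i) := fun i => ⟨by have := hm i; omega⟩
  have hdP : 0 ≤ d * P' := le_trans (by positivity) hP'
  have hP0 : 0 ≤ P' := nonneg_of_mul_nonneg_right hdP (by exact_mod_cast hd)
  refine (sum_rounds_le hN (B := ENNReal.ofReal (d * P')) ?_ ?_).trans ?_
  · intro t ht
    simp only [LFC.input_of_le _ hd Λ _ _ _ _ t ht]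
    simpa using msgAvg_const (Msg := fun i => Fin d × Fin 2 → Fin (m i)) 0
  · intro b hb
    set n : Fin NC := ⟨b / 2, by omega⟩ with hn
    set p : Fin 2 := ⟨b % 2, Nat.mod_lt _ two_pos⟩ with hp
    have hslot (j : Fin d) : (⟨b * d + j, block_lt hN hb j.isLt⟩ : Fin N) = slot hN n p j := by
      rw [slot]
      congr 3
      simp only [hn, hp]
      omega
    have hV := (scheme P T g κ NC m).measurable_slotInput Λ (γ := γ) hN p n
    simp only [hslot, LFC.input_slot _ hd Λ hN]
    have e (j : Fin d) := msgAvg_lintegral_codebookBar_add_sq (Λ := Λ) (μ := macNoise N S vt)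
      (T := T) (g := g) (κ := κ) hP hm n (j, p)
      (s := fun ω => (scheme P T g κ NC m).slotInput Λ γ hN p ω.1 ω.2 n j)
      ((show Measurable fun v : EuclideanSpace ℝ (Fin d) => v j by fun_prop).comp hV)
    simp only [e]
    rw [Finset.sum_add_distrib, sum_lintegral_sq_apply hV, Finset.sum_const, Finset.card_univ,
      Fintype.card_fin, nsmul_eq_mul, ← ENNReal.ofReal_natCast, ← ENNReal.ofReal_mul
      (Nat.cast_nonneg _)]
    have hsum := codebookPow_add_noisePow (κ := κ) hP hg hT0 hT1 n
    have hc0 : 0 ≤ codebookPow P T g κ n := by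
      unfold codebookPow; split_ifs
      exacts [hP.le, sq_nonneg _]
    have hle : ∫⁻ ω, ENNReal.ofReal
        (‖(scheme P T g κ NC m).slotInput Λ γ hN p ω.1 ω.2 n‖ ^ 2) ∂(macNoise N S vt) ≤
        ENNReal.ofReal (d * noisePow P T g κ n + γ⁻¹ ^ 2 * (d * vt + C * (NC * η))) := by
      by_cases h0 : n.val = 0
      · have hz (ω : (Fin N → EuclideanSpace ℝ (Fin 2)) × (Fin N → ℝ)) :
            (scheme P T g κ NC m).slotInput Λ γ hN p ω.1 ω.2 n = 0 :=
          LFC.latticeInput_zero _ _ _ _ _ h0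
        simp [hz]
      · exact lintegral_norm_sq_slotInput_le hN hvt hT hT0 hP hS hγ hm hC0 hη hC (hov p) h0
    refine (add_le_add le_rfl hle).trans ?_
    have hn0 : 0 ≤ noisePow P T g κ n := Finset.sum_nonneg fun k _ => quadForm_nonneg hT0 _
    rw [← ENNReal.ofReal_add (by positivity) (by positivity)]
    refine ENNReal.ofReal_le_ofReal (le_trans (le_of_eq ?_) hP')
    rw [← add_assoc, ← mul_add, hsum]
  · rw [← ENNReal.ofReal_natCast, ← ENNReal.ofReal_mul (Nat.cast_nonneg _)]
    refine ENNReal.ofReal_le_ofReal ?_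
    have : ((2 * NC : ℕ) : ℝ) * d ≤ N := by exact_mod_cast hN
    rw [← mul_assoc]
    gcongr

end OzarowLeung

/-! ### Decoding and error probability of the modulo-lattice scheme -/

namespace OzarowLeung

/-- A measurable decision rule that decides for the message point close to its argument. -/
theorem exists_decision (m : ℕ) [NeZero m] : ∃ dec : ℝ → Fin m,
    (∀ v, MeasurableSet (dec ⁻¹' {v})) ∧ ∀ x v, |x - pam m v| < halfDist m → dec x = v := by
  classical
  have huniq (x : ℝ) {v w : Fin m} (hv : |x - pam m v| < halfDist m)
      (hw : |x - pam m w| < halfDist m) : v = w := by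
    by_contra h
    have h1 := two_mul_halfDist_le h
    have h2 := abs_sub_le (pam m v) x (pam m w)
    rw [abs_sub_comm (pam m v) x] at h2
    linarith
  refine ⟨fun x => if h : ∃ v, |x - pam m v| < halfDist m then h.choose else 0, fun v => ?_,
    fun x v hv => ?_⟩
  · have hb (w : Fin m) : MeasurableSet {x : ℝ | |x - pam m w| < halfDist m} :=
      measurableSet_lt (by fun_prop) measurable_const
    -- Arguments close to no message point are all decoded as `0`, which adds one measurable piece
    -- to the preimage of `0`.
    have e : (fun x => if h : ∃ v, |x - pam m v| < halfDist m then h.choose else 0) ⁻¹' {v} =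
        {x : ℝ | |x - pam m v| < halfDist m} ∪
          if v = 0 then (⋃ w, {x : ℝ | |x - pam m w| < halfDist m})ᶜ else ∅ := by
      ext x
      simp only [Set.mem_preimage, Set.mem_singleton_iff, Set.mem_union]
      by_cases h : ∃ v, |x - pam m v| < halfDist m
      · rw [dif_pos h]
        have h3 : x ∉ if v = 0 then (⋃ w, {x : ℝ | |x - pam m w| < halfDist m})ᶜ else ∅ := by
          split_ifs
          · simpa using h
          · simp
        simp only [h3, or_false]
        exact ⟨fun h4 => h4 ▸ h.choose_spec, fun h4 => huniq x h.choose_spec h4⟩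
      · rw [dif_neg h]
        have h3 : x ∉ {x : ℝ | |x - pam m v| < halfDist m} := fun h4 => h ⟨v, h4⟩
        simp only [h3, false_or]
        split_ifs with h0
        · simpa [h0] using h
        · simp [eq_comm, h0]
    rw [e]
    refine (hb v).union ?_
    split_ifs
    · exact (MeasurableSet.iUnion hb).compl
    · exact MeasurableSet.empty
  · have h : ∃ v, |x - pam m v| < halfDist m := ⟨v, hv⟩
    simp only [dif_pos h]
    exact huniq x h.choose_spec hv

variable {P : ℝ} {T : Matrix (Fin 2) (Fin 2) ℝ} {g : ℝ} {κ : Fin 2 → ℝ} {NC d N : ℕ}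
  {m : Fin 2 → ℕ} (hN : 2 * NC * d ≤ N) {γ : ℝ} {p : Fin 2} (hd : 0 < d)
  {Λ : LatticeQuantizer d}

theorem evalWeight_equivNoise (x : Weight) (u : ℝ)
    (ω : (Fin N → EuclideanSpace ℝ (Fin 2)) × (Fin N → ℝ)) (j : Fin d) :
    evalWeight x u (LFC.equivNoise γ (LFC.blockNoise hN p ω.1) (LFC.fbBlockNoise hN p ω.2) j) =
      x.1 * u + slotForm hN p (fun k : Fin NC => x.2 k)
        (fun k : Fin NC => -(if k.val = 0 then 0 else γ⁻¹ * ∑ i, x.2 k i)) ω j := by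
  rw [evalWeight, slotForm, ← Finset.sum_add_distrib]
  refine congrArg (x.1 * u + ·) (Finset.sum_congr rfl fun k _ => ?_)
  simp only [LFC.equivNoise, LFC.blockNoise, LFC.fbBlockNoise, Fin.sum_univ_two]
  split_ifs <;> ring

/-- Without overload, the modulo-lattice scheme simulates the underlying scheme over the equivalent
channel. -/
theorem bcOutput_slot (hP : 0 < P) (hγ : γ ≠ 0) (w : ∀ i, Fin d × Fin 2 → Fin (m i))
    (q : MLRandomness NC d) (ω : (Fin N → EuclideanSpace ℝ (Fin 2)) × (Fin N → ℝ))
    (h : ∀ k, ω ∉ overload P T g κ hN γ p Λ k) (j : Fin d) (k : Fin NC) (i : Fin 2) :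
    (mlScheme (scheme P T g κ NC m) hd Λ (fun _ => γ) N).bcOutput w q ω.1 ω.2 i (slot hN k p j) =
      (scheme P T g κ NC m).output (fun i => w i (j, p)) (q.2 (j, p))
        (LFC.equivNoise γ (LFC.blockNoise hN p ω.1) (LFC.fbBlockNoise hN p ω.2) j) i k := by
  rw [MacScheme.bcOutput, LFC.input_slot _ hd Λ hN]
  refine LFC.codebookBar_add_latticeInput _ Λ hγ (fun i => w i (j, p)) (q.2 (j, p)) _ _ ?_ _ _ j
    (fun _ => rfl) k i
  intro k _
  rw [linearArg_scheme hN hP hγ]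
  exact not_not.mp (h k)

/-- The final error is a Gaussian form in seed, channel noise and feedback noise, with variance at
most that of the equivalent channel. -/
theorem measure_errWeight_ge_le [IsProbabilityMeasure Λ.dither] {S : Matrix (Fin 2) (Fin 2) ℝ}
    {vt : ℝ} (hvt : 0 ≤ vt)
    (hT : ∀ a : Fin 2 → ℝ, ∑ i, ∑ j, a i * T i j * a j =
      ∑ i, ∑ j, a i * S i j * a j + γ⁻¹ ^ 2 * vt * (∑ i, a i) ^ 2) (hT0 : T.PosSemidef)
    (hT1 : ∀ i, 0 < T i i) (hg : 0 ≤ g) (hP : 0 < P) (hS : S.PosSemidef) {k : ℕ} (hk : k + 2 ≤ NC)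
    {a : ℝ} (ha : 0 ≤ a) (i : Fin 2) (j : Fin d) :
    (mlRandomnessLaw NC Λ).prod (macNoise N S vt) {x | a ≤ |evalWeight (errWeight P T g κ k i)
      (x.1.2 (j, p))
        (LFC.equivNoise γ (LFC.blockNoise hN p x.2.1) (LFC.fbBlockNoise hN p x.2.2) j)|} ≤
      ENNReal.ofReal (2 * Real.exp (-a ^ 2 / (2 * (state P T g κ k).var i))) := by
  simp only [evalWeight_equivNoise]
  have h1 := (CenteredGaussian.id_gaussianReal_one.const_mul (errWeight P T g κ k i).1).comp
    (measurePreserving_seed (NC := NC) (Λ := Λ) (j, p))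
  have h2 := centeredGaussian_slotForm hN p hS hvt
    (fun k' : Fin NC => (errWeight P T g κ k i).2 k')
    (fun k' : Fin NC => -(if k'.val = 0 then 0 else γ⁻¹ * ∑ i', (errWeight P T g κ k i).2 k' i')) j
  refine (h1.prod_add h2).measure_abs_ge_le ?_ ha
  rw [← (state_valid (κ := κ) hP hg hT0 hT1 k hk).var_eq i, covForm_apply, Finset.sum_range]
  have := slotVar_le hvt hT fun k' : Fin NC => (errWeight P T g κ k i).2 k'
  rw [mul_one, sq]
  exact add_le_add le_rfl this

/-- Union bound over `2 NC` overloads and over the final errors of two receivers in `2 d` instances.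
Without any of these events every estimate is within `halfDist` of the right point. -/
theorem errorProb_mlScheme_le [IsProbabilityMeasure Λ.dither] {S : Matrix (Fin 2) (Fin 2) ℝ}
    {vt : ℝ} (hvt : 0 ≤ vt)
    (hT : ∀ a : Fin 2 → ℝ, ∑ i, ∑ j, a i * T i j * a j =
      ∑ i, ∑ j, a i * S i j * a j + γ⁻¹ ^ 2 * vt * (∑ i, a i) ^ 2) (hT0 : T.PosSemidef)
    (hT1 : ∀ i, 0 < T i i) (hg : 0 ≤ g) (hP : 0 < P) (hS : S.PosSemidef) (hγ : γ ≠ 0)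
    (hm : ∀ i, 2 ≤ m i) {k : ℕ} (hk : k + 2 = NC) {η β : ℝ} (hη : 0 ≤ η) (hβ0 : 0 ≤ β)
    (hov : ∀ (p : Fin 2) (k : Fin NC), macNoise N S vt (overload P T g κ hN γ p Λ k) ≤
      ENNReal.ofReal η)
    (hβ : ∀ i, 2 * Real.exp (-halfDist (m i) ^ 2 / (2 * (state P T g κ k).var i)) ≤ β) :
    (mlScheme (scheme P T g κ NC m) hd Λ (fun _ => γ) N).errorProb (mlRandomnessLaw NC Λ) S vt ≤
      ENNReal.ofReal (2 * NC * η + 4 * d * β) := by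
  have : ∀ i, NeZero (m i) := fun i => ⟨by have := hm i; omega⟩
  have : NeZero d := ⟨hd.ne'⟩
  choose dec hdec hdec' using fun i => exists_decision (m i)
  set D : ∀ i, MLRandomness NC d → (Fin N → ℝ) → (Fin d × Fin 2 → Fin (m i)) := fun i q y x =>
    dec i (estimate P T g κ (q.2 x) i fun k => y (slot hN k x.2 x.1)) with hD
  have hDm (i : Fin 2) (v : Fin d × Fin 2 → Fin (m i)) :
      MeasurableSet {x : MLRandomness NC d × (Fin N → ℝ) | D i x.1 x.2 = v} := by
    have e : {x : MLRandomness NC d × (Fin N → ℝ) | D i x.1 x.2 = v} =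
        ⋂ a, {x | dec i (estimate P T g κ (x.1.2 a) i fun k => x.2 (slot hN k a.2 a.1)) = v a} := by
      ext x
      simp [hD, funext_iff]
    rw [e]
    refine MeasurableSet.iInter fun a => ?_
    have hest : Measurable fun x : MLRandomness NC d × (Fin N → ℝ) =>
        estimate P T g κ (x.1.2 a) i fun k => x.2 (slot hN k a.2 a.1) := by
      have h1 : Measurable fun x : MLRandomness NC d × (Fin N → ℝ) => x.1.2 a :=
        (measurable_pi_apply a).comp (measurable_snd.comp measurable_fst)
      exact (h1.const_mul _).add (Finset.measurable_sum _ fun k _ =>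
        ((measurable_pi_apply _).comp measurable_snd).const_mul _)
    exact hest (hdec i (v a))
  refine (iInf₂_le D hDm).trans (msgAvg_le_of_le fun w => ?_)
  set A : Fin 2 × Fin NC → Set (MLRandomness NC d ×
      ((Fin N → EuclideanSpace ℝ (Fin 2)) × (Fin N → ℝ))) := fun a =>
    Prod.snd ⁻¹' overload P T g κ hN γ a.1 Λ a.2 with hA
  set B : Fin 2 × (Fin d × Fin 2) → Set (MLRandomness NC d ×
      ((Fin N → EuclideanSpace ℝ (Fin 2)) × (Fin N → ℝ))) := fun b =>
    {x | halfDist (m b.1) ≤ |evalWeight (errWeight P T g κ k b.1) (x.1.2 b.2)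
      (LFC.equivNoise γ (LFC.blockNoise hN b.2.2 x.2.1) (LFC.fbBlockNoise hN b.2.2 x.2.2) b.2.1)|}
    with hB
  have hsub : {x : MLRandomness NC d × ((Fin N → EuclideanSpace ℝ (Fin 2)) × (Fin N → ℝ)) |
      ∃ i, D i x.1 ((mlScheme (scheme P T g κ NC m) hd Λ (fun _ => γ) N).bcOutput w x.1
        x.2.1 x.2.2 i) ≠ w i} ⊆ (⋃ a, A a) ∪ ⋃ b, B b := by
    rintro x ⟨i, hx⟩
    by_contra hx'
    rw [Set.mem_union, not_or, Set.mem_iUnion, Set.mem_iUnion, not_exists, not_exists] at hx'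
    refine hx (funext fun a => hdec' i _ _ ?_)
    have h1 : (fun k => (mlScheme (scheme P T g κ NC m) hd Λ (fun _ => γ) N).bcOutput w x.1
        x.2.1 x.2.2 i (slot hN k a.2 a.1)) = (scheme P T g κ NC m).output (fun i => w i a) (x.1.2 a)
          (LFC.equivNoise γ (LFC.blockNoise hN a.2 x.2.1) (LFC.fbBlockNoise hN a.2 x.2.2) a.1) i :=
      funext fun k' => bcOutput_slot hN hd hP hγ w x.1 x.2 (fun k'' => hx'.1 (a.2, k'')) a.1 k' i
    rw [h1, estimate_scheme _ _ _ hP k hk i]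
    exact not_le.mp (hx'.2 (i, a))
  have hAle (a) : (mlRandomnessLaw NC Λ).prod (macNoise N S vt) (A a) ≤ ENNReal.ofReal η := by
    rw [hA, measurePreserving_snd.measure_preimage
      (measurableSet_overload hN Λ a.2).nullMeasurableSet]
    exact hov a.1 a.2
  have hBle (b) : (mlRandomnessLaw NC Λ).prod (macNoise N S vt) (B b) ≤ ENNReal.ofReal β :=
    (measure_errWeight_ge_le hN hvt hT hT0 hT1 hg hP hS hk.le (halfDist_pos (hm b.1)).le b.1
      b.2.1).trans (ENNReal.ofReal_le_ofReal (hβ b.1))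
  calc _ ≤ _ := measure_mono hsub
    _ ≤ _ := measure_union_le _ _
    _ ≤ ∑ a, ENNReal.ofReal η + ∑ b, ENNReal.ofReal β := add_le_add
        ((measure_iUnion_fintype_le _ _).trans (Finset.sum_le_sum fun a _ => hAle a))
        ((measure_iUnion_fintype_le _ _).trans (Finset.sum_le_sum fun b _ => hBle b))
    _ = _ := by
      simp only [Finset.sum_const, Finset.card_univ, Fintype.card_prod, Fintype.card_fin,
        nsmul_eq_mul]
      rw [← ENNReal.ofReal_natCast, ← ENNReal.ofReal_natCast, ← ENNReal.ofReal_mul (by positivity),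
        ← ENNReal.ofReal_mul (by positivity), ← ENNReal.ofReal_add (by positivity) (by positivity)]
      congr 1
      push_cast
      ring

end OzarowLeung

/-! ### Choice of the number of steps and of the lattice dimension -/

theorem tendsto_mul_sub_sq_div (a : ℝ) {b : ℝ} (hb : 0 < b) :
    Tendsto (fun K : ℕ => a * (K : ℝ) - (K : ℝ) ^ 2 / b) atTop atBot := by
  have h1 : Tendsto (fun K : ℕ => (K : ℝ)) atTop atTop := tendsto_natCast_atTop_atTop
  have h2 : Tendsto (fun K : ℕ => a - (K : ℝ) / b) atTop atBot := by
    have := tendsto_atBot_add_const_left atTop a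
      (tendsto_neg_atTop_atBot.comp (h1.atTop_div_const hb))
    refine this.congr fun K => ?_
    simp [sub_eq_add_neg]
  refine (h1.atTop_mul_atBot₀ h2).congr fun K => ?_
  ring

/-- Since `d ≥ exp (K ^ 2 / 2)`, the quantities `L ^ K` and `K` are subpolynomial in `d`. Since `d ≤
exp ((K + 1) ^ 2)`, a doubly exponential in `K` beats `d`. -/
theorem eventually_steps {L a c δ : ℝ} (hL : 1 ≤ L) (ha : 0 ≤ a) (hc : 0 < c) (hδ : 0 < δ) :
    ∀ᶠ K : ℕ in atTop, 2 ≤ K ∧ ∀ d N : ℝ, Real.exp ((K : ℝ) ^ 2) ≤ N →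
      N ≤ Real.exp (((K : ℝ) + 1) ^ 2) → N ≤ 2 * K * (d + 1) → d ≤ N →
        1 ≤ d ∧ L ^ K * (a * d ^ (-(1 / 4) : ℝ)) ≤ δ ∧ 8 * K ≤ d ∧ K ≤ δ * d ∧
          d * Real.exp (-(Real.exp (c * (K - 2)) / 2)) ≤ δ ∧ K ≤ δ * N := by
  have hexp (b : ℝ) {b' : ℝ} (hb : 0 < b') {M : ℝ} (hM : 0 < M) : ∀ᶠ K : ℕ in atTop,
      Real.exp (b * K - (K : ℝ) ^ 2 / b') ≤ M :=
    (Real.tendsto_exp_atBot.comp (tendsto_mul_sub_sq_div b hb)).eventually_le_const hM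
  have e1 := hexp 3 (b' := 2) two_pos (M := 1) one_pos
  have e2 := hexp (Real.log L) (b' := 8) (by norm_num) (M := δ / (a + 1)) (by positivity)
  have e3 := hexp 3 (b' := 2) two_pos (M := 1 / 8) (by norm_num)
  have e4 := hexp 3 (b' := 2) two_pos hδ
  have e5 : ∀ᶠ K : ℕ in atTop, (K : ℝ) ^ 3 ≤ Real.exp (c * (K - 2)) / 2 := by
    have h := (isLittleO_pow_exp_pos_mul_atTop 3 hc).bound
      (show 0 < Real.exp (-(2 * c)) / 2 by positivity)
    filter_upwards [tendsto_natCast_atTop_atTop.eventually h] with K hK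
    rw [Real.norm_of_nonneg (by positivity), Real.norm_of_nonneg (by positivity)] at hK
    refine hK.trans (le_of_eq ?_)
    rw [show c * ((K : ℝ) - 2) = -(2 * c) + c * K by ring, Real.exp_add]
    ring
  have e6 : ∀ᶠ K : ℕ in atTop, Real.exp (-(K : ℝ)) ≤ δ :=
    (Real.tendsto_exp_atBot.comp (tendsto_neg_atTop_atBot.comp
      tendsto_natCast_atTop_atTop)).eventually_le_const hδ
  filter_upwards [e1, e2, e3, e4, e5, e6, eventually_ge_atTop 4] with K h1 h2 h3 h4 h5 h6 h7
  refine ⟨by omega, fun d N hN1 hN2 hd1 hd2 => ?_⟩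
  have hK : (4 : ℝ) ≤ K := by exact_mod_cast h7
  have hKe : (K : ℝ) ≤ Real.exp K := (by linarith [Real.add_one_le_exp (K : ℝ)])
  set E := Real.exp ((K : ℝ) ^ 2 / 2) with hE
  have hEsq : Real.exp ((K : ℝ) ^ 2) = E * E := by rw [hE, ← Real.exp_add]; ring_nf
  have h3K (M : ℝ) (h : Real.exp (3 * K - (K : ℝ) ^ 2 / 2) ≤ M) : Real.exp (3 * K) ≤ M * E := by
    rwa [Real.exp_sub, div_le_iff₀ (Real.exp_pos _)] at h
  have h3e : Real.exp (3 * K) = Real.exp K * Real.exp K * Real.exp K := by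
    rw [← Real.exp_add, ← Real.exp_add]; ring_nf
  have h4e : 4 * Real.exp K ≤ Real.exp (3 * K) := by
    rw [h3e]
    have : (0 : ℝ) < Real.exp K := Real.exp_pos _
    nlinarith
  have hE1 : 1 < E := Real.one_lt_exp_iff.mpr (by positivity)
  -- Otherwise `N ≤ 2 K (d + 1) < 4 K E ≤ E ^ 2`, against `E ^ 2 ≤ N`.
  have hEd : E ≤ d := by
    by_contra hlt
    rw [not_le] at hlt
    have h8 := h3K 1 h1
    have : N < E * E := by
      calc N ≤ 2 * K * (d + 1) := hd1
        _ < 2 * K * (E + E) := by gcongr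
        _ = 4 * K * E := by ring
        _ ≤ E * E := by gcongr; linarith
    linarith
  have hd0 : 0 < d := by linarith
  refine ⟨hE1.le.trans hEd, ?_, ?_, ?_, ?_, ?_⟩
  · have h8 : d ^ (-(1 / 4) : ℝ) ≤ Real.exp (-((K : ℝ) ^ 2 / 8)) := by
      calc d ^ (-(1 / 4) : ℝ) ≤ E ^ (-(1 / 4) : ℝ) :=
            Real.rpow_le_rpow_of_nonpos (by positivity) hEd (by norm_num)
        _ = _ := by rw [hE, ← Real.exp_mul]; ring_nf
    have h9 : L ^ K = Real.exp (Real.log L * K) := by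
      rw [mul_comm, Real.exp_nat_mul, Real.exp_log (by linarith)]
    calc L ^ K * (a * d ^ (-(1 / 4) : ℝ)) ≤ L ^ K * (a * Real.exp (-((K : ℝ) ^ 2 / 8))) := by gcongr
      _ = a * Real.exp (Real.log L * K - (K : ℝ) ^ 2 / 8) := by
        rw [h9, sub_eq_add_neg, Real.exp_add]; ring
      _ ≤ a * (δ / (a + 1)) := by gcongr
      _ = δ * (a / (a + 1)) := by ring
      _ ≤ δ * 1 := by gcongr; rw [div_le_one (by positivity)]; linarith
      _ = δ := mul_one δ
  · have h8 := h3K _ h3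
    linarith
  · have h8 := h3K _ h4
    have := mul_le_mul_of_nonneg_left hEd hδ.le
    linarith
  · have h8 : ((K : ℝ) + 1) ^ 2 + K ≤ (K : ℝ) ^ 3 := by nlinarith
    calc d * Real.exp (-(Real.exp (c * (K - 2)) / 2))
        ≤ Real.exp (((K : ℝ) + 1) ^ 2) * Real.exp (-(K : ℝ) ^ 3) := by
          gcongr
          exact hd2.trans hN2
      _ = Real.exp (((K : ℝ) + 1) ^ 2 - (K : ℝ) ^ 3) := by rw [← Real.exp_add]; ring_nf
      _ ≤ Real.exp (-(K : ℝ)) := Real.exp_le_exp.mpr (by linarith)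
      _ ≤ δ := h6
  · have h8 := h3K _ h4
    have := mul_le_mul_of_nonneg_left (hEd.trans hd2) hδ.le
    linarith

/-- For a given length, a number of steps that grows slowly enough. -/
theorem exists_steps : ∃ K : ℕ → ℕ, Tendsto K atTop atTop ∧ ∀ᶠ N : ℕ in atTop,
    Real.exp ((K N : ℝ) ^ 2) ≤ N ∧ (N : ℝ) ≤ Real.exp (((K N : ℝ) + 1) ^ 2) := by
  refine ⟨fun N => ⌊√(Real.log N)⌋₊, ?_, ?_⟩
  · exact tendsto_nat_floor_atTop.comp (Real.tendsto_sqrt_atTop.comp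
      (Real.tendsto_log_atTop.comp tendsto_natCast_atTop_atTop))
  · filter_upwards [eventually_ge_atTop 1] with N hN
    have hN1 : (1 : ℝ) ≤ N := by exact_mod_cast hN
    have h0 := Real.log_nonneg hN1
    have h1 := Nat.floor_le (Real.sqrt_nonneg (Real.log N))
    have h2 := (Nat.lt_floor_add_one √(Real.log N)).le
    constructor
    · rw [← Real.le_log_iff_exp_le (by linarith)]
      calc _ ≤ √(Real.log N) ^ 2 := by gcongr
        _ = _ := Real.sq_sqrt h0
    · rw [← Real.log_le_iff_le_exp (by linarith)]
      calc Real.log N = √(Real.log N) ^ 2 := (Real.sq_sqrt h0).symm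
        _ ≤ _ := by gcongr

/-! ### All requirements for one modulo-lattice scheme -/

namespace OzarowLeung

variable {P : ℝ} {T : Matrix (Fin 2) (Fin 2) ℝ} {g : ℝ} {κ : Fin 2 → ℝ} {NC d N : ℕ}
  {m : Fin 2 → ℕ} (hN : 2 * NC * d ≤ N) {γ : ℝ} (hd : 0 < d)
  {Λ : LatticeQuantizer d}

theorem measurable_codebook_scheme (n : Fin NC) (w : ∀ i, Fin (m i)) :
    Measurable ((scheme P T g κ NC m).codebook n w) := by
  simp only [scheme]
  split_ifs
  · exact measurable_const
  · exact measurable_const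
  · fun_prop

include hN in
theorem achieves_mlScheme [IsProbabilityMeasure Λ.dither] {S : Matrix (Fin 2) (Fin 2) ℝ}
    {vt : ℝ} (hvt : 0 ≤ vt)
    (hT : ∀ a : Fin 2 → ℝ, ∑ i, ∑ j, a i * T i j * a j =
      ∑ i, ∑ j, a i * S i j * a j + γ⁻¹ ^ 2 * vt * (∑ i, a i) ^ 2) (hT0 : T.PosSemidef)
    (hT1 : ∀ i, 0 < T i i) (hg : 0 ≤ g) (hP : 0 < P) (hS : S.PosSemidef) (hγ : γ ≠ 0)
    (hm : ∀ i, 2 ≤ m i) {k : ℕ} (hk : k + 2 = NC) {C η β : ℝ} (hC0 : 0 ≤ C) (hη : 0 ≤ η)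
    (hβ0 : 0 ≤ β) (hC : ∀ x, ‖Λ.mod x‖ ^ 2 ≤ C)
    (hΛ : ∀ s, 0 ≤ s → s ^ 2 ≤ γ ^ 2 * P + vt →
      stdGaussian (EuclideanSpace ℝ (Fin d)) {x | Λ.mod (s • x) ≠ s • x} ≤ ENNReal.ofReal η)
    (hβ : ∀ i, 2 * Real.exp (-halfDist (m i) ^ 2 / (2 * (state P T g κ k).var i)) ≤ β)
    {P' : ℝ} (hP' : d * P + γ⁻¹ ^ 2 * (d * vt + C * (NC * η)) ≤ d * P') {R : Fin 2 → ℝ} {ε : ℝ}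
    (hN0 : 0 < N) (hR : ∀ i, N * (R i - ε) ≤ 2 * d * Real.logb 2 (m i))
    (hε : 2 * NC * η + 4 * d * β ≤ ε) :
    (mlScheme (scheme P T g κ NC m) hd Λ (fun _ => γ) N).Achieves (mlRandomnessLaw NC Λ) P' S
      Λ.secondMoment vt R ε := by
  have : ∀ i, NeZero (m i) := fun i => ⟨by have := hm i; omega⟩
  have hov (p : Fin 2) (n : Fin NC) :
      macNoise N S vt (overload P T g κ hN γ p Λ n) ≤ ENNReal.ofReal η := by
    refine measure_overload_le hN hvt hT hS hγ hΛ ?_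
    have h1 := codebookPow_add_noisePow (κ := κ) hP hg hT0 hT1 n
    have h2 : 0 ≤ codebookPow P T g κ n := by
      unfold codebookPow; split_ifs
      exacts [hP.le, sq_nonneg _]
    have h3 : noisePow P T g κ n ≤ P := by linarith
    gcongr
  refine ⟨fun i => inferInstance, inferInstance,
    LFC.isMeasurable_mlScheme _ hd Λ measurable_codebook_scheme,
    feedforwardPower_le hN hd hvt hT hT0 hT1 hg hP hS hγ hm hC0 hη hC hov hP', fun i => ?_,
    fun i => ?_, ?_⟩
  · rw [sum_msgAvg]
    exact msgAvg_le_of_le fun w =>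
      LFC.feedbackPower_le _ hd Λ hN measurable_codebook_scheme hC S vt w i
  · rw [le_div_iff₀ (by exact_mod_cast hN0), mul_comm]
    refine (hR i).trans (le_of_eq ?_)
    rw [Fintype.card_fun, Fintype.card_prod, Fintype.card_fin, Fintype.card_fin, Fintype.card_fin]
    push_cast
    rw [Real.logb_pow]
    push_cast
    ring
  · exact (errorProb_mlScheme_le hN hd hvt hT hT0 hT1 hg hP hS hγ hm hk hη hβ0 hov hβ).trans
      (ENNReal.ofReal_le_ofReal hε)

end OzarowLeung

/-! ### The equivalent channel -/

theorem posSemidef_of_quadForm {S : Matrix (Fin 2) (Fin 2) ℝ} (h : S 0 1 = S 1 0)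
    (hS : ∀ a b : ℝ, 0 ≤ a ^ 2 * S 0 0 + 2 * a * b * S 0 1 + b ^ 2 * S 1 1) : S.PosSemidef := by
  refine Matrix.PosSemidef.of_dotProduct_mulVec_nonneg ?_ fun x => ?_
  · ext i j
    fin_cases i <;> fin_cases j <;> simp [Matrix.conjTranspose_apply, h]
  · refine (hS (x 0) (x 1)).trans (le_of_eq ?_)
    simp [dotProduct, Matrix.mulVec, Fin.sum_univ_two, ← h]
    ring

theorem posSemidef_bcCov {σ₁ σ₂ r : ℝ} (hr : |r| ≤ 1) : (bcCov σ₁ σ₂ r).PosSemidef := by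
  refine posSemidef_of_quadForm (by simp [bcCov]) fun a b => ?_
  have h1 : 0 ≤ 1 - r ^ 2 := by
    have := (sq_le_one_iff_abs_le_one r).mpr hr
    linarith
  have h2 : 0 ≤ (a * σ₁ + r * (b * σ₂)) ^ 2 + (1 - r ^ 2) * (b * σ₂) ^ 2 := by positivity
  refine h2.trans (le_of_eq ?_)
  simp [bcCov]
  ring

section equivalent

variable {P Pt vt : ℝ} {S : Matrix (Fin 2) (Fin 2) ℝ}

theorem posSemidef_eqCov (hP : 0 < P) (hvt : 0 ≤ vt) (hPt : vt < Pt) (hS : S.PosSemidef) :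
    (eqCov P S Pt vt).PosSemidef := by
  have hPt0 : 0 < Pt := hvt.trans_lt hPt
  refine hS.add (Matrix.PosSemidef.smul ?_ (by positivity))
  refine posSemidef_of_quadForm (by simp) fun a b => ?_
  have := sq_nonneg (a + b)
  simp
  linarith

theorem eqCov_diag_pos (hP : 0 < P) (hvt : 0 ≤ vt) (hPt : vt < Pt) (hS : ∀ i, 0 < S i i)
    (i : Fin 2) : 0 < eqCov P S Pt vt i i := by
  have hPt0 : 0 < Pt := hvt.trans_lt hPt
  have h : eqCov P S Pt vt i i = S i i + vt * P / Pt := by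
    fin_cases i <;> simp [eqCov]
  rw [h]
  have := hS i
  positivity

theorem eqPower_pos (hP : 0 < P) (hvt : 0 ≤ vt) (hPt : vt < Pt) : 0 < eqPower P Pt vt :=
  mul_pos hP (sub_pos.mpr ((div_lt_one (hvt.trans_lt hPt)).mpr hPt))

/-- The constant `c` stands for `γ⁻¹ ^ 2`: the scaled feedback noise is common to both receivers and
adds a multiple of the all-ones matrix. -/
theorem quadForm_eqCov (c : ℝ) (hc : c = P / Pt) (a : Fin 2 → ℝ) :
    ∑ i, ∑ j, a i * eqCov P S Pt vt i j * a j =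
      ∑ i, ∑ j, a i * S i j * a j + c * vt * (∑ i, a i) ^ 2 := by
  subst hc
  simp [eqCov, Fin.sum_univ_two]
  ring

end equivalent

/-! ### Choice of all parameters -/

namespace OzarowLeung

/-- The squared half distance is at least `3 / m ^ 2`, and `e < 3` absorbs the change of the
variance by a factor `e`. -/
theorem exp_neg_halfDist_le {m : ℕ} (hm : 2 ≤ m) {v v' a : ℝ} (hv' : 0 < v')
    (h : v' ≤ Real.exp 1 * v) (ha : (m : ℝ) ^ 2 * v ≤ Real.exp (-a)) :
    2 * Real.exp (-halfDist m ^ 2 / (2 * v')) ≤ 2 * Real.exp (-(Real.exp a / 2)) := by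
  have hm4 : (4 : ℝ) ≤ (m : ℝ) ^ 2 := by
    have : (2 : ℝ) ≤ m := by exact_mod_cast hm
    nlinarith
  have hh : 3 / (m : ℝ) ^ 2 ≤ halfDist m ^ 2 := by
    rw [halfDist, Real.sq_sqrt (div_nonneg (by norm_num) (by linarith))]
    exact div_le_div_of_nonneg_left (by norm_num) (by linarith) (by linarith)
  gcongr
  rw [neg_div, neg_le_neg_iff, div_le_div_iff₀ two_pos (by positivity)]
  have h1 : Real.exp a * ((m : ℝ) ^ 2 * v) ≤ 1 := by
    calc _ ≤ Real.exp a * Real.exp (-a) := by gcongr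
      _ = 1 := by rw [← Real.exp_add]; simp
  have h2 : Real.exp 1 < 3 := by linarith [Real.exp_one_lt_d9]
  have h3 : Real.exp a * v' * (m : ℝ) ^ 2 ≤ 3 := by
    calc _ ≤ Real.exp a * (Real.exp 1 * v) * (m : ℝ) ^ 2 := by gcongr
      _ = Real.exp 1 * (Real.exp a * ((m : ℝ) ^ 2 * v)) := by ring
      _ ≤ Real.exp 1 * 1 := by gcongr
      _ ≤ 3 := by linarith
  have h4 : Real.exp a * v' ≤ 3 / (m : ℝ) ^ 2 := by rwa [le_div_iff₀ (by linarith)]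
  linarith

theorem tendsto_dimension {K : ℕ → ℕ} (hK : Tendsto K atTop atTop)
    (hKN : ∀ᶠ N : ℕ in atTop,
      Real.exp ((K N : ℝ) ^ 2) ≤ N ∧ (N : ℝ) ≤ Real.exp (((K N : ℝ) + 1) ^ 2)) :
    Tendsto (fun N : ℕ => N / (2 * K N)) atTop atTop := by
  rw [tendsto_atTop]
  intro b
  have h := eventually_steps le_rfl (L := 1) (a := 0) le_rfl one_pos
    (δ := 1 / ((b : ℝ) + 1)) (by positivity)
  filter_upwards [hKN, hK.eventually h, eventually_ge_atTop 1] with N hN h hN1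
  have hd1 : (N : ℝ) ≤ 2 * K N * ((N / (2 * K N) : ℕ) + 1 : ℝ) := by
    have := (Nat.lt_mul_div_succ N (show 0 < 2 * K N by omega)).le
    exact_mod_cast this
  have hd2 : ((N / (2 * K N) : ℕ) : ℝ) ≤ N := by exact_mod_cast Nat.div_le_self _ _
  obtain ⟨-, -, -, h5, -⟩ := h.2 _ N hN.1 hN.2 hd1 hd2
  have h6 : (2 : ℝ) ≤ K N := by exact_mod_cast h.1
  have h7 : ((b : ℝ) + 1) * K N ≤ (N / (2 * K N) : ℕ) := by
    rw [one_div, inv_mul_eq_div, le_div_iff₀ (by positivity)] at h5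
    linarith
  have h8 : (b : ℝ) ≤ (N / (2 * K N) : ℕ) := by
    have : (0 : ℝ) ≤ b := b.cast_nonneg
    nlinarith
  exact_mod_cast h8

-- The design power is `P' = Pe - 4 P x` with `x = d ^ (-1/4)`: then `γ ^ 2 P' + vt = Pt (1 - 4 x)`,
-- which is the variance that the lattice tolerates. The rest is checking that the small losses fit.
set_option maxHeartbeats 600000 in
theorem region_subset_moduloLatticeOLRegion {P Pt vt : ℝ} {S : Matrix (Fin 2) (Fin 2) ℝ}
    (hP : 0 < P) (hvt : 0 ≤ vt) (hPt : vt < Pt) (hS : S.PosSemidef) (hS1 : ∀ i, 0 < S i i)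
    {g : ℝ} (hg : 0 ≤ g) (κ : Fin 2 → ℝ) :
    region (eqPower P Pt vt) (eqCov P S Pt vt) g κ ⊆ moduloLatticeOLRegion P S Pt vt g κ := by
  intro R hR
  refine ⟨hR.1, fun ε hε => ?_⟩
  have hPt0 : 0 < Pt := hvt.trans_lt hPt
  have hT0 := posSemidef_eqCov hP hvt hPt hS
  have hT1 := eqCov_diag_pos hP hvt hPt hS1
  have hPe := eqPower_pos hP hvt hPt
  set T := eqCov P S Pt vt with hTdef
  set Pe := eqPower P Pt vt with hPedef
  obtain ⟨L, hL, htrack⟩ := exists_abs_log_var_sub_le hPe hg hT0 hT1 κ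
  obtain ⟨c, hc, hsizes⟩ := exists_message_sizes hPe hg hT0 hT1 hR (half_pos hε)
  set ρ := R 0 + R 1 + 1 with hρ
  have hρ0 : 0 < ρ := by have := hR.1 0; have := hR.1 1; positivity
  have hRρ (i : Fin 2) : R i ≤ ρ := by
    have := hR.1 0; have := hR.1 1
    fin_cases i <;> simp [hρ] <;> linarith
  -- In turn: variances change by a factor `e` at most, `P'` stays in `[Pe / 2, Pe]`, total error at
  -- most `10 δ ≤ ε`, and loss of rate by rounding.
  set δ := min (min 1 (Pe / 2)) (min (ε / 16) (ε / (4 * ρ))) with hδ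
  have hδ0 : 0 < δ := by positivity
  have hδ1 : δ ≤ 1 := (min_le_left _ _).trans (min_le_left _ _)
  have hδ2 : δ ≤ Pe / 2 := (min_le_left _ _).trans (min_le_right _ _)
  have hδ3 : δ ≤ ε / 16 := (min_le_right _ _).trans (min_le_left _ _)
  have hδ4 : δ ≤ ε / (4 * ρ) := (min_le_right _ _).trans (min_le_right _ _)
  have hsteps := eventually_steps hL (a := 4 * P) (by positivity) hc hδ0
  obtain ⟨K, hK, hKN⟩ := exists_steps
  have hdim := tendsto_dimension hK hKN
  filter_upwards [hKN, hK.eventually hsteps, hK.eventually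
    ((tendsto_sub_atTop_nat 2).eventually hsizes),
    hdim.eventually (LatticeQuantizer.eventually_exists_good hPt0), eventually_ge_atTop 1]
    with N hN hst hsz hlat hN1
  set NC := K N with hNC
  set d := N / (2 * NC) with hd
  have hNd : 2 * NC * d ≤ N := Nat.mul_div_le _ _
  have hd1 : (N : ℝ) ≤ 2 * NC * ((d : ℕ) + 1 : ℝ) := by
    have := (Nat.lt_mul_div_succ N (show 0 < 2 * NC by omega)).le
    exact_mod_cast this
  have hd2 : (d : ℝ) ≤ N := by exact_mod_cast Nat.div_le_self _ _
  obtain ⟨hNC2, hst⟩ := hst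
  obtain ⟨hdge, hx, h8, hKd, herr, hKNδ⟩ := hst d N hN.1 hN.2 hd1 hd2
  have hd0 : 0 < d := by
    have : (0 : ℝ) < d := by linarith
    exact_mod_cast this
  obtain ⟨k, hk⟩ : ∃ k, k + 2 = NC := ⟨NC - 2, by omega⟩
  have hk' : NC - 2 = k := by omega
  have hkR : (NC : ℝ) - 2 = k := by rw [← hk]; push_cast; ring
  rw [hk'] at hsz
  obtain ⟨m, hm2, hmR, hmv⟩ := hsz
  obtain ⟨Λ, hΛ, hprob, hΛC, hΛov⟩ := hlat
  have hdR : (0 : ℝ) < d := by exact_mod_cast hd0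
  set x := (d : ℝ) ^ (-(1 / 4) : ℝ) with hxdef
  have hx0 : 0 < x := Real.rpow_pos_of_pos hdR _
  have hxd : 1 ≤ x * d := by
    have : x * d = (d : ℝ) ^ (3 / 4 : ℝ) := by
      rw [hxdef]
      nth_rewrite 2 [← Real.rpow_one (d : ℝ)]
      rw [← Real.rpow_add hdR]
      norm_num
    rw [this]
    exact Real.one_le_rpow hdge (by norm_num)
  have hLK : 1 ≤ L ^ NC := one_le_pow₀ hL
  have hPx : 4 * P * x ≤ δ := le_trans (le_mul_of_one_le_left (by positivity) hLK) hx
  have hPx0 : 0 < 4 * P * x := by positivity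
  set P' := Pe - 4 * P * x with hP'
  have hP'0 : 0 < P' := by linarith
  have hγ2 : √(Pt / P) ^ 2 = Pt / P := Real.sq_sqrt (by positivity)
  have hγ0 : √(Pt / P) ≠ 0 := (Real.sqrt_pos.mpr (by positivity)).ne'
  have hγi : (√(Pt / P))⁻¹ ^ 2 = P / Pt := by rw [inv_pow, hγ2, inv_div]
  refine ⟨P', NC, d, hd0, Λ, m, hP'0, by linarith, by linarith, hNd, hΛ, hm2, ?_⟩
  -- The message sizes were chosen for the power `Pe`; the variances of the scheme for `P'` exceed
  -- those for `Pe` at most by a factor `e`.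
  have hvar (i : Fin 2) : (state P' T g κ k).var i ≤ Real.exp 1 * (state Pe T g κ k).var i := by
    have h1 := htrack P' ⟨by linarith, by linarith⟩ k i
    have h2 : L ^ (k + 1) * (Pe - P') ≤ 1 := by
      have h3 : L ^ (k + 1) ≤ L ^ NC := pow_le_pow_right₀ hL (by omega)
      calc L ^ (k + 1) * (Pe - P') ≤ L ^ NC * (Pe - P') := by
            gcongr; linarith
        _ = L ^ NC * (4 * P * x) := by rw [hP']; ring
        _ ≤ 1 := hx.trans hδ1
    have hv1 := state_var_pos (κ := κ) hP'0 hg hT0 hT1 k i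
    have hv2 := state_var_pos (κ := κ) hPe hg hT0 hT1 k i
    rw [← Real.log_le_log_iff hv1 (by positivity), Real.log_mul (Real.exp_pos 1).ne' hv2.ne',
      Real.log_exp]
    linarith [(abs_le.mp h1).2]
  set β := 2 * Real.exp (-(Real.exp (c * (NC - 2)) / 2)) with hβ
  have hβi (i : Fin 2) :
      2 * Real.exp (-halfDist (m i) ^ 2 / (2 * (state P' T g κ k).var i)) ≤ β := by
    refine exp_neg_halfDist_le (hm2 i) (state_var_pos (κ := κ) hP'0 hg hT0 hT1 k i)
      (hvar i) ?_
    rw [hkR]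
    exact hmv i
  have hηd : (NC : ℝ) * ((d : ℝ) ^ 3)⁻¹ ≤ δ / d ^ 2 := by
    rw [← div_eq_mul_inv, div_le_div_iff₀ (by positivity) (by positivity)]
    calc (NC : ℝ) * d ^ 2 ≤ δ * d * d ^ 2 := by gcongr
      _ = _ := by ring
  have hmain := achieves_mlScheme (P := P') (T := T) (g := g) (κ := κ) (m := m) (R := R) (ε := ε)
    (P' := P) hNd hd0 (Λ := Λ) (γ := √(Pt / P)) hvt
    (fun a => by rw [hγi]; exact quadForm_eqCov _ rfl a) hT0 hT1 hg hP'0 hS hγ0 hm2 hk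
    (C := 32 * (d : ℝ) ^ 2 * Pt) (η := ((d : ℝ) ^ 3)⁻¹) (β := β) (by positivity) (by positivity)
    (by positivity) hΛC ?_ hβi ?_ hN1 ?_ ?_
  · rwa [hΛ] at hmain
  · intro s hs hs2
    refine hΛov s hs (hs2.trans (le_of_eq ?_))
    rw [hγ2, hP', hPedef, eqPower]
    field_simp
    ring
  · rw [hγi, hP', hPedef, eqPower]
    have e1 : P / Pt * (d * vt + 32 * (d : ℝ) ^ 2 * Pt * (NC * ((d : ℝ) ^ 3)⁻¹)) =
        d * (P * (vt / Pt)) + 32 * P * (NC / d) := by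
      field_simp
    -- The power `4 P x` saved per transmission pays for the overloads.
    have e2 : (8 : ℝ) * (NC / d) ≤ x * d := by
      refine le_trans ?_ hxd
      rw [← mul_div_assoc, div_le_one hdR]
      exact h8
    have e3 := mul_le_mul_of_nonneg_left e2 (show 0 ≤ 4 * P by positivity)
    rw [e1]
    linarith
  · intro i
    have h1 : (NC : ℝ) * (R i - ε / 2) ≤ Real.logb 2 (m i) := by
      have := hmR i
      rwa [hk] at this
    have hl0 : 0 ≤ Real.logb 2 (m i) := Real.logb_nonneg one_lt_two (by
      have : (2 : ℝ) ≤ m i := by exact_mod_cast hm2 i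
      linarith)
    have hNR : (1 : ℝ) ≤ N := by exact_mod_cast hN1
    -- For tiny rates two message points suffice. Otherwise the rounds lost in rounding `N` to a
    -- multiple of `2 NC` cost at most `N ε / 2`.
    rcases le_or_gt (R i - ε / 2) 0 with h | h
    · refine le_trans ?_ (show (0 : ℝ) ≤ 2 * d * Real.logb 2 (m i) by positivity)
      nlinarith
    · have h2 : (NC : ℝ) * (4 * ρ) ≤ ε * N := by
        calc (NC : ℝ) * (4 * ρ) ≤ δ * N * (4 * ρ) := by gcongr
          _ ≤ ε / (4 * ρ) * N * (4 * ρ) := by gcongr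
          _ = ε * N := by field_simp
      have h3 : (NC : ℝ) * (4 * R i) ≤ ε * N := by
        refine le_trans ?_ h2
        have := hRρ i
        gcongr
      calc (N : ℝ) * (R i - ε) = N * (R i - ε / 2) - N * ε / 2 := by ring
        _ ≤ 2 * NC * (d + 1) * (R i - ε / 2) - N * ε / 2 := by gcongr
        _ = 2 * d * (NC * (R i - ε / 2)) + 2 * NC * (R i - ε / 2) - N * ε / 2 := by ring
        _ ≤ 2 * d * (NC * (R i - ε / 2)) := by
          have : 0 ≤ (NC : ℝ) * ε := by positivity
          linarith
        _ ≤ 2 * d * Real.logb 2 (m i) := by gcongr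
  · have h1 : δ / (d : ℝ) ^ 2 ≤ δ := div_le_self hδ0.le (one_le_pow₀ hdge)
    have h2 : 4 * d * β = 8 * (d * Real.exp (-(Real.exp (c * (NC - 2)) / 2))) := by
      rw [hβ]; ring
    rw [h2, mul_assoc]
    linarith

end OzarowLeung

/-! ### From the modulo-lattice scheme to the whole rate region -/

theorem moduloLatticeOLRegion_subset_setup1Region {P Pt vt : ℝ} {S : Matrix (Fin 2) (Fin 2) ℝ}
    {g : ℝ} {κ : Fin 2 → ℝ} : moduloLatticeOLRegion P S Pt vt g κ ⊆ setup1Region P S Pt vt := by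
  refine fun R hR => ⟨hR.1, fun ε hε => ?_⟩
  filter_upwards [hR.2 ε hε] with N hN
  obtain ⟨P', NC, d, hd, Λ, m, -, -, -, -, -, -, h⟩ := hN
  exact ⟨_, inferInstance, _, inferInstance, _, _, h⟩

/-- Half of `ε` serves for approximating the rates by an achievable pair, the other half for the
scheme. -/
theorem isClosed_setup1Region (P : ℝ) (S : Matrix (Fin 2) (Fin 2) ℝ) (Pt vt : ℝ) :
    IsClosed (setup1Region P S Pt vt) := by
  refine isClosed_of_closure_subset fun R hR => ?_
  rw [Metric.mem_closure_iff] at hR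
  have happrox (ε : ℝ) (hε : 0 < ε) : ∃ R' ∈ setup1Region P S Pt vt, ∀ i, |R i - R' i| < ε := by
    obtain ⟨R', hR', h⟩ := hR ε hε
    exact ⟨R', hR', fun i => (dist_le_pi_dist R R' i).trans_lt h⟩
  constructor
  · intro i
    by_contra h
    obtain ⟨R', hR', h'⟩ := happrox (-R i) (by linarith)
    have h1 := hR'.1 i
    have h2 := (abs_lt.mp (h' i)).1
    linarith
  · intro ε hε
    obtain ⟨R', hR', h'⟩ := happrox (ε / 2) (half_pos hε)
    filter_upwards [hR'.2 (ε / 2) (half_pos hε)] with N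
    rintro ⟨Msg, iM, Q, iQ, ν, C, h1, h2, h3, h4, h5, h6, h7⟩
    refine ⟨Msg, iM, Q, iQ, ν, C, h1, h2, h3, h4, h5, fun i => ?_,
      h7.trans (ENNReal.ofReal_le_ofReal (by linarith))⟩
    have h8 := h6 i
    have h9 := (abs_lt.mp (h' i)).2
    linarith

end

theorem mainTheorem2 (P Pt σ₁ σ₂ r σt : ℝ) (hP : 0 < P) (hσ₁ : 0 < σ₁) (hσ₂ : 0 < σ₂)
    (hr : |r| ≤ 1) (hσt : 0 ≤ σt) (hPt : σt ^ 2 < Pt) :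
    -- over Setup 2, the Ozarow–Leung scheme has constant transmission power
    (∀ (g : ℝ) (κ : Fin 2 → ℝ), 0 ≤ g → ∀ (N : ℕ) (m : Fin 2 → ℕ), (∀ i, 2 ≤ m i) → ∀ n : Fin N,
      (OzarowLeung.scheme (eqPower P Pt (σt ^ 2)) (eqCov P (bcCov σ₁ σ₂ r) Pt (σt ^ 2))
        g κ N m).power (eqCov P (bcCov σ₁ σ₂ r) Pt (σt ^ 2)) n =
          ENNReal.ofReal (eqPower P Pt (σt ^ 2))) ∧
    -- what it achieves over Setup 2, its modulo-lattice version achieves over Setup 1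
    (∀ (g : ℝ) (κ : Fin 2 → ℝ), 0 ≤ g →
      OzarowLeung.region (eqPower P Pt (σt ^ 2)) (eqCov P (bcCov σ₁ σ₂ r) Pt (σt ^ 2)) g κ ⊆
        moduloLatticeOLRegion P (bcCov σ₁ σ₂ r) Pt (σt ^ 2) g κ) ∧
    -- hence its whole rate region for Setup 2 is achievable over Setup 1
    OzarowLeung.fullRegion (eqPower P Pt (σt ^ 2)) (eqCov P (bcCov σ₁ σ₂ r) Pt (σt ^ 2)) ⊆
      setup1Region P (bcCov σ₁ σ₂ r) Pt (σt ^ 2) := by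
  have hPt0 : 0 ≤ σt ^ 2 := sq_nonneg σt
  have hS : (bcCov σ₁ σ₂ r).PosSemidef := posSemidef_bcCov hr
  have hS1 (i : Fin 2) : 0 < bcCov σ₁ σ₂ r i i := by
    fin_cases i <;> simp [bcCov] <;> positivity
  have h2 (g : ℝ) (κ : Fin 2 → ℝ) (hg : 0 ≤ g) :=
    OzarowLeung.region_subset_moduloLatticeOLRegion hP hPt0 hPt hS hS1 hg κ
  refine ⟨fun g κ hg N m hm n => OzarowLeung.power_scheme (eqPower_pos hP hPt0 hPt) hg
    (posSemidef_eqCov hP hPt0 hPt hS) (eqCov_diag_pos hP hPt0 hPt hS1) κ N hm n, h2, ?_⟩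
  refine closure_minimal ?_ (isClosed_setup1Region _ _ _ _)
  exact Set.iUnion_subset fun g => Set.iUnion_subset fun hg => Set.iUnion_subset fun κ =>
    (h2 g κ hg).trans moduloLatticeOLRegion_subset_setup1Region
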